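/- Let $R$ be a field of characteristic $0$. A \emph{trivalent diagram} is a finite connected trivalent graph $D$ (loops and multiple edges allowed) with an embedded oriented circle $S^1\subset D$ and a cyclic order of the three half-edges at every vertex outside $S^1$; diagrams are taken up to isomorphism respecting these data, and the circle without vertices is allowed. It is a \emph{chord diagram} if all its vertices lie on $S^1$. Its degree is half its number of vertices. Let $A=\bigoplus_d A_d$ be the graded $R$-vector space generated by trivalent diagrams modulo the relations (STU) $S=T-U$: here a vertex $p$ of $S$ on $S^1$ is joined by an edge to a vertex $v$ outside $S^1$, with cyclic order $(e,x,y)$ at $v$, where $e$ is the half-edge leading to $p$; in $T$ and $U$ the points $p,v$ and the edge joining them are removed and $p$ is replaced by two consecutive points $q_1,q_2$ of the oriented circle, where in $T$ the strand $y$ is attached to $q_1$ and $x$ to $q_2$, and in $U$ the strand $x$ is attached to $q_1$ and $y$ to $q_2$. For a subset $s$ of $\pi_0(D\setminus S^1)$ let $D_s$ be the diagram consisting of $S^1$ and the components in $s$, and let $\Delta:A\to A\otimes A$ be the linear map with $\Delta(D)=\sum_{s\subseteq \pi_0(D\setminus S^1)}D_s\otimes D_{s^c}$. Write $1\in A$ for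 the class of the circle without vertices, and $P(A)_d=\{a\in A_d\mid \Delta(a)=a\otimes 1+1\otimes a\}$. Let $\mathcal C$ be the $R$-vector space generated by isomorphism classes of finite simple graphs (including the empty graph) with positive integer vertex weights, modulo the relations $G=G'_e-G''_e$ for all edges $e$, where $G'_e$ is $G$ with $e$ removed and $G''_e$ is obtained from $G'_e$ by contracting the two end points of $e$ to one vertex, whose weight is the sum of their weights, and replacing multiple edges by single ones. The \emph{universal chromatic weight system} $\overline\Gamma:A\to\mathcal C$ is the linear map that sends every chord diagram to its intersection graph (vertices: the chords; edges: pairs of chords whose end points alternate on $S^1$) with all weights equal to $1$. Equip each vertex of $D$ on $S^1$ with the cyclic order (outgoing arc of the circle, half-edge off the circle, incoming arc of the circle). Consider the embeddings of $D$ into an oriented $2$-sphere up to orientation preserving homeomorphism of the sphere, i.e. (if $D$ has at least one vertex) the choices of a cyclic order of the half-edges at every vertex for which the associated closed oriented surface has Euler characteristic $2$; the circle without vertices has exactly one embedding. For an embedding $\iota$ let $\sigma(\iota)$ be the number of vertices at which the counterclockwise cyclic order induced by $\iota$ differs from the given one, and let $E:A\to R$ be the linear map with $$E(D)=\sum_{\iota}(-1)^{\sigma(\iota)}$$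 for all trivalent diagrams $D$, the sum being over all these embeddings. Then each of the linear maps $\Delta$, $\overline\Gamma$ and $E$ exists and is uniquely determined by the stated values. Moreover $P(A)_0=0$, and for every $d\ge 1$ and every primitive element $a\in P(A)_d$ $$\overline\Gamma(a)=\tfrac12\,E(a)\,\bullet_d ,$$ where $\bullet_d\in\mathcal C$ is the class of the graph with a single vertex, of weight $d$. -/

import Mathlib

open scoped TensorProduct

noncomputable section

/-! ### Trivalent diagrams -/

/-- The vertex of a half-edge lying off the oriented circle. For a set `C` of vertices on the
circle and a set `I` of vertices off the circle, these half-edges form `C ⊕ I × Fin 3`: a circle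
vertex has exactly one of them, an inner vertex has three. -/
def legVertex {C I : Type} : C ⊕ I × Fin 3 → C ⊕ I :=
  Sum.map id Prod.fst

/-- `u` and `w` are joined by an edge that is not an arc of the circle. -/
def LegAdj {C I : Type} (pair : C ⊕ I × Fin 3 → C ⊕ I × Fin 3) (u w : C ⊕ I) : Prop :=
  ∃ h, legVertex h = u ∧ legVertex (pair h) = w

/-- A finite trivalent graph with an embedded oriented circle.
The vertices on the circle form the cyclically ordered finite set `Circ` (the cyclic order
is the one in which they are met along the oriented circle), the other vertices form the finite set
`Inner`. The cyclic order of the half-edges at an inner vertex `i` is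
`(i, 0) → (i, 1) → (i, 2) → (i, 0)`. The edges that are not arcs of the circle are the orbits of
the fixed point free involution `pair`. The graph is connected, i.e. every inner vertex is
joined to the circle. -/
structure TrivalentDiagram where
  Circ : Type
  Inner : Type
  [circularOrder : CircularOrder Circ]
  [fintypeCirc : Fintype Circ]
  [fintypeInner : Fintype Inner]
  pair : Circ ⊕ Inner × Fin 3 → Circ ⊕ Inner × Fin 3
  pair_pair : ∀ h, pair (pair h) = h
  pair_ne : ∀ h, pair h ≠ h
  connected : ∀ i : Inner, ∃ c : Circ, Relation.ReflTransGen (LegAdj pair) (Sum.inr i) (Sum.inl c)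

namespace TrivalentDiagram

attribute [instance] circularOrder fintypeCirc fintypeInner

/-- The vertices of the diagram. -/
abbrev Vertex (D : TrivalentDiagram) : Type := D.Circ ⊕ D.Inner

/-- The half-edges off the circle. -/
abbrev Leg (D : TrivalentDiagram) : Type := D.Circ ⊕ D.Inner × Fin 3

/-- The degree: half the number of vertices. -/
def deg (D : TrivalentDiagram) : ℕ := Fintype.card D.Vertex / 2

/-- Chord diagrams: all vertices lie on the circle. -/
def IsChordDiagram (D : TrivalentDiagram) : Prop := IsEmpty D.Inner

/-- Equivalence of diagrams: an isomorphism of graphs that respects the oriented circle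
and the cyclic orders at the inner vertices. -/
def Equivalent (D D' : TrivalentDiagram) : Prop :=
  ∃ (e : D.Circ ≃ D'.Circ) (f : D.Inner ≃ D'.Inner) (r : D.Inner → Fin 3),
    (∀ a b c, sbtw a b c ↔ sbtw (e a) (e b) (e c)) ∧
    ∀ h, D'.pair (Sum.map e (fun x => (f x.1, x.2 + r x.1)) h) =
      Sum.map e (fun x => (f x.1, x.2 + r x.1)) (D.pair h)

/-- The circle without vertices. -/
def circle : TrivalentDiagram :=
  letI : CircularOrder Empty :=
    { btw := fun _ _ _ => True
      btw_refl := fun a => a.elim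
      btw_cyclic_left := fun {a} => a.elim
      sbtw_trans_left := fun {a} => a.elim
      btw_antisymm := fun {a} => a.elim
      btw_total := fun a => a.elim }
  { Circ := Empty
    Inner := Empty
    pair := id
    pair_pair := fun _ => rfl
    pair_ne := fun h => h.elim (fun c => c.elim) (fun x => x.1.elim)
    connected := fun i => i.elim }

/-! ### The components of the complement of the circle, and subdiagrams -/

/-- The set of connected components of `D ∖ S¹`. -/
def Component (D : TrivalentDiagram) : Type := Quot (LegAdj D.pair)

/-- The component of `D ∖ S¹` at a vertex. -/
def comp (D : TrivalentDiagram) (v : D.Vertex) : D.Component := Quot.mk _ v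

instance (D : TrivalentDiagram) : Finite D.Component :=
  inferInstanceAs (Finite (Quot (LegAdj D.pair)))

instance (D : TrivalentDiagram) : Fintype (Set D.Component) := Fintype.ofFinite _

theorem comp_legVertex_pair (D : TrivalentDiagram) (h : D.Leg) :
    D.comp (legVertex (D.pair h)) = D.comp (legVertex h) :=
  (Quot.sound ⟨h, rfl, rfl⟩).symm

/-- The circular order on a subset. -/
@[reducible]
def subCircularOrder {α : Type} [CircularOrder α] (p : α → Prop) :
    CircularOrder {a // p a} where
  btw a b c := btw a.1 b.1 c.1
  sbtw a b c := sbtw a.1 b.1 c.1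
  btw_refl a := btw_refl a.1
  btw_cyclic_left h := btw_cyclic_left h
  sbtw_iff_btw_not_btw := sbtw_iff_btw_not_btw
  sbtw_trans_left h h' := sbtw_trans_left h h'
  btw_antisymm h h' := by simpa only [Subtype.ext_iff] using btw_antisymm h h'
  btw_total a b c := btw_total a.1 b.1 c.1

section sub

variable (D : TrivalentDiagram) (s : Set D.Component)

/-- The circle vertices of the subdiagram carried by the components in `s`. -/
abbrev SubCirc : Type := {c : D.Circ // D.comp (Sum.inl c) ∈ s}

/-- The inner vertices of the subdiagram carried by the components in `s`. -/
abbrev SubInner : Type := {i : D.Inner // D.comp (Sum.inr i) ∈ s}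

/-- The half-edges of the subdiagram as half-edges of the diagram. -/
def subIncl : D.SubCirc s ⊕ D.SubInner s × Fin 3 → D.Leg :=
  Sum.map Subtype.val (Prod.map Subtype.val id)

theorem subIncl_mem (x : D.SubCirc s ⊕ D.SubInner s × Fin 3) :
    D.comp (legVertex (D.subIncl s x)) ∈ s := by
  rcases x with c | ⟨i, k⟩
  · exact c.2
  · exact i.2

/-- A half-edge of the diagram belonging to a component in `s`, as half-edge of the subdiagram. -/
def subLeg : (h : D.Leg) → D.comp (legVertex h) ∈ s → D.SubCirc s ⊕ D.SubInner s × Fin 3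
  | Sum.inl c, hs => Sum.inl ⟨c, hs⟩
  | Sum.inr (i, k), hs => Sum.inr (⟨i, hs⟩, k)

theorem subIncl_subLeg (h : D.Leg) (hs : D.comp (legVertex h) ∈ s) :
    D.subIncl s (D.subLeg s h hs) = h := by
  rcases h with c | ⟨i, k⟩ <;> rfl

theorem subIncl_injective : Function.Injective (D.subIncl s) := by
  rintro (⟨c, hc⟩ | ⟨⟨i, hi⟩, k⟩) (⟨c', hc'⟩ | ⟨⟨i', hi'⟩, k'⟩) h <;>
    simp_all [subIncl]

/-- The involution of the subdiagram. -/
def subPair (x : D.SubCirc s ⊕ D.SubInner s × Fin 3) : D.SubCirc s ⊕ D.SubInner s × Fin 3 :=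
  D.subLeg s (D.pair (D.subIncl s x))
    ((D.comp_legVertex_pair _).symm ▸ D.subIncl_mem s x)

theorem subIncl_subPair (x : D.SubCirc s ⊕ D.SubInner s × Fin 3) :
    D.subIncl s (D.subPair s x) = D.pair (D.subIncl s x) :=
  D.subIncl_subLeg s _ _

/-- A vertex of the diagram belonging to a component in `s`, as vertex of the subdiagram. -/
def subVertex : (v : D.Vertex) → D.comp v ∈ s → D.SubCirc s ⊕ D.SubInner s
  | Sum.inl c, hs => Sum.inl ⟨c, hs⟩
  | Sum.inr i, hs => Sum.inr ⟨i, hs⟩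

theorem legVertex_subLeg (h : D.Leg) (hs : D.comp (legVertex h) ∈ s) :
    legVertex (D.subLeg s h hs) = D.subVertex s (legVertex h) hs := by
  rcases h with c | ⟨i, k⟩ <;> rfl

theorem subVertex_congr {u w : D.Vertex} (h : u = w) (hu : D.comp u ∈ s) (hw : D.comp w ∈ s) :
    D.subVertex s u hu = D.subVertex s w hw := by
  subst h; rfl

theorem sub_connected {u w : D.Vertex} (h : Relation.ReflTransGen (LegAdj D.pair) u w)
    (hu : D.comp u ∈ s) : ∃ hw : D.comp w ∈ s,
      Relation.ReflTransGen (LegAdj (D.subPair s)) (D.subVertex s u hu) (D.subVertex s w hw) := by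
  induction h with
  | refl => exact ⟨hu, .refl⟩
  | @tail b c _ hbc ih =>
    obtain ⟨hb, ih⟩ := ih
    obtain ⟨l, rfl, rfl⟩ := hbc
    have hc : D.comp (legVertex (D.pair l)) ∈ s := (D.comp_legVertex_pair l).symm ▸ hb
    refine ⟨hc, ih.tail ⟨D.subLeg s l hb, D.legVertex_subLeg s l hb, ?_⟩⟩
    rw [subPair, legVertex_subLeg]
    exact D.subVertex_congr s (by rw [subIncl_subLeg]) _ _

/-- The subdiagram of `D` obtained by removing all components of `D ∖ S¹` that are not in `s`. -/
def sub : TrivalentDiagram :=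
  letI : CircularOrder (D.SubCirc s) := subCircularOrder _
  { Circ := D.SubCirc s
    Inner := D.SubInner s
    fintypeCirc := Fintype.ofFinite _
    fintypeInner := Fintype.ofFinite _
    pair := D.subPair s
    pair_pair := fun h => D.subIncl_injective s (by
      rw [subIncl_subPair, subIncl_subPair, D.pair_pair])
    pair_ne := fun h hh => D.pair_ne (D.subIncl s h) (by rw [← subIncl_subPair, hh])
    connected := fun i => by
      obtain ⟨c, hc⟩ := D.connected i.1
      obtain ⟨hw, h⟩ := D.sub_connected s hc i.2
      exact ⟨⟨c, hw⟩, h⟩ }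

end sub

/-! ### The (STU)-relation -/

/-- `T` arises from `S` by removing the circle vertex `p`, the inner vertex `v` and the edge joining
them, replacing `p` by two neighbouring circle vertices `q₁`, `q₂` (in this order along the
circle), and attaching to them the two remaining edges at `v`, the one of the half-edge `(v, a)`
to `q₁` and the one of the half-edge `(v, b)` to `q₂`. The map `γ` identifies the other
circle vertices of `T` with those of `S`, and `ι` does this for the inner vertices; `j` is the
resulting identification of the half-edges of `T` with half-edges of `S`. -/
def IsResolution (S : TrivalentDiagram) (p : S.Circ) (v : S.Inner) (a b : Fin 3)
    (T : TrivalentDiagram) : Prop :=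
  ∃ (q₁ q₂ : T.Circ) (γ : T.Circ → S.Circ) (ι : T.Inner → S.Inner) (j : T.Leg → S.Leg),
    q₁ ≠ q₂ ∧
    (∀ t, γ t = p ↔ t = q₁ ∨ t = q₂) ∧
    (∀ c, c ≠ p → ∃! t, γ t = c) ∧
    (∀ t t' t'', sbtw (γ t) (γ t') (γ t'') → sbtw t t' t'') ∧
    (∀ t, t ≠ q₁ → t ≠ q₂ → sbtw q₁ q₂ t) ∧
    Function.Injective ι ∧ Set.range ι = {v}ᶜ ∧
    j (Sum.inl q₁) = Sum.inr (v, a) ∧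
    j (Sum.inl q₂) = Sum.inr (v, b) ∧
    (∀ t, t ≠ q₁ → t ≠ q₂ → j (Sum.inl t) = Sum.inl (γ t)) ∧
    (∀ i k, j (Sum.inr (i, k)) = Sum.inr (ι i, k)) ∧
    ∀ h, S.pair (j h) = j (T.pair h)

/-- The triples of the (STU)-relation `S = T - U`. In `S` the circle vertex `p` is joined to the
inner vertex `v` by the half-edge `(v, k)`; the cyclic order at `v` is
`(v, k) → (v, k + 1) → (v, k + 2)`. Drawing `p` at the bottom of the counterclockwise circle and `v`
above it, `(v, k + 1)` leaves to the right and `(v, k + 2)` to the left; in `T` these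
two strands go straight down to the circle, in `U` they cross. -/
def IsSTU (S T U : TrivalentDiagram) : Prop :=
  ∃ (p : S.Circ) (v : S.Inner) (k : Fin 3), S.pair (Sum.inl p) = Sum.inr (v, k) ∧
    S.IsResolution p v (k + 2) (k + 1) T ∧ S.IsResolution p v (k + 1) (k + 2) U

/-! ### Embeddings into an oriented 2-sphere -/

/-- All half-edges of `D`. At every vertex, `0 → 1 → 2 → 0` is the chosen cyclic order. At a
circle vertex, `0` is the outgoing arc of the circle, `1` the half-edge off the circle
and `2` the incoming arc; this is the counterclockwise order when the circle is drawn
counterclockwise with the rest of the diagram in its interior. -/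
abbrev Dart (D : TrivalentDiagram) : Type := D.Vertex × Fin 3

/-- A half-edge off the circle as an element of `Dart`. -/
def legDart (D : TrivalentDiagram) : D.Leg → D.Dart :=
  Sum.elim (fun c => (Sum.inl c, 1)) (fun x => (Sum.inr x.1, x.2))

/-- `b` is the vertex that follows `a` on the circle (`b = a` if `a` is the only one). -/
def IsNext (D : TrivalentDiagram) (a b : D.Circ) : Prop :=
  (∀ x, ¬ sbtw a x b) ∧ (a = b → ∀ x, x = a)

/-- `d` and `e` are the two half-edges of one edge of `D`. -/
def Joined (D : TrivalentDiagram) (d e : D.Dart) : Prop :=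
  (∃ h : D.Leg, d = D.legDart h ∧ e = D.legDart (D.pair h)) ∨
  ∃ a b : D.Circ, D.IsNext a b ∧
    ((d = (Sum.inl a, 0) ∧ e = (Sum.inl b, 2)) ∨ (d = (Sum.inl b, 2) ∧ e = (Sum.inl a, 0)))

open Classical in
/-- The next half-edge in counterclockwise order around a vertex, if the counterclockwise order is
the opposite of the chosen one exactly at the vertices in `F`. -/
def turn (D : TrivalentDiagram) (F : Finset D.Vertex) (d : D.Dart) : D.Dart :=
  (d.1, if d.1 ∈ F then d.2 - 1 else d.2 + 1)

/-- The step along the boundary of a face: traverse the edge of `d`, then turn. -/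
def FaceStep (D : TrivalentDiagram) (F : Finset D.Vertex) (d d' : D.Dart) : Prop :=
  ∃ e, D.Joined d e ∧ d' = D.turn F e

/-- A cyclic order of the three half-edges at each vertex of `D` is given by the set `F` of vertices
where it is the opposite of the chosen one. These cyclic orders are the counterclockwise
ones of an embedding of the connected graph `D` into an oriented closed surface with
disks as complementary regions, unique up to orientation preserving homeomorphism. The
surface is the 2-sphere iff `V - E + F = 2`. (The circle without vertices has exactly one
embedding into the 2-sphere, up to orientation preserving homeomorphism.) So the finsets `F` with
this property are the embeddings of `D` into an oriented 2-sphere. -/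
def IsSphereEmbedding (D : TrivalentDiagram) (F : Finset D.Vertex) : Prop :=
  IsEmpty D.Vertex ∨
    Nat.card D.Vertex + Nat.card (Quot (D.FaceStep F)) = Nat.card (Quot D.Joined) + 2

open Classical in
/-- The signed number of embeddings of `D` into an oriented 2-sphere. The sign of an embedding is
`-1` to the number of vertices where the counterclockwise cyclic order is not the chosen one. -/
def embeddingNumber (D : TrivalentDiagram) : ℤ :=
  ∑ F : Finset D.Vertex with D.IsSphereEmbedding F, (-1) ^ F.card

end TrivalentDiagram

/-! ### The space `A` -/

/-- The relations of `A`: equivalent diagrams are identified, and the (STU)-relation. -/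
inductive DiagramRel (R : Type*) [Field R] : (TrivalentDiagram →₀ R) → Prop
  | equivalent (D D' : TrivalentDiagram) (h : D.Equivalent D') :
      DiagramRel R (Finsupp.single D 1 - Finsupp.single D' 1)
  | stu (S T U : TrivalentDiagram) (h : TrivalentDiagram.IsSTU S T U) :
      DiagramRel R (Finsupp.single S 1 - (Finsupp.single T 1 - Finsupp.single U 1))

/-- The vector space `A` of trivalent diagrams modulo the (STU)-relation. -/
abbrev DiagramSpace (R : Type*) [Field R] :=
  (TrivalentDiagram →₀ R) ⧸ Submodule.span R {x | DiagramRel R x}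

/-- The class of a diagram in `A`. -/
def diagramClass (R : Type*) [Field R] (D : TrivalentDiagram) : DiagramSpace R :=
  Submodule.Quotient.mk (Finsupp.single D 1)

/-- The homogeneous part `A_d` of degree `d`. -/
def DiagramSpace.homogeneous (R : Type*) [Field R] (d : ℕ) : Submodule R (DiagramSpace R) :=
  Submodule.span R {x | ∃ D : TrivalentDiagram, D.deg = d ∧ x = diagramClass R D}

/-- The coproduct of `A`: the sum over all maps from the set of components of `D ∖ S¹` to a set
with two elements. -/
def IsCoproduct (R : Type*) [Field R]
    (Δ : DiagramSpace R →ₗ[R] DiagramSpace R ⊗[R] DiagramSpace R) : Prop :=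
  ∀ D : TrivalentDiagram, Δ (diagramClass R D) =
    ∑ s : Set D.Component, diagramClass R (D.sub s) ⊗ₜ[R] diagramClass R (D.sub sᶜ)

/-- Primitive elements; the unit of `A` is the class of the circle without vertices. -/
def IsPrimitiveFor (R : Type*) [Field R]
    (Δ : DiagramSpace R →ₗ[R] DiagramSpace R ⊗[R] DiagramSpace R) (a : DiagramSpace R) : Prop :=
  Δ a = a ⊗ₜ[R] diagramClass R TrivalentDiagram.circle +
    diagramClass R TrivalentDiagram.circle ⊗ₜ[R] a

/-- The weight system `E : A → R` counting embeddings into an oriented 2-sphere. -/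
def IsEmbeddingWeightSystem (R : Type*) [Field R] (E : DiagramSpace R →ₗ[R] R) : Prop :=
  ∀ D : TrivalentDiagram, E (diagramClass R D) = (D.embeddingNumber : R)

/-! ### Weighted graphs, the space `C` and the universal chromatic weight system -/

/-- Finite simple graphs with positive integral weights of the vertices. -/
structure WeightedGraph where
  V : Type
  [finite : Finite V]
  graph : SimpleGraph V
  weight : V → ℕ+

namespace WeightedGraph

attribute [instance] finite

/-- Isomorphism of weighted graphs. -/
def Isomorphic (G H : WeightedGraph) : Prop :=
  ∃ e : G.graph ≃g H.graph, ∀ v, H.weight (e v) = G.weight v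

/-- `G'_e`: the edge `e = {v, w}` is removed. -/
def deleteEdge (G : WeightedGraph) (v w : G.V) : WeightedGraph where
  V := G.V
  graph := G.graph.deleteEdges {s(v, w)}
  weight := G.weight

open Classical in
/-- `G''_e`: the edge `e = {v, w}` is removed, `v` and `w` are contracted to one vertex whose
weight is the sum of the weights of `v` and `w`, and multiple edges are replaced by unique edges.
The new vertex is represented by `v`. -/
def contractEdge (G : WeightedGraph) (v w : G.V) (hvw : v ≠ w) : WeightedGraph where
  V := {x : G.V // x ≠ w}
  graph :=
    let π : G.V → {x : G.V // x ≠ w} := fun x => if h : x = w then ⟨v, hvw⟩ else ⟨x, h⟩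
    SimpleGraph.fromRel fun a b => ∃ x y, π x = a ∧ π y = b ∧ G.graph.Adj x y
  weight x := if x.1 = v then G.weight v + G.weight w else G.weight x.1

/-- The graph with a single vertex of weight `d`. -/
def singleVertex (d : ℕ+) : WeightedGraph where
  V := Unit
  graph := ⊥
  weight := fun _ => d

end WeightedGraph

/-- The relations of `C`: isomorphic weighted graphs are identified, and the chromatic relation
`G = G'_e - G''_e` for all edges `e`. -/
inductive ChromaticRel (R : Type*) [Field R] : (WeightedGraph →₀ R) → Prop
  | isomorphic (G H : WeightedGraph) (h : G.Isomorphic H) :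
      ChromaticRel R (Finsupp.single G 1 - Finsupp.single H 1)
  | chromatic (G : WeightedGraph) (v w : G.V) (h : G.graph.Adj v w) :
      ChromaticRel R (Finsupp.single G 1 -
        (Finsupp.single (G.deleteEdge v w) 1 - Finsupp.single (G.contractEdge v w h.ne) 1))

/-- The vector space `C` of weighted graphs modulo the chromatic relations. -/
abbrev ChromaticSpace (R : Type*) [Field R] :=
  (WeightedGraph →₀ R) ⧸ Submodule.span R {x | ChromaticRel R x}

/-- The class of a weighted graph in `C`. -/
def graphClass (R : Type*) [Field R] (G : WeightedGraph) : ChromaticSpace R :=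
  Submodule.Quotient.mk (Finsupp.single G 1)

/-- The intersection graph of a chord diagram, all weights being one. The vertices are the
chords, i.e. the components of `D ∖ S¹`. Two chords are adjacent iff
their endpoints are met in alternating order on the circle. -/
def TrivalentDiagram.intersectionGraph (D : TrivalentDiagram) : WeightedGraph where
  V := D.Component
  graph := SimpleGraph.fromRel fun a b => ∃ x x' y y' : D.Circ,
    D.comp (Sum.inl x) = a ∧ D.comp (Sum.inl x') = a ∧
    D.comp (Sum.inl y) = b ∧ D.comp (Sum.inl y') = b ∧ sbtw x y x' ∧ sbtw x' y' x
  weight := fun _ => 1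

/-- The universal chromatic weight system `A → C`: the linear map sending every chord diagram to
its intersection graph. -/
def IsUniversalChromatic (R : Type*) [Field R] (Γ : DiagramSpace R →ₗ[R] ChromaticSpace R) : Prop :=
  ∀ D : TrivalentDiagram, D.IsChordDiagram →
    Γ (diagramClass R D) = graphClass R D.intersectionGraph

end

/-!
The weight systems are compared by cutting the universal chromatic weight system into pieces that
count planar drawings.

A chord diagram is drawn on a sphere by placing every chord on one of the two sides of the circle so
that crossing chords are on different sides (`TrivalentDiagram.IsChordDiagram.isSphereEmbedding_iff`).
The combinatorial condition `V - E + F = 2` is related to crossings by linear algebra over the field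
with two elements: the functions on the set of faces are mapped to their jumps across the chords and
across one arc of the circle, the kernel consists of the constants, so the genus is zero iff this map
(`TrivalentDiagram.jumps`) is surjective, i.e. iff the surface is separated by the circle and by every
closed curve that consists of a chord and an arc of the circle.

Let `ζ(D)` be the signed number of embeddings of `D` with the whole diagram on the inner side of the
circle. Both `ζ` and the count `E` of all embeddings satisfy the (STU)-relation
(`TrivalentDiagram.signedCount_stu`): contracting the edge between `p` and `v` in `S`, or the new arc
of the circle in `T` or `U`, leaves the same combinatorial map, and the remaining embeddings of `T`
and `U` cancel. On a chord diagram `ζ` is one or zero according to whether the intersection graph has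
no edges, hence `E = (ζ ⊗ ζ) ∘ Δ`, since this holds on chord diagrams, which span `A`.

In `C` every graph is a combination of complete graphs (`WeightedGraph.graphClass_eq_sum`):
`[G] = ∑ₖ 1/k! ∑_κ [K_k]`, where `κ` runs through the proper colourings with exactly `k` colours and
the weights of the complete graph `K_k` are those of the colour classes. For an intersection graph a
colouring is a distribution of the chords to `k` planar sides, so the sum over all `κ` is the
`k`-fold iterated coproduct followed by `ζ` on all factors, restricted to factors of positive degree
(`iteratedCount_chord`). This formula makes sense on all of `A`. It shows that the universal chromatic
weight system exists, and since the iterated reduced coproducts of a primitive element `a` of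
degree `d` vanish, only `k = 1` contributes: its value is `ζ(a) •_d`. On the other hand
`E(a) = ζ(a) ζ(1) + ζ(1) ζ(a) = 2 ζ(a)`.
-/

/-! ### Finite circular orders -/

/-- The map that identifies the new point `none` of `Option α` with `p`. -/
def collapse {α : Type} (p : α) : Option α → α := fun o => o.getD p

@[simp] theorem collapse_none {α : Type} (p : α) : collapse p none = p := rfl

@[simp] theorem collapse_some {α : Type} (p x : α) : collapse p (some x) = x := rfl

section CircularOrder

variable {α : Type} [CircularOrder α]

theorem sbtw_or_sbtw_of_ne {a b c : α} (hab : a ≠ b) (hbc : b ≠ c) (hca : c ≠ a) :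
    sbtw a b c ∨ sbtw c b a := by
  by_contra! h
  rcases (btw_iff_not_sbtw.2 h.1).antisymm (btw_iff_not_sbtw.2 h.2) with h | h | h
  exacts [hbc h.symm, hab h.symm, hca h.symm]

theorem SBtw.sbtw.ne_left {a b c : α} (h : sbtw a b c) : a ≠ b := by
  rintro rfl; exact sbtw_irrefl_left h

theorem SBtw.sbtw.ne_right {a b c : α} (h : sbtw a b c) : b ≠ c := by
  rintro rfl; exact sbtw_irrefl_right h

theorem SBtw.sbtw.ne_outer {a b c : α} (h : sbtw a b c) : a ≠ c := by
  rintro rfl; exact sbtw_irrefl_left_right h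

open Classical in
/-- The linear order obtained by cutting a circular order open in front of `p`, so that `p`
becomes the least element. -/
@[reducible]
noncomputable def cutOrder (p : α) : LinearOrder α where
  le x y := x = p ∨ x = y ∨ sbtw p x y
  lt x y := (x = p ∧ y ≠ p) ∨ sbtw p x y
  le_refl x := Or.inr (Or.inl rfl)
  le_trans x y z := by
    rintro (rfl | rfl | h) h'
    · exact Or.inl rfl
    · exact h'
    · rcases h' with rfl | rfl | h'
      · exact (sbtw_irrefl_left_right h).elim
      · exact Or.inr (Or.inr h)
      · exact Or.inr (Or.inr (h.cyclic_left.trans_left h'.cyclic_left).cyclic_right)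
  le_antisymm x y := by
    rintro (rfl | rfl | h) (h' | h' | h')
    · exact h'.symm
    · exact h'.symm
    · exact (sbtw_irrefl_left_right h').elim
    · rfl
    · rfl
    · rfl
    · exact (sbtw_irrefl_left_right (h' ▸ h)).elim
    · exact h'.symm
    · exact (h.cyclic_left.not_sbtw h').elim
  le_total x y := by
    by_cases hx : x = p
    · exact Or.inl (Or.inl hx)
    by_cases hy : y = p
    · exact Or.inr (Or.inl hy)
    by_cases hxy : x = y
    · exact Or.inl (Or.inr (Or.inl hxy))
    rcases sbtw_or_sbtw_of_ne (Ne.symm hx) hxy hy with h | h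
    · exact Or.inl (Or.inr (Or.inr h))
    · exact Or.inr (Or.inr (Or.inr h.cyclic_left.cyclic_left))
  lt_iff_le_not_ge x y := by
    constructor
    · rintro (⟨rfl, h⟩ | h)
      · exact ⟨Or.inl rfl, by
          rintro (h' | h' | h')
          exacts [h h', h h', sbtw_irrefl_left_right h']⟩
      · refine ⟨Or.inr (Or.inr h), ?_⟩
        rintro (rfl | rfl | h')
        exacts [sbtw_irrefl_left_right h, sbtw_irrefl_right h,
          h.cyclic_left.not_sbtw h']
    · rintro ⟨h | rfl | h, h'⟩
      · exact Or.inl ⟨h, fun hy => h' (Or.inl hy)⟩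
      · exact (h' (Or.inr (Or.inl rfl))).elim
      · exact Or.inr h
  toDecidableLE := Classical.decRel _

theorem cutOrder_lt_iff (p x y : α) :
    (cutOrder p).lt x y ↔ (x = p ∧ y ≠ p) ∨ sbtw p x y := Iff.rfl

/-- The circular order is recovered from each of its cuts. -/
theorem sbtw_iff_cutOrder (p x y z : α) : letI := cutOrder p
    sbtw x y z ↔ (x < y ∧ y < z) ∨ (y < z ∧ z < x) ∨ (z < x ∧ x < y) := by
  let := cutOrder p
  have key : ∀ x y z : α, x < y → y < z → sbtw x y z := by
    rintro x y z (⟨rfl, h⟩ | h) (⟨h1, h1'⟩ | h')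
    · exact absurd h1 h
    · exact h'
    · exact absurd (h1 ▸ h) sbtw_irrefl_left_right
    · exact (h'.cyclic_left.trans_right h.cyclic_right).cyclic_right
  constructor
  · intro h
    have h1 := h.ne_left
    have h2 := h.ne_right
    have h3 := h.ne_outer
    by_contra! hc
    have aux : (z < y ∧ y < x) ∨ (y < x ∧ x < z) ∨ (x < z ∧ z < y) := by
      rcases lt_or_gt_of_ne h1 with a | a <;> rcases lt_or_gt_of_ne h2 with b | b <;>
        rcases lt_or_gt_of_ne h3 with c | c <;> grind
    rcases aux with ⟨a, b⟩ | ⟨a, b⟩ | ⟨a, b⟩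
    · exact h.not_sbtw (key _ _ _ a b)
    · exact h.not_sbtw (key _ _ _ a b).cyclic_right
    · exact h.not_sbtw (key _ _ _ a b).cyclic_left
  · rintro (⟨a, b⟩ | ⟨a, b⟩ | ⟨a, b⟩)
    · exact key _ _ _ a b
    · exact (key _ _ _ a b).cyclic_right
    · exact (key _ _ _ a b).cyclic_left

/-- `b` is the successor of `a` in the circular order (`b = a` if there is no other point). -/
def IsCircularNext (a b : α) : Prop := (∀ x, ¬ sbtw a x b) ∧ (a = b → ∀ x, x = a)

theorem exists_isCircularNext [Finite α] (a : α) : ∃ b, IsCircularNext a b := by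
  by_cases h : ∀ x, x = a
  · exact ⟨a, fun x => by rw [h x]; exact sbtw_irrefl a, fun _ => h⟩
  push Not at h
  let := cutOrder a
  obtain ⟨b, hb, hmin⟩ := Set.exists_min_image {x | x ≠ a} id (Set.toFinite _) h
  refine ⟨b, fun x hx => ?_, fun hab => (hb hab.symm).elim⟩
  have h1 : x < b := Or.inr hx
  exact absurd (hmin x hx.ne_left.symm) (not_le.2 h1)

theorem IsCircularNext.eq {a b c : α} (hb : IsCircularNext a b) (hc : IsCircularNext a c) :
    b = c := by
  by_contra hbc
  have hab : a ≠ b := fun h => hbc ((hb.2 h b).trans (hb.2 h c).symm)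
  have hac : a ≠ c := fun h => hbc ((hc.2 h b).trans (hc.2 h c).symm)
  rcases sbtw_or_sbtw_of_ne hab hbc hac.symm with h | h
  · exact hc.1 b h
  · exact hb.1 c h.cyclic_left.cyclic_left

theorem IsCircularNext.eq_left {a b c : α} (hb : IsCircularNext b a) (hc : IsCircularNext c a) :
    b = c := by
  by_contra hbc
  have hab : b ≠ a := fun h => hbc ((hb.2 h b).trans (hb.2 h c).symm)
  have hac : c ≠ a := fun h => hbc ((hc.2 h b).trans (hc.2 h c).symm)
  rcases sbtw_or_sbtw_of_ne hbc hac hab.symm with h | h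
  · exact hb.1 c h
  · exact hc.1 b h.cyclic_left

/-- Induction along the circle, from `x` to `y`: all intermediate points `b` lie in `(x, y]`. -/
theorem circular_induction [Finite α] {P : α → Prop} {x : α} (hx : P x) (y : α)
    (hP : ∀ a b, IsCircularNext a b → b ≠ x → (b = y ∨ sbtw x b y) → P a → P b) : P y := by
  let := cutOrder x
  suffices H : ∀ z : α, z ≤ y → P z from H y le_rfl
  intro z
  induction z using (Finite.to_wellFoundedLT (α := α)).wf.induction with
  | _ z ih =>
  intro hzy
  by_cases hzx : z = x
  · rwa [hzx]
  obtain ⟨a, ha, hmax⟩ := Set.exists_max_image {w : α | w < z} id (Set.toFinite _)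
    ⟨x, Or.inl ⟨rfl, hzx⟩⟩
  have ha' : a < z := ha
  refine hP a z ⟨fun w hw => ?_, fun h => (ha'.ne h).elim⟩ hzx ?_ (ih a ha (ha'.le.trans hzy))
  · rcases (sbtw_iff_cutOrder x a w z).1 hw with h | h | h
    · exact absurd (hmax w h.2) (not_le.2 h.1)
    · exact absurd ha' h.2.not_gt
    · exact absurd ha' h.1.not_gt
  · rcases hzy with h | h | h
    · exact absurd h hzx
    · exact Or.inl h
    · exact Or.inr h

/-- The circular order on `Option α` in which the new point `none` is inserted in front of `p`. -/
@[reducible]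
noncomputable def insertCircularOrder (p : α) : CircularOrder (Option α) :=
  letI := cutOrder p
  LinearOrder.toCircularOrder (WithBot α)

theorem sbtw_insert_some (p x y z : α) : letI := insertCircularOrder p
    sbtw (some x) (some y) (some z) ↔ sbtw x y z := by
  let := cutOrder p
  have h := sbtw_iff_cutOrder p x y z
  rw [h]
  have e : ∀ u w : α, ((u : WithBot α) < w) ↔ u < w := fun u w => WithBot.coe_lt_coe
  simp only [← e]
  rfl

theorem sbtw_insert_none (p x y : α) : letI := insertCircularOrder p
    sbtw none (some x) (some y) ↔ (x = p ∧ y ≠ p) ∨ sbtw p x y := by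
  let := cutOrder p
  rw [← cutOrder_lt_iff]
  have e : ∀ u w : α, ((u : WithBot α) < w) ↔ u < w := fun u w => WithBot.coe_lt_coe
  have h0 : ∀ u : α, ((⊥ : WithBot α) < u) := fun u => WithBot.bot_lt_coe u
  have h1 : ∀ u : WithBot α, ¬ (u < (⊥ : WithBot α)) := fun u => not_lt_bot
  change (((⊥ : WithBot α) < x ∧ (x : WithBot α) < y) ∨ ((x : WithBot α) < y ∧ (y : WithBot α) < ⊥) ∨
    ((y : WithBot α) < ⊥ ∧ (⊥ : WithBot α) < x)) ↔ x < y
  simp [h0, h1]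

/-- The circular order on `Option α` is the given one except for the relative position of the two
points `none` and `some p`. -/
theorem sbtw_insert_iff (p : α) (x y z : Option α)
    (h : ¬ ((x = none ∨ y = none ∨ z = none) ∧ (x = some p ∨ y = some p ∨ z = some p))) :
    letI := insertCircularOrder p
    sbtw x y z ↔ sbtw (collapse p x) (collapse p y) (collapse p z) := by
  let := insertCircularOrder p
  have cyc : ∀ a b c : Option α, sbtw a b c ↔ sbtw b c a :=
    fun a b c => ⟨fun h => h.cyclic_left, fun h => h.cyclic_right⟩
  have cyc' : ∀ a b c : α, sbtw a b c ↔ sbtw b c a :=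
    fun a b c => ⟨fun h => h.cyclic_left, fun h => h.cyclic_right⟩
  have one : ∀ a b : α, a ≠ p → (sbtw none (some a) (some b) ↔ sbtw p a b) := by
    intro a b ha
    rw [sbtw_insert_none]; simp [ha]
  have i1 : ∀ a b : Option α, ¬ sbtw a a b := fun a b => sbtw_irrefl_left
  have i2 : ∀ a b : Option α, ¬ sbtw a b b := fun a b => sbtw_irrefl_right
  have i3 : ∀ a b : Option α, ¬ sbtw a b a := fun a b => sbtw_irrefl_left_right
  have j1 : ∀ a b : α, ¬ sbtw a a b := fun a b => sbtw_irrefl_left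
  have j2 : ∀ a b : α, ¬ sbtw a b b := fun a b => sbtw_irrefl_right
  have j3 : ∀ a b : α, ¬ sbtw a b a := fun a b => sbtw_irrefl_left_right
  rcases x with _ | x <;> rcases y with _ | y <;> rcases z with _ | z <;>
    simp only [collapse_none, collapse_some, i1, i2, i3, j1, j2, j3]
  · apply one; rintro rfl; simp at h
  · rw [cyc, cyc' x]; apply one; rintro rfl; simp at h
  · rw [← cyc, ← cyc' p]; apply one; rintro rfl; simp at h
  · exact sbtw_insert_some p x y z

theorem sbtw_insert_pair (p : α) (x : Option α) (h1 : x ≠ none) (h2 : x ≠ some p) :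
    letI := insertCircularOrder p
    sbtw none (some p) x := by
  let := insertCircularOrder p
  rcases x with _ | x
  · exact (h1 rfl).elim
  · rw [sbtw_insert_none]
    exact Or.inl ⟨rfl, fun h => h2 (by rw [h])⟩

end CircularOrder

/-! ### Isomorphic diagrams and subdiagrams -/

namespace TrivalentDiagram

/-- The map on half-edges induced by maps of the vertices and rotations at the inner vertices. -/
def mapLeg {C I C' I' : Type} (c : C → C') (i : I → I') (r : I → Fin 3) :
    C ⊕ I × Fin 3 → C' ⊕ I' × Fin 3 :=
  Sum.map c (fun x => (i x.1, x.2 + r x.1))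

/-- `X` is identified by `c`, `i` and the rotations `r` with a union of components of `D ∖ S¹`,
together with the circle. -/
structure IsImmersion (X D : TrivalentDiagram) (c : X.Circ → D.Circ) (i : X.Inner → D.Inner)
    (r : X.Inner → Fin 3) : Prop where
  injective_circ : Function.Injective c
  injective_inner : Function.Injective i
  sbtw_iff : ∀ x y z, sbtw x y z ↔ sbtw (c x) (c y) (c z)
  pair_map : ∀ h, D.pair (mapLeg c i r h) = mapLeg c i r (X.pair h)

theorem mapLeg_injective {C I C' I' : Type} {c : C → C'} {i : I → I'} (r : I → Fin 3)
    (hc : Function.Injective c) (hi : Function.Injective i) :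
    Function.Injective (mapLeg c i r) := by
  rintro (x | ⟨x, m⟩) (y | ⟨y, n⟩) h
  · rw [hc (Sum.inl_injective h)]
  · simp [mapLeg] at h
  · simp [mapLeg] at h
  · simp only [mapLeg, Sum.map_inr, Sum.inr.injEq, Prod.mk.injEq] at h
    obtain rfl := hi h.1
    rw [add_right_cancel h.2]

/-- A union of components is determined by its vertices. -/
theorem IsImmersion.equivalent {X Y D : TrivalentDiagram} {c : X.Circ → D.Circ}
    {i : X.Inner → D.Inner} {r : X.Inner → Fin 3} {c' : Y.Circ → D.Circ} {i' : Y.Inner → D.Inner}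
    {r' : Y.Inner → Fin 3} (h : IsImmersion X D c i r) (h' : IsImmersion Y D c' i' r')
    (hc : Set.range c = Set.range c') (hi : Set.range i = Set.range i') : X.Equivalent Y := by
  let e : X.Circ ≃ Y.Circ := (Equiv.ofInjective c h.injective_circ).trans
    ((Equiv.setCongr hc).trans (Equiv.ofInjective c' h'.injective_circ).symm)
  let f : X.Inner ≃ Y.Inner := (Equiv.ofInjective i h.injective_inner).trans
    ((Equiv.setCongr hi).trans (Equiv.ofInjective i' h'.injective_inner).symm)
  have he : ∀ x, c' (e x) = c x := fun x => by
    simp [e, Equiv.apply_ofInjective_symm]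
  have hf : ∀ x, i' (f x) = i x := fun x => by
    simp [f, Equiv.apply_ofInjective_symm]
  have key : ∀ l, mapLeg c' i' r' (mapLeg e f (fun x => r x - r' (f x)) l) = mapLeg c i r l := by
    rintro (x | ⟨x, m⟩)
    · simp [mapLeg, he]
    · simp [mapLeg, hf, add_assoc]
  refine ⟨e, f, fun x => r x - r' (f x), fun a b d => ?_, fun l => ?_⟩
  · rw [h.sbtw_iff, h'.sbtw_iff, he, he, he]
  · change Y.pair (mapLeg e f (fun x => r x - r' (f x)) l) =
      mapLeg e f (fun x => r x - r' (f x)) (X.pair l)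
    apply mapLeg_injective r' h'.injective_circ h'.injective_inner
    rw [← h'.pair_map, key, key, h.pair_map]

theorem mapLeg_id {C I : Type} (h : C ⊕ I × Fin 3) : mapLeg id id (fun _ => 0) h = h := by
  rcases h with x | ⟨x, m⟩ <;> simp [mapLeg]

theorem isImmersion_refl (D : TrivalentDiagram) : IsImmersion D D id id (fun _ => 0) where
  injective_circ := Function.injective_id
  injective_inner := Function.injective_id
  sbtw_iff _ _ _ := Iff.rfl
  pair_map h := by rw [mapLeg_id, mapLeg_id]

theorem subIncl_eq_mapLeg (D : TrivalentDiagram) (s : Set D.Component)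
    (h : D.SubCirc s ⊕ D.SubInner s × Fin 3) :
    D.subIncl s h = mapLeg Subtype.val Subtype.val (fun _ => 0) h := by
  rcases h with x | ⟨x, m⟩ <;> simp [mapLeg, subIncl]

theorem isImmersion_sub (D : TrivalentDiagram) (s : Set D.Component) :
    IsImmersion (D.sub s) D Subtype.val Subtype.val (fun _ => 0) where
  injective_circ := Subtype.val_injective
  injective_inner := Subtype.val_injective
  sbtw_iff _ _ _ := Iff.rfl
  pair_map h := (D.subIncl_eq_mapLeg s h ▸ D.subIncl_eq_mapLeg s (D.subPair s h) ▸
    D.subIncl_subPair s h).symm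

/-- A diagram of a union of components followed by an immersion that need only respect the circular
order on that union. -/
theorem isImmersion_sub_comp (D D' : TrivalentDiagram) (s : Set D.Component)
    {c : D.Circ → D'.Circ} {i : D.Inner → D'.Inner} {r : D.Inner → Fin 3}
    (hc : ∀ x y, D.comp (Sum.inl x) ∈ s → D.comp (Sum.inl y) ∈ s → c x = c y → x = y)
    (hi : Function.Injective i)
    (hs : ∀ x y z, D.comp (Sum.inl x) ∈ s → D.comp (Sum.inl y) ∈ s → D.comp (Sum.inl z) ∈ s →
      (sbtw x y z ↔ sbtw (c x) (c y) (c z)))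
    (hp : ∀ h, D.comp (legVertex h) ∈ s → D'.pair (mapLeg c i r h) = mapLeg c i r (D.pair h)) :
    IsImmersion (D.sub s) D' (fun x => c x.1) (fun x => i x.1) (fun x => r x.1) where
  injective_circ x y h := Subtype.ext (hc _ _ x.2 y.2 h)
  injective_inner x y h := Subtype.ext (hi h)
  sbtw_iff x y z := hs _ _ _ x.2 y.2 z.2
  pair_map h := by
    have e : ∀ h : D.SubCirc s ⊕ D.SubInner s × Fin 3,
        mapLeg (fun x => c x.1) (fun x => i x.1) (fun x => r x.1) h =
          mapLeg c i r (D.subIncl s h) := by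
      rintro (x | ⟨x, m⟩) <;> simp [mapLeg, subIncl]
    exact (congrArg D'.pair (e h)).trans ((hp _ (D.subIncl_mem s h)).trans
      ((congrArg (mapLeg c i r) (D.subIncl_subPair s h).symm).trans (e _).symm))

theorem IsImmersion.equivalent_of_surjective {D D' : TrivalentDiagram} {c i r}
    (h : IsImmersion D D' c i r) (hc : Function.Surjective c) (hi : Function.Surjective i) :
    D.Equivalent D' :=
  h.equivalent D'.isImmersion_refl (by rw [hc.range_eq, Set.range_id])
    (by rw [hi.range_eq, Set.range_id])

theorem legVertex_mapLeg {C I C' I' : Type} (c : C → C') (i : I → I') (r : I → Fin 3)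
    (h : C ⊕ I × Fin 3) : legVertex (mapLeg c i r h) = Sum.map c i (legVertex h) := by
  rcases h with x | ⟨x, m⟩ <;> rfl

/-- The degree is half the number of vertices. -/
theorem deg_eq_card (D : TrivalentDiagram) :
    D.deg = (Fintype.card D.Circ + Fintype.card D.Inner) / 2 := by
  rw [deg, Fintype.card_sum]

theorem Equivalent.deg_eq {D D' : TrivalentDiagram} (h : D.Equivalent D') : D.deg = D'.deg := by
  obtain ⟨e, f, -⟩ := h
  rw [deg_eq_card, deg_eq_card, Fintype.card_congr e, Fintype.card_congr f]

/-! ### The resolution of an inner vertex joined to the circle -/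

/-- The inner vertex `v` is joined to the circle vertex `p` by its half-edge `(v, k)`; its other two
half-edges are `(v, a)` and `(v, b)`. -/
structure IsStem (S : TrivalentDiagram) (p : S.Circ) (v : S.Inner) (k a b : Fin 3) : Prop where
  pair_eq : S.pair (Sum.inl p) = Sum.inr (v, k)
  ne_left : a ≠ k
  ne_right : b ≠ k
  ne : a ≠ b

theorem isStem_standard {S : TrivalentDiagram} {p : S.Circ} {v : S.Inner} {k : Fin 3}
    (h : S.pair (Sum.inl p) = Sum.inr (v, k)) : S.IsStem p v k (k + 2) (k + 1) :=
  have : ∀ k : Fin 3, k + 2 ≠ k ∧ k + 1 ≠ k ∧ k + 2 ≠ k + 1 := by decide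
  ⟨h, (this k).1, (this k).2.1, (this k).2.2⟩

section Resolve

variable {S : TrivalentDiagram} {p : S.Circ} {v : S.Inner} {k a b : Fin 3}

theorem IsStem.symm (h : S.IsStem p v k a b) : S.IsStem p v k b a :=
  ⟨h.1, h.3, h.2, h.4.symm⟩

theorem IsStem.pair_inner (h : S.IsStem p v k a b) : S.pair (Sum.inr (v, k)) = Sum.inl p := by
  rw [← h.pair_eq, S.pair_pair]

theorem IsStem.eq_or (h : S.IsStem p v k a b) (m : Fin 3) : m = k ∨ m = a ∨ m = b := by
  have : ∀ k a b m : Fin 3, a ≠ k → b ≠ k → a ≠ b → m = k ∨ m = a ∨ m = b := by decide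
  exact this k a b m h.2 h.3 h.4

open Classical in
/-- The half-edges of the resolution as half-edges of `S`. -/
noncomputable def resolveLeg (S : TrivalentDiagram) (p : S.Circ) (v : S.Inner) (a b : Fin 3) :
    Option S.Circ ⊕ {i : S.Inner // i ≠ v} × Fin 3 → S.Leg
  | Sum.inl none => Sum.inr (v, a)
  | Sum.inl (some c) => if c = p then Sum.inr (v, b) else Sum.inl c
  | Sum.inr (i, m) => Sum.inr (i.1, m)

theorem IsStem.resolveLeg_injective (h : S.IsStem p v k a b) :
    Function.Injective (S.resolveLeg p v a b) := by
  have := h.ne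
  rintro ((_ | c) | ⟨⟨i, hi⟩, m⟩) ((_ | d) | ⟨⟨j, hj⟩, n⟩) <;> simp only [resolveLeg] <;>
    (try split_ifs) <;> simp_all <;> grind

theorem IsStem.mem_range_resolveLeg (h : S.IsStem p v k a b) (l : S.Leg) :
    l ∈ Set.range (S.resolveLeg p v a b) ↔ l ≠ Sum.inl p ∧ l ≠ Sum.inr (v, k) := by
  constructor
  · have := h.ne_left
    have := h.ne_right
    rintro ⟨((_ | c) | ⟨⟨i, hi⟩, m⟩), rfl⟩ <;> simp only [resolveLeg] <;>
      (try split_ifs) <;> simp_all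
  · rintro ⟨h1, h2⟩
    rcases l with c | ⟨i, m⟩
    · have : c ≠ p := fun hc => h1 (by rw [hc])
      exact ⟨Sum.inl (some c), by simp [resolveLeg, this]⟩
    · by_cases hi : i = v
      · subst hi
        have : m ≠ k := fun hm => h2 (by rw [hm])
        rcases h.eq_or m with rfl | rfl | rfl
        · exact (this rfl).elim
        · exact ⟨Sum.inl none, rfl⟩
        · exact ⟨Sum.inl (some p), by simp [resolveLeg]⟩
      · exact ⟨Sum.inr (⟨i, hi⟩, m), rfl⟩

theorem IsStem.exists_pair (h : S.IsStem p v k a b)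
    (l : Option S.Circ ⊕ {i : S.Inner // i ≠ v} × Fin 3) :
    ∃ l', S.resolveLeg p v a b l' = S.pair (S.resolveLeg p v a b l) := by
  have h1 := (h.mem_range_resolveLeg _).1 ⟨l, rfl⟩
  refine (h.mem_range_resolveLeg _).2 ⟨fun h2 => h1.2 ?_, fun h2 => h1.1 ?_⟩
  · rw [← S.pair_pair (S.resolveLeg p v a b l), h2, h.pair_eq]
  · rw [← S.pair_pair (S.resolveLeg p v a b l), h2, h.pair_inner]

/-- The involution on the half-edges of the resolution. -/
noncomputable def IsStem.resolvePair (h : S.IsStem p v k a b)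
    (l : Option S.Circ ⊕ {i : S.Inner // i ≠ v} × Fin 3) :
    Option S.Circ ⊕ {i : S.Inner // i ≠ v} × Fin 3 :=
  (h.exists_pair l).choose

theorem IsStem.resolveLeg_resolvePair (h : S.IsStem p v k a b)
    (l : Option S.Circ ⊕ {i : S.Inner // i ≠ v} × Fin 3) :
    S.resolveLeg p v a b (h.resolvePair l) = S.pair (S.resolveLeg p v a b l) :=
  (h.exists_pair l).choose_spec

/-- A path from an inner vertex to the circle can be followed in the resolution as long as it does not
meet a removed edge; the strands of `v` end on the circle there. -/
theorem IsStem.connected_aux (h : S.IsStem p v k a b) {u w : S.Vertex}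
    (huw : Relation.ReflTransGen (LegAdj S.pair) u w) :
    ∀ c, w = Sum.inl c → ∀ i : {i : S.Inner // i ≠ v}, u = Sum.inr i.1 →
      ∃ o : Option S.Circ,
        Relation.ReflTransGen (LegAdj h.resolvePair) (Sum.inr i) (Sum.inl o) := by
  induction huw using Relation.ReflTransGen.head_induction_on with
  | refl => rintro c rfl i hi; cases hi
  | @head u u' huu' _ ih =>
    rintro c rfl i rfl
    obtain ⟨l, hl, rfl⟩ := huu'
    rcases l with x | ⟨j, m⟩
    · cases hl
    obtain rfl : j = i.1 := Sum.inr_injective hl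
    have key := h.resolveLeg_resolvePair (Sum.inr (i, m))
    have hadj : LegAdj h.resolvePair (Sum.inr i)
      (legVertex (h.resolvePair (Sum.inr (i, m)))) := ⟨Sum.inr (i, m), rfl, rfl⟩
    rcases hr : h.resolvePair (Sum.inr (i, m)) with o | ⟨j, n⟩
    · rw [hr] at hadj
      exact ⟨o, .single hadj⟩
    · rw [hr] at hadj key
      obtain ⟨o, ho⟩ := ih c rfl j (by
        change legVertex (S.pair (S.resolveLeg p v a b (Sum.inr (i, m)))) = _
        rw [← key]; rfl)
      exact ⟨o, ho.head hadj⟩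

/-- The resolution of the vertex `v`: the circle vertex `p` is replaced by the points `none`, `some p`
(in this order along the circle); the strand of `(v, a)` is attached to `none`, the one
of `(v, b)` to `some p`. -/
noncomputable def IsStem.resolve (h : S.IsStem p v k a b) : TrivalentDiagram :=
  letI := insertCircularOrder p
  { Circ := Option S.Circ
    Inner := {i : S.Inner // i ≠ v}
    fintypeInner := Fintype.ofFinite _
    pair := h.resolvePair
    pair_pair := fun l => h.resolveLeg_injective (by
      rw [h.resolveLeg_resolvePair, h.resolveLeg_resolvePair, S.pair_pair])
    pair_ne := fun l hl => S.pair_ne (S.resolveLeg p v a b l) (by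
      rw [← h.resolveLeg_resolvePair, hl])
    connected := fun i => by
      obtain ⟨c, hc⟩ := S.connected i.1
      exact h.connected_aux hc c rfl i rfl }

theorem IsStem.isResolution_resolve (h : S.IsStem p v k a b) :
    S.IsResolution p v a b h.resolve := by
  refine ⟨(none : Option S.Circ), some p, collapse p, Subtype.val, S.resolveLeg p v a b,
    fun h => (nomatch h), ?_, ?_, ?_, ?_, Subtype.val_injective, ?_, rfl, ?_, ?_, fun _ _ => rfl, ?_⟩
  · rintro (_ | t)
    · exact iff_of_true rfl (Or.inl rfl)
    · exact ⟨fun ht => Or.inr (congrArg some ht),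
        fun ht => Option.some_injective _ (ht.resolve_left fun h' => nomatch h')⟩
  · intro c hc
    refine ⟨some c, rfl, ?_⟩
    rintro (_ | t) ht
    · exact (hc ht.symm).elim
    · exact congrArg some ht
  · rintro (t : Option S.Circ) (t' : Option S.Circ) (t'' : Option S.Circ) ht
    refine (sbtw_insert_iff p t t' t'' ?_).2 ht
    have h1 := ht.ne_left
    have h2 := ht.ne_right
    have h3 := ht.ne_outer
    rintro ⟨rfl | rfl | rfl, h' | h' | h'⟩ <;> simp_all
  · intro t h1 h2
    exact sbtw_insert_pair p t h1 h2
  · exact Subtype.range_coe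
  · simp [resolveLeg]
  · rintro (_ | t) h1 h2
    · exact (h1 rfl).elim
    · have : t ≠ p := fun ht => h2 (by rw [ht])
      simp [resolveLeg, this]
  · intro l
    exact (h.resolveLeg_resolvePair l).symm

/-- A resolution is unique up to isomorphism. -/
theorem IsResolution.equivalent_resolve {T : TrivalentDiagram} (hT : S.IsResolution p v a b T)
    (h : S.IsStem p v k a b) : T.Equivalent h.resolve := by
  classical
  obtain ⟨q₁, q₂, γ, ι, j, hq, hγ, hγ', hsb, hpair, hι, hι', hj1, hj2, hj3, hj4, hj⟩ := hT
  let e : T.Circ → Option S.Circ := fun t => if t = q₁ then none else some (γ t)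
  have e1 : e q₁ = none := if_pos rfl
  have e2 : ∀ t, t ≠ q₁ → e t = some (γ t) := fun t ht => if_neg ht
  have hγinj : ∀ t t', t ≠ q₁ → t' ≠ q₁ → γ t = γ t' → t = t' := by
    intro t t' h1 h2 htt
    by_cases hp : γ t = p
    · rw [((hγ t).1 hp).resolve_left h1, ((hγ t').1 (htt ▸ hp)).resolve_left h2]
    · exact (hγ' _ hp).unique rfl htt.symm
  have einj : Function.Injective e := by
    intro t t' htt
    by_cases h1 : t = q₁ <;> by_cases h2 : t' = q₁
    · rw [h1, h2]
    · rw [h1, e1, e2 _ h2] at htt; cases htt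
    · rw [h2, e1, e2 _ h1] at htt; cases htt
    · rw [e2 _ h1, e2 _ h2] at htt
      exact hγinj _ _ h1 h2 (Option.some_injective _ htt)
  have esurj : Function.Surjective e := by
    rintro (_ | c)
    · exact ⟨q₁, e1⟩
    · by_cases hc : c = p
      · exact ⟨q₂, by rw [e2 _ hq.symm, (hγ q₂).2 (Or.inr rfl), hc]⟩
      · obtain ⟨t, ht, -⟩ := hγ' c hc
        refine ⟨t, ?_⟩
        rw [e2, ht]
        rintro rfl
        exact hc (ht.symm.trans ((hγ t).2 (Or.inl rfl)))
  have hcol : ∀ t, collapse p (e t) = γ t := by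
    intro t
    by_cases h1 : t = q₁
    · rw [h1, e1, collapse_none, (hγ q₁).2 (Or.inl rfl)]
    · rw [e2 _ h1, collapse_some]
  have hιv : ∀ i, ι i ≠ v := fun i => by
    have : ι i ∈ ({v}ᶜ : Set S.Inner) := hι' ▸ ⟨i, rfl⟩
    exact this
  let f : T.Inner → {i : S.Inner // i ≠ v} := fun i => ⟨ι i, hιv i⟩
  have finj : Function.Injective f := fun i i' hi => hι (Subtype.ext_iff.1 hi)
  have fsurj : Function.Surjective f := by
    rintro ⟨i, hi⟩
    have : i ∈ Set.range ι := hι' ▸ hi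
    obtain ⟨i', rfl⟩ := this
    exact ⟨i', rfl⟩
  have e2' : e q₂ = some p := by rw [e2 _ hq.symm, (hγ q₂).2 (Or.inr rfl)]
  have hfwd : letI := insertCircularOrder p
      ∀ x y z, sbtw (e x) (e y) (e z) → sbtw x y z := by
    let := insertCircularOrder p
    have pairCase : ∀ z, sbtw (e q₁) (e q₂) (e z) → sbtw q₁ q₂ z := by
      intro z h
      refine hpair z ?_ ?_
      · rintro rfl; exact sbtw_irrefl_left_right h
      · rintro rfl; exact sbtw_irrefl_right h
    have noCase : ∀ z, ¬ sbtw (e q₂) (e q₁) (e z) := by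
      intro z h
      have h1 : e z ≠ none := fun h' => by
        rw [← e1] at h'; exact h.ne_right h'.symm
      have h2 : e z ≠ some p := fun h' => by
        rw [← e2'] at h'; exact h.ne_outer h'.symm
      have := sbtw_insert_pair p _ h1 h2
      rw [e1, e2'] at h
      exact h.not_sbtw this.cyclic_left.cyclic_left.cyclic_left.cyclic_left.cyclic_left
    intro x y z h
    by_cases hbad : (e x = none ∨ e y = none ∨ e z = none) ∧
        (e x = some p ∨ e y = some p ∨ e z = some p)
    · have t1 : ∀ t, e t = none → t = q₁ := fun t ht => einj (ht.trans e1.symm)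
      have t2 : ∀ t, e t = some p → t = q₂ := fun t ht => einj (ht.trans e2'.symm)
      rcases hbad with ⟨hx | hx | hx, hy | hy | hy⟩
      · rw [hx] at hy; cases hy
      · obtain rfl := t1 _ hx; obtain rfl := t2 _ hy; exact pairCase _ h
      · obtain rfl := t1 _ hx; obtain rfl := t2 _ hy; exact (noCase _ h.cyclic_right).elim
      · obtain rfl := t1 _ hx; obtain rfl := t2 _ hy; exact (noCase _ h).elim
      · rw [hx] at hy; cases hy
      · obtain rfl := t1 _ hx; obtain rfl := t2 _ hy
        exact (pairCase _ h.cyclic_left).cyclic_right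
      · obtain rfl := t1 _ hx; obtain rfl := t2 _ hy
        exact (pairCase _ h.cyclic_right).cyclic_left
      · obtain rfl := t1 _ hx; obtain rfl := t2 _ hy
        exact (noCase _ h.cyclic_left).elim
      · rw [hx] at hy; cases hy
    · have := (sbtw_insert_iff p _ _ _ hbad).1 h
      rw [hcol, hcol, hcol] at this
      exact hsb _ _ _ this
  refine IsImmersion.equivalent_of_surjective (D' := h.resolve) (c := e) (i := f)
    (r := fun _ => 0) ⟨einj, finj, ?_, ?_⟩ esurj fsurj
  · intro x y z
    refine ⟨fun h => ?_, hfwd x y z⟩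
    by_contra hn
    let := insertCircularOrder p
    rcases sbtw_or_sbtw_of_ne (einj.ne h.ne_left) (einj.ne h.ne_right) (einj.ne h.ne_outer.symm)
      with h' | h'
    · exact hn h'
    · exact h.not_sbtw (hfwd _ _ _ h')
  · have key : ∀ l, S.resolveLeg p v a b (mapLeg e f (fun _ => 0) l) = j l := by
      rintro (t | ⟨i, m⟩)
      · by_cases h1 : t = q₁
        · subst h1
          simp only [mapLeg, Sum.map_inl, e1, hj1, resolveLeg]
        · by_cases h2 : t = q₂
          · subst h2
            simp only [mapLeg, Sum.map_inl, e2', hj2, resolveLeg, if_true]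
          · have : γ t ≠ p := fun hp => ((hγ t).1 hp).elim h1 h2
            simp only [mapLeg, Sum.map_inl, e2 _ h1, hj3 _ h1 h2, resolveLeg, if_neg this]
      · simp [mapLeg, resolveLeg, hj4, f]
    intro l
    apply h.resolveLeg_injective
    exact (h.resolveLeg_resolvePair (mapLeg e f (fun _ => 0) l)).trans
      ((congrArg S.pair (key l)).trans ((hj l).trans (key _).symm))

theorem IsStem.deg_resolve (h : S.IsStem p v k a b) : h.resolve.deg = S.deg := by
  classical
  rw [deg_eq_card, deg_eq_card]
  have h1 : Fintype.card h.resolve.Circ = Fintype.card S.Circ + 1 :=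
    (Fintype.card_congr (Equiv.refl (Option S.Circ))).trans Fintype.card_option
  have h2 : Fintype.card h.resolve.Inner = Fintype.card S.Inner - 1 := by
    rw [← Nat.card_eq_fintype_card, ← Nat.card_eq_fintype_card]
    change Nat.card {i : S.Inner // i ≠ v} = _
    rw [Nat.card_eq_fintype_card, Fintype.card_subtype_compl, Fintype.card_subtype_eq,
      Nat.card_eq_fintype_card]
  have h3 : 0 < Fintype.card S.Inner := Fintype.card_pos_iff.2 ⟨v⟩
  rw [h1, h2]; congr 1; omega

end Resolve

theorem isSTU_resolve {S : TrivalentDiagram} {p : S.Circ} {v : S.Inner} {k : Fin 3}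
    (h : S.pair (Sum.inl p) = Sum.inr (v, k)) :
    IsSTU S (isStem_standard h).resolve (isStem_standard h).symm.resolve :=
  ⟨p, v, k, h, (isStem_standard h).isResolution_resolve,
    (isStem_standard h).symm.isResolution_resolve⟩

/-- By connectedness, some inner vertex is joined to the circle unless there are no inner vertices. -/
theorem exists_stem (S : TrivalentDiagram) [hS : Nonempty S.Inner] :
    ∃ (p : S.Circ) (v : S.Inner) (k : Fin 3), S.pair (Sum.inl p) = Sum.inr (v, k) := by
  obtain ⟨i⟩ := hS
  obtain ⟨c, hc⟩ := S.connected i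
  suffices H : ∀ u w : S.Vertex, Relation.ReflTransGen (LegAdj S.pair) u w →
      ∀ i c, u = Sum.inr i → w = Sum.inl c →
      ∃ (p : S.Circ) (v : S.Inner) (k : Fin 3), S.pair (Sum.inl p) = Sum.inr (v, k) from
    H _ _ hc i c rfl rfl
  intro u w huw
  induction huw with
  | refl => rintro i c rfl h; cases h
  | @tail w w' _ hw ih =>
    rintro i c rfl rfl
    rcases w with d | d
    · exact ih i d rfl rfl
    · obtain ⟨l, hl, hl'⟩ := hw
      rcases l with x | ⟨j, m⟩
      · cases hl
      · refine ⟨c, j, m, ?_⟩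
        rcases hp : S.pair (Sum.inr (j, m)) with y | y
        · rw [hp] at hl'
          obtain rfl : y = c := Sum.inl_injective hl'
          rw [← hp, S.pair_pair]
        · rw [hp] at hl'; cases hl'

end TrivalentDiagram

/-! ### Linear maps on the space of diagrams -/

section DiagramSpace

variable (R : Type*) [Field R]

theorem diagramClass_eq_of_equivalent {D D' : TrivalentDiagram} (h : D.Equivalent D') :
    diagramClass R D = diagramClass R D' := by
  rw [diagramClass, diagramClass, Submodule.Quotient.eq]
  exact Submodule.subset_span (DiagramRel.equivalent D D' h)

theorem diagramClass_stu {S T U : TrivalentDiagram} (h : TrivalentDiagram.IsSTU S T U) :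
    diagramClass R S = diagramClass R T - diagramClass R U := by
  rw [diagramClass, diagramClass, diagramClass, ← Submodule.Quotient.mk_sub, Submodule.Quotient.eq]
  exact Submodule.subset_span (DiagramRel.stu S T U h)

/-- A function on diagrams that is invariant under isomorphism and satisfies the (STU)-relation for
the standard resolutions extends to a linear map. -/
theorem exists_linearMap_diagramClass {M : Type*} [AddCommGroup M] [Module R M]
    (w : TrivalentDiagram → M) (h1 : ∀ D D', D.Equivalent D' → w D = w D')
    (h2 : ∀ (S : TrivalentDiagram) (p : S.Circ) (v : S.Inner) (k : Fin 3)
      (h : S.pair (Sum.inl p) = Sum.inr (v, k)),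
      w S = w (TrivalentDiagram.isStem_standard h).resolve -
        w (TrivalentDiagram.isStem_standard h).symm.resolve) :
    ∃ φ : DiagramSpace R →ₗ[R] M, ∀ D, φ (diagramClass R D) = w D := by
  let ψ : (TrivalentDiagram →₀ R) →ₗ[R] M := Finsupp.linearCombination R w
  have hψ : ∀ D, ψ (Finsupp.single D 1) = w D := fun D => by simp [ψ]
  refine ⟨Submodule.liftQ _ ψ (Submodule.span_le.2 ?_), fun D => ?_⟩
  · rintro x (⟨D, D', h⟩ | ⟨S, T, U, p, v, k, h, hT, hU⟩)
    · simp [hψ, h1 D D' h]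
    · simp only [SetLike.mem_coe, LinearMap.mem_ker, map_sub, hψ]
      rw [h1 _ _ (hT.equivalent_resolve (TrivalentDiagram.isStem_standard h)),
        h1 _ _ (hU.equivalent_resolve (TrivalentDiagram.isStem_standard h).symm), h2 S p v k h,
        sub_self]
  · rw [diagramClass, Submodule.liftQ_apply, hψ]

theorem diagramSpace_hom_ext {M : Type*} [AddCommGroup M] [Module R M]
    {φ ψ : DiagramSpace R →ₗ[R] M}
    (h : ∀ D, φ (diagramClass R D) = ψ (diagramClass R D)) : φ = ψ := by
  apply Submodule.linearMap_qext
  apply Finsupp.lhom_ext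
  intro D r
  have := congrArg (r • ·) (h D)
  simp only [← map_smul] at this
  simpa [diagramClass, ← Submodule.Quotient.mk_smul] using this

/-- Linear maps on the space of diagrams are determined by their values on chord diagrams: the
(STU)-relation removes the inner vertices one by one. -/
theorem diagramSpace_hom_ext_chord {M : Type*} [AddCommGroup M] [Module R M]
    {φ ψ : DiagramSpace R →ₗ[R] M}
    (h : ∀ D : TrivalentDiagram, D.IsChordDiagram → φ (diagramClass R D) = ψ (diagramClass R D)) :
    φ = ψ := by
  apply diagramSpace_hom_ext
  suffices H : ∀ (n : ℕ) (D : TrivalentDiagram), Nat.card D.Inner = n →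
    φ (diagramClass R D) = ψ (diagramClass R D) from fun D => H _ D rfl
  intro n
  induction n with
  | zero =>
    intro D hD
    apply h
    rcases Nat.card_eq_zero.1 hD with h | h
    · exact h
    · exact (not_finite D.Inner).elim
  | succ n ih =>
    intro D hD
    have : Nonempty D.Inner := (Nat.card_pos_iff.1 (by omega)).1
    obtain ⟨p, v, k, hk⟩ := D.exists_stem
    have hcard : Nat.card {i : D.Inner // i ≠ v} = n := by
      classical
      rw [Nat.card_eq_fintype_card, Fintype.card_subtype_compl, Fintype.card_subtype_eq,
        ← Nat.card_eq_fintype_card, hD, Nat.add_sub_cancel]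
    rw [diagramClass_stu R (TrivalentDiagram.isSTU_resolve hk), map_sub, map_sub,
      ih _ hcard, ih _ hcard]

end DiagramSpace

/-! ### The coproduct -/

namespace TrivalentDiagram

section CompEquiv

variable {D D' : TrivalentDiagram} {c : D.Circ ≃ D'.Circ} {i : D.Inner ≃ D'.Inner}
  {r : D.Inner → Fin 3}

theorem legAdj_map_iff (hp : ∀ h, D'.pair (mapLeg c i r h) = mapLeg c i r (D.pair h))
    (u w : D.Vertex) :
    LegAdj D.pair u w ↔ LegAdj D'.pair (Equiv.sumCongr c i u) (Equiv.sumCongr c i w) := by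
  constructor
  · rintro ⟨l, rfl, rfl⟩
    exact ⟨mapLeg c i r l, legVertex_mapLeg _ _ _ _, by rw [hp, legVertex_mapLeg]; rfl⟩
  · rintro ⟨l, hl, hl'⟩
    obtain ⟨l, rfl⟩ : ∃ l₀, mapLeg c i r l₀ = l := by
      rcases l with x | ⟨j, m⟩
      · exact ⟨Sum.inl (c.symm x), by simp [mapLeg]⟩
      · exact ⟨Sum.inr (i.symm j, m - r (i.symm j)), by simp [mapLeg]⟩
    rw [legVertex_mapLeg] at hl
    rw [hp, legVertex_mapLeg] at hl'
    exact ⟨l, (Equiv.sumCongr c i).injective hl, (Equiv.sumCongr c i).injective hl'⟩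

/-- The bijection between the components of the complement of the circle that is induced by an
isomorphism of the parts of the diagrams off the circle. -/
def compEquiv (hp : ∀ h, D'.pair (mapLeg c i r h) = mapLeg c i r (D.pair h)) :
    D.Component ≃ D'.Component :=
  Quot.congr (Equiv.sumCongr c i) (legAdj_map_iff hp)

/-- An isomorphism off the circle restricts to an isomorphism of subdiagrams if it respects the
circular order of the circle vertices that belong to them. -/
theorem equivalent_sub_preimage
    (hp : ∀ h, D'.pair (mapLeg c i r h) = mapLeg c i r (D.pair h)) (s : Set D'.Component)
    (hs : ∀ x y z, D'.comp (Sum.inl (c x)) ∈ s → D'.comp (Sum.inl (c y)) ∈ s →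
      D'.comp (Sum.inl (c z)) ∈ s → (sbtw x y z ↔ sbtw (c x) (c y) (c z))) :
    (D.sub (compEquiv hp ⁻¹' s)).Equivalent (D'.sub s) := by
  refine (isImmersion_sub_comp D D' (compEquiv hp ⁻¹' s) (c := c) (i := i) (r := r)
    (fun _ _ _ _ h => c.injective h) i.injective hs (fun l _ => hp l)).equivalent
    (isImmersion_sub D' s) ?_ ?_
  · ext x
    constructor
    · rintro ⟨y, rfl⟩
      exact ⟨⟨c y.1, y.2⟩, rfl⟩
    · rintro ⟨⟨y, hy⟩, rfl⟩
      exact ⟨⟨c.symm y, by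
        change D'.comp (Sum.inl (c (c.symm y))) ∈ s
        rwa [c.apply_symm_apply]⟩, c.apply_symm_apply y⟩
  · ext x
    constructor
    · rintro ⟨y, rfl⟩
      exact ⟨⟨i y.1, y.2⟩, rfl⟩
    · rintro ⟨⟨y, hy⟩, rfl⟩
      exact ⟨⟨i.symm y, by
        change D'.comp (Sum.inr (i (i.symm y))) ∈ s
        rwa [i.apply_symm_apply]⟩, i.apply_symm_apply y⟩

end CompEquiv

theorem preimage_bijective {α β : Type*} (e : α ≃ β) :
    Function.Bijective (fun s : Set β => e ⁻¹' s) :=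
  ⟨Set.preimage_injective.2 e.surjective, Set.preimage_surjective.2 e.injective⟩

/-- The summands of the coproduct. -/
noncomputable def coproductTerm (R : Type*) [Field R] (D : TrivalentDiagram) (s : Set D.Component) :
    DiagramSpace R ⊗[R] DiagramSpace R :=
  diagramClass R (D.sub s) ⊗ₜ[R] diagramClass R (D.sub sᶜ)

theorem Equivalent.sum_coproductTerm (R : Type*) [Field R] {D D' : TrivalentDiagram}
    (h : D.Equivalent D') :
    ∑ s, coproductTerm R D s = ∑ s, coproductTerm R D' s := by
  obtain ⟨c, i, r, h1, h2⟩ := h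
  refine (Fintype.sum_bijective _ (preimage_bijective (compEquiv h2)) _ _ fun s => ?_).symm
  rw [coproductTerm, coproductTerm, ← Set.preimage_compl,
    diagramClass_eq_of_equivalent R (equivalent_sub_preimage h2 s fun _ _ _ _ _ _ => h1 _ _ _),
    diagramClass_eq_of_equivalent R (equivalent_sub_preimage h2 sᶜ fun _ _ _ _ _ _ => h1 _ _ _)]

section Resolve

variable {S : TrivalentDiagram} {p : S.Circ} {v : S.Inner} {k a b : Fin 3}

open Classical in
/-- The vertices of the resolution correspond to those of `S`: the point `none` to the removed
vertex `v`. -/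
noncomputable def resolveVertex (S : TrivalentDiagram) (v : S.Inner) :
    Option S.Circ ⊕ {i : S.Inner // i ≠ v} ≃ S.Vertex where
  toFun
    | Sum.inl none => Sum.inr v
    | Sum.inl (some c) => Sum.inl c
    | Sum.inr i => Sum.inr i.1
  invFun
    | Sum.inl c => Sum.inl (some c)
    | Sum.inr i => if h : i = v then Sum.inl none else Sum.inr ⟨i, h⟩
  left_inv := by
    rintro ((_ | c) | ⟨i, hi⟩)
    · simp
    · rfl
    · simp [hi]
  right_inv := by
    rintro (c | i)
    · rfl
    · by_cases hi : i = v
      · simp [hi]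
      · simp [hi]

theorem IsStem.comp_eq (h : S.IsStem p v k a b) : S.comp (Sum.inl p) = S.comp (Sum.inr v) := by
  have := S.comp_legVertex_pair (Sum.inl p)
  rw [h.pair_eq] at this
  exact this.symm

theorem IsStem.comp_resolveVertex (h : S.IsStem p v k a b)
    (l : Option S.Circ ⊕ {i : S.Inner // i ≠ v} × Fin 3) :
    S.comp (resolveVertex S v (legVertex l)) = S.comp (legVertex (S.resolveLeg p v a b l)) := by
  rcases l with (_ | c) | ⟨i, m⟩
  · rfl
  · by_cases hc : c = p
    · subst hc
      simp only [resolveLeg, if_true]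
      exact h.comp_eq
    · simp only [resolveLeg, if_neg hc]
      rfl
  · rfl

/-- The map from the components of the resolution to the components of `S`. It identifies the
component of `none` with the one of `some p`. -/
noncomputable def IsStem.resolveComp (h : S.IsStem p v k a b) (q : h.resolve.Component) :
    S.Component :=
  Quot.lift (fun u => S.comp (resolveVertex S v u)) (by
    rintro _ _ ⟨l, rfl, rfl⟩
    refine (h.comp_resolveVertex l).trans (Eq.trans ?_ (h.comp_resolveVertex (h.resolvePair l)).symm)
    exact (S.comp_legVertex_pair _).symm.trans
      (congrArg (fun l => S.comp (legVertex l)) (h.resolveLeg_resolvePair l).symm)) q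

/-- A circle vertex of the resolution as an element of its set of vertices. -/
abbrev IsStem.circVertex (h : S.IsStem p v k a b) (o : Option S.Circ) : h.resolve.Vertex :=
  Sum.inl o

theorem IsStem.resolveComp_inl (h : S.IsStem p v k a b) (o : Option S.Circ) :
    h.resolveComp (h.resolve.comp (h.circVertex o)) = S.comp (Sum.inl (collapse p o)) := by
  rcases o with _ | c
  · exact h.comp_eq.symm
  · rfl

theorem IsStem.resolveComp_surjective (h : S.IsStem p v k a b) :
    Function.Surjective h.resolveComp := by
  rintro ⟨u⟩
  refine ⟨h.resolve.comp ((resolveVertex S v).symm u), ?_⟩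
  change S.comp (resolveVertex S v ((resolveVertex S v).symm u)) = _
  rw [Equiv.apply_symm_apply]; rfl

/-- A set of components of the resolution that contains both strands of the resolved vertex or none
of them. -/
def IsStem.IsSaturated (h : S.IsStem p v k a b) (s : Set h.resolve.Component) : Prop :=
  h.resolve.comp (h.circVertex none) ∈ s ↔ h.resolve.comp (h.circVertex (some p)) ∈ s

theorem IsStem.isSaturated_preimage (h : S.IsStem p v k a b) (s : Set S.Component) :
    h.IsSaturated (h.resolveComp ⁻¹' s) := by
  rw [IsSaturated, Set.mem_preimage, Set.mem_preimage, h.resolveComp_inl, h.resolveComp_inl]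
  rfl

theorem IsStem.IsSaturated.exists_preimage {h : S.IsStem p v k a b}
    {s : Set h.resolve.Component} (hs : h.IsSaturated s) : ∃ s', h.resolveComp ⁻¹' s' = s := by
  have key : ∀ l : Option S.Circ ⊕ {i : S.Inner // i ≠ v} × Fin 3,
      h.resolve.comp ((resolveVertex S v).symm (legVertex (S.resolveLeg p v a b l))) ∈ s ↔
        h.resolve.comp (legVertex l) ∈ s := by
    have e1 : (resolveVertex S v).symm (Sum.inr v) = Sum.inl none :=
      (resolveVertex S v).symm_apply_eq.2 rfl
    rintro ((_ | c) | ⟨i, m⟩)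
    · change h.resolve.comp ((resolveVertex S v).symm (Sum.inr v)) ∈ s ↔ _
      rw [e1]; rfl
    · by_cases hc : c = p
      · subst hc
        simp only [resolveLeg, if_true]
        change h.resolve.comp ((resolveVertex S v).symm (Sum.inr v)) ∈ s ↔ _
        rw [e1]; exact hs
      · simp only [resolveLeg, if_neg hc]
        rfl
    · have : (resolveVertex S v).symm (Sum.inr i.1) = Sum.inr i :=
        (resolveVertex S v).symm_apply_eq.2 rfl
      change h.resolve.comp ((resolveVertex S v).symm (Sum.inr i.1)) ∈ s ↔ _
      rw [this]; rfl
  have stem : h.resolve.comp ((resolveVertex S v).symm (Sum.inl p)) ∈ s ↔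
      h.resolve.comp ((resolveVertex S v).symm (Sum.inr v)) ∈ s := by
    have e1 : (resolveVertex S v).symm (Sum.inr v) = Sum.inl none :=
      (resolveVertex S v).symm_apply_eq.2 rfl
    rw [e1]; exact hs.symm
  let P : S.Component → Prop := Quot.lift
    (fun u => h.resolve.comp ((resolveVertex S v).symm u) ∈ s) (by
      rintro _ _ ⟨l, rfl, rfl⟩
      apply propext
      by_cases hl : l ∈ Set.range (S.resolveLeg p v a b)
      · obtain ⟨l, rfl⟩ := hl
        rw [← h.resolveLeg_resolvePair, key, key]
        have := h.resolve.comp_legVertex_pair l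
        change h.resolve.comp (legVertex (h.resolvePair l)) = _ at this
        rw [this]
      · rw [h.mem_range_resolveLeg, not_and_or, not_not, not_not] at hl
        rcases hl with rfl | rfl
        · rw [h.pair_eq]; exact stem
        · rw [h.pair_inner]; exact stem.symm)
  refine ⟨{q | P q}, ?_⟩
  ext ⟨u⟩
  exact Iff.of_eq (congrArg (fun w => h.resolve.comp w ∈ s)
    ((resolveVertex S v).symm_apply_apply u))

/-- A subdiagram that does not contain the resolved vertex is not affected by the resolution. -/
theorem IsStem.equivalent_sub (h : S.IsStem p v k a b) (s : Set S.Component)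
    (hv : S.comp (Sum.inr v) ∉ s) : (h.resolve.sub (h.resolveComp ⁻¹' s)).Equivalent (S.sub s) := by
  have hmem : ∀ o : Option S.Circ, h.resolve.comp (h.circVertex o) ∈ h.resolveComp ⁻¹' s →
      ∃ x, o = some x ∧ x ≠ p := by
    intro o ho
    rw [Set.mem_preimage, h.resolveComp_inl] at ho
    rcases o with _ | x
    · rw [collapse_none, h.comp_eq] at ho
      exact (hv ho).elim
    · refine ⟨x, rfl, ?_⟩
      rintro rfl
      rw [collapse_some, h.comp_eq] at ho
      exact hv ho
  have hleg : ∀ l : Option S.Circ ⊕ {i : S.Inner // i ≠ v} × Fin 3,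
      h.resolve.comp (legVertex l) ∈ h.resolveComp ⁻¹' s →
      mapLeg (collapse p) Subtype.val (fun _ => 0) l = S.resolveLeg p v a b l := by
    rintro (o | ⟨i, m⟩) hl
    · obtain ⟨x, rfl, hx⟩ := hmem o hl
      simp [mapLeg, resolveLeg, hx]
    · simp [mapLeg, resolveLeg]
  refine (isImmersion_sub_comp h.resolve S (h.resolveComp ⁻¹' s) (c := collapse p)
    (i := Subtype.val) (r := fun _ => 0) ?_ Subtype.val_injective ?_ ?_).equivalent
    (isImmersion_sub S s) ?_ ?_
  · intro x y hx hy hxy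
    obtain ⟨x, rfl, -⟩ := hmem x hx
    obtain ⟨y, rfl, -⟩ := hmem y hy
    exact congrArg some hxy
  · intro x y z hx hy hz
    obtain ⟨x, rfl, -⟩ := hmem x hx
    obtain ⟨y, rfl, -⟩ := hmem y hy
    obtain ⟨z, rfl, -⟩ := hmem z hz
    exact sbtw_insert_some p x y z
  · intro l hl
    have hl' : h.resolve.comp (legVertex (h.resolvePair l)) ∈ h.resolveComp ⁻¹' s := by
      have := h.resolve.comp_legVertex_pair l
      change h.resolve.comp (legVertex (h.resolvePair l)) = _ at this
      rwa [this]
    exact (congrArg S.pair (hleg l hl)).trans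
      ((h.resolveLeg_resolvePair l).symm.trans (hleg _ hl').symm)
  · ext x
    constructor
    · rintro ⟨⟨y, hy⟩, rfl⟩
      have hy' := hy
      rw [Set.mem_preimage] at hy'
      exact ⟨⟨collapse p y, (h.resolveComp_inl y) ▸ hy'⟩, rfl⟩
    · rintro ⟨⟨y, hy⟩, rfl⟩
      exact ⟨⟨(some y : Option S.Circ), hy⟩, rfl⟩
  · ext x
    constructor
    · rintro ⟨y, rfl⟩
      exact ⟨⟨y.1.1, y.2⟩, rfl⟩
    · rintro ⟨⟨y, hy⟩, rfl⟩
      exact ⟨⟨⟨y, fun hyv => hv (hyv ▸ hy)⟩, hy⟩, rfl⟩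

/-- A subdiagram that contains the resolved vertex is resolved. -/
theorem IsStem.isResolution_sub (h : S.IsStem p v k a b) (s : Set S.Component)
    (hp : S.comp (Sum.inl p) ∈ s) (hv : S.comp (Sum.inr v) ∈ s) :
    (S.sub s).IsResolution ⟨p, hp⟩ ⟨v, hv⟩ a b (h.resolve.sub (h.resolveComp ⁻¹' s)) := by
  have hcirc : ∀ o : Option S.Circ, h.resolve.comp (h.circVertex o) ∈ h.resolveComp ⁻¹' s →
      S.comp (Sum.inl (collapse p o)) ∈ s := fun o ho => h.resolveComp_inl o ▸ ho
  have hcirc' : ∀ o : Option S.Circ, S.comp (Sum.inl (collapse p o)) ∈ s →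
      h.resolve.comp (h.circVertex o) ∈ h.resolveComp ⁻¹' s := fun o ho => by
    rw [Set.mem_preimage, h.resolveComp_inl]; exact ho
  have hj : ∀ l : h.resolve.SubCirc (h.resolveComp ⁻¹' s) ⊕
      h.resolve.SubInner (h.resolveComp ⁻¹' s) × Fin 3,
      S.comp (legVertex (S.resolveLeg p v a b (h.resolve.subIncl _ l))) ∈ s := by
    intro l
    exact (h.comp_resolveVertex (h.resolve.subIncl _ l)).subst (motive := (· ∈ s))
      (h.resolve.subIncl_mem _ l)
  obtain ⟨-, -, -, -, -, -, -, -, -, -, -, hsb, hnext, -⟩ := h.isResolution_resolve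
  refine ⟨⟨(none : Option S.Circ), hcirc' _ hp⟩, ⟨(some p : Option S.Circ), hcirc' _ hp⟩,
    fun t => ⟨collapse p t.1, hcirc _ t.2⟩, fun i => ⟨i.1.1, i.2⟩,
    fun l => S.subLeg s _ (hj l), ?_, ?_, ?_, ?_, ?_, ?_, ?_, ?_, ?_, ?_, ?_, ?_⟩
  · intro h'
    cases congrArg Subtype.val h'
  · rintro ⟨t, ht⟩
    rcases t with _ | t
    · exact iff_of_true rfl (Or.inl rfl)
    · refine ⟨fun h' => Or.inr (Subtype.ext (congrArg some (congrArg Subtype.val h'))), ?_⟩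
      rintro (h' | h')
      · cases congrArg Subtype.val h'
      · exact Subtype.ext (Option.some_injective _ (congrArg Subtype.val h'))
  · rintro ⟨c, hc⟩ hcp
    refine ⟨⟨(some c : Option S.Circ), hc⟩, rfl, ?_⟩
    rintro ⟨_ | t, ht⟩ ht'
    · exact (hcp ht'.symm).elim
    · obtain rfl : t = c := congrArg Subtype.val ht'
      rfl
  · rintro ⟨t, _⟩ ⟨t', _⟩ ⟨t'', _⟩ ht
    have ht' : sbtw (collapse p t) (collapse p t') (collapse p t'') := ht
    refine (sbtw_insert_iff p t t' t'' ?_).2 ht'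
    have h1 := ht'.ne_left
    have h2 := ht'.ne_right
    have h3 := ht'.ne_outer
    rintro ⟨rfl | rfl | rfl, h' | h' | h'⟩ <;> simp_all
  · rintro ⟨t, ht⟩ h1 h2
    exact sbtw_insert_pair p t (fun h' => h1 (Subtype.ext h')) (fun h' => h2 (Subtype.ext h'))
  · rintro ⟨i, hi⟩ ⟨j, hj⟩ hij
    have h' : i.1 = j.1 := congrArg (fun q : S.SubInner s => q.1) hij
    exact Subtype.ext (Subtype.ext h')
  · ext ⟨i, hi⟩
    constructor
    · rintro ⟨j, hj⟩ hi'
      exact j.1.2 ((congrArg Subtype.val hj).trans (congrArg Subtype.val hi'))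
    · intro hi'
      exact ⟨⟨⟨i, fun h' => hi' (Subtype.ext h')⟩, hi⟩, rfl⟩
  · rfl
  · apply S.subIncl_injective
    rw [S.subIncl_subLeg]
    exact if_pos rfl
  · rintro ⟨_ | t, ht⟩ h1 h2
    · exact (h1 rfl).elim
    · apply S.subIncl_injective
      rw [S.subIncl_subLeg]
      have : t ≠ p := by
        rintro rfl
        exact h2 rfl
      exact if_neg this
  · intro i m
    rfl
  · intro l
    apply S.subIncl_injective
    refine (S.subIncl_subPair s _).trans ?_
    rw [S.subIncl_subLeg, S.subIncl_subLeg]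
    exact (h.resolveLeg_resolvePair _).symm.trans
      (congrArg (S.resolveLeg p v a b) (h.resolve.subIncl_subPair _ l).symm)

open Classical in
/-- The two resolutions of a vertex differ by an exchange of the points `none` and `some p`. -/
theorem IsStem.pair_swap (h : S.IsStem p v k a b) (l : h.resolve.Leg) :
    h.symm.resolve.pair (mapLeg (Equiv.swap none (some p)) (Equiv.refl _) (fun _ => 0) l) =
      mapLeg (Equiv.swap none (some p)) (Equiv.refl _) (fun _ => 0) (h.resolve.pair l) := by
  have key : ∀ l : Option S.Circ ⊕ {i : S.Inner // i ≠ v} × Fin 3,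
      S.resolveLeg p v b a (mapLeg (Equiv.swap none (some p)) (Equiv.refl _) (fun _ => 0) l) =
        S.resolveLeg p v a b l := by
    rintro ((_ | c) | ⟨i, m⟩)
    · simp [mapLeg, resolveLeg]
    · by_cases hc : c = p
      · subst hc
        simp [mapLeg, resolveLeg]
      · simp [mapLeg, resolveLeg, Equiv.swap_apply_of_ne_of_ne, hc]
    · simp [mapLeg, resolveLeg]
  apply h.symm.resolveLeg_injective
  exact (h.symm.resolveLeg_resolvePair _).trans ((congrArg S.pair (key l)).trans
    ((h.resolveLeg_resolvePair l).symm.trans (key _).symm))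

open Classical in
/-- If both strands of the resolved vertex go to the same factor, the (STU)-relation in this factor
compares the summands of `S`, `T` and `U`. -/
theorem IsStem.sum_saturated (R : Type*) [Field R] (h : S.IsStem p v k a b) :
    ∑ s with h.IsSaturated s, coproductTerm R h.resolve s =
      ∑ s, coproductTerm R h.resolve (h.resolveComp ⁻¹' s) := by
  symm
  refine Finset.sum_bij (fun s _ => h.resolveComp ⁻¹' s) ?_ ?_ ?_ ?_
  · intro s _
    simpa using h.isSaturated_preimage s
  · intro s _ s' _ hs
    exact Set.preimage_injective.2 h.resolveComp_surjective hs
  · intro s hs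
    obtain ⟨s', hs'⟩ := IsSaturated.exists_preimage (Finset.mem_filter.1 hs).2
    exact ⟨s', Finset.mem_univ _, hs'⟩
  · intro s _
    rfl

open Classical in
/-- If the two strands of the resolved vertex are distributed to different factors, their order on
the circle is irrelevant. -/
theorem IsStem.sum_not_saturated (R : Type*) [Field R] (h : S.IsStem p v k a b) :
    ∑ s with ¬ h.IsSaturated s, coproductTerm R h.resolve s =
      ∑ s with ¬ h.symm.IsSaturated s, coproductTerm R h.symm.resolve s := by
  let ψ := compEquiv h.pair_swap
  have hψ : ∀ o, ψ (h.resolve.comp (h.circVertex o)) =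
      h.symm.resolve.comp (h.symm.circVertex (Equiv.swap none (some p) o)) := fun o => rfl
  have hsat : ∀ s, h.IsSaturated (ψ ⁻¹' s) ↔ h.symm.IsSaturated s := by
    intro s
    rw [IsSaturated, IsSaturated, Set.mem_preimage, Set.mem_preimage, hψ, hψ,
      Equiv.swap_apply_left, Equiv.swap_apply_right]
    exact Iff.comm
  have hcol : ∀ o, collapse p (Equiv.swap none (some p) o) = collapse p o := by
    rintro (_ | c)
    · simp
    · by_cases hc : c = p
      · simp [hc]
      · rw [Equiv.swap_apply_of_ne_of_ne] <;> simp [hc]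
  have key : ∀ s, ¬ h.symm.IsSaturated s →
      diagramClass R (h.resolve.sub (ψ ⁻¹' s)) = diagramClass R (h.symm.resolve.sub s) := by
    intro s hs
    refine diagramClass_eq_of_equivalent R (equivalent_sub_preimage h.pair_swap s ?_)
    rintro (x : Option S.Circ) (y : Option S.Circ) (z : Option S.Circ) hx hy hz
    have hs' : ∀ o : Option S.Circ, h.symm.resolve.comp (h.symm.circVertex
        (Equiv.swap none (some p) o)) ∈ s → ∀ o' : Option S.Circ, h.symm.resolve.comp
        (h.symm.circVertex (Equiv.swap none (some p) o')) ∈ s →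
        ¬ (o = none ∧ o' = some p) := by
      rintro _ h1 _ h2 ⟨rfl, rfl⟩
      rw [Equiv.swap_apply_left] at h1
      rw [Equiv.swap_apply_right] at h2
      exact hs (iff_of_true h2 h1)
    have h1 : ¬ ((x = none ∨ y = none ∨ z = none) ∧ (x = some p ∨ y = some p ∨ z = some p)) := by
      have := hs' x hx y hy
      have := hs' x hx z hz
      have := hs' y hy x hx
      have := hs' y hy z hz
      have := hs' z hz x hx
      have := hs' z hz y hy
      rintro ⟨rfl | rfl | rfl, h' | h' | h'⟩ <;> simp_all
    have h2 : ¬ ((Equiv.swap none (some p) x = none ∨ Equiv.swap none (some p) y = none ∨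
        Equiv.swap none (some p) z = none) ∧ (Equiv.swap none (some p) x = some p ∨
        Equiv.swap none (some p) y = some p ∨ Equiv.swap none (some p) z = some p)) := by
      simp only [Equiv.swap_apply_eq_iff, Equiv.swap_apply_left, Equiv.swap_apply_right]
      tauto
    refine (sbtw_insert_iff p _ _ _ h1).trans (Iff.trans ?_ (sbtw_insert_iff p _ _ _ h2).symm)
    rw [hcol, hcol, hcol]
  symm
  refine Finset.sum_bij (fun s _ => ψ ⁻¹' s) ?_ ?_ ?_ ?_
  · intro s hs
    simpa [hsat] using hs
  · intro s _ s' _ hs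
    exact (preimage_bijective ψ).1 hs
  · intro s hs
    obtain ⟨s', rfl⟩ := (preimage_bijective ψ).2 s
    exact ⟨s', by simpa [hsat] using hs, rfl⟩
  · intro s hs
    have hs := (Finset.mem_filter.1 hs).2
    rw [coproductTerm, coproductTerm, ← Set.preimage_compl, key s hs, key sᶜ]
    intro h'
    exact hs (not_iff_not.1 h')

theorem sum_coproductTerm_stu (R : Type*) [Field R]
    (h : S.pair (Sum.inl p) = Sum.inr (v, k)) :
    ∑ s, coproductTerm R S s = ∑ s, coproductTerm R (isStem_standard h).resolve s -
      ∑ s, coproductTerm R (isStem_standard h).symm.resolve s := by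
  classical
  set h1 := isStem_standard h
  rw [← Finset.sum_filter_add_sum_filter_not Finset.univ h1.IsSaturated,
    ← Finset.sum_filter_add_sum_filter_not Finset.univ h1.symm.IsSaturated,
    h1.sum_not_saturated R, add_sub_add_right_eq_sub, h1.sum_saturated R, h1.symm.sum_saturated R,
    ← Finset.sum_sub_distrib]
  have stu : ∀ s : Set S.Component, S.comp (Sum.inr v) ∈ s → diagramClass R (S.sub s) =
      diagramClass R (h1.resolve.sub (h1.resolveComp ⁻¹' s)) -
        diagramClass R (h1.symm.resolve.sub (h1.symm.resolveComp ⁻¹' s)) := by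
    intro s hv
    have hp : S.comp (Sum.inl p) ∈ s := h1.comp_eq ▸ hv
    refine diagramClass_stu R ⟨⟨p, hp⟩, ⟨v, hv⟩, k, ?_, h1.isResolution_sub s hp hv,
      h1.symm.isResolution_sub s hp hv⟩
    apply S.subIncl_injective
    refine (S.subIncl_subPair s _).trans ?_
    exact h
  refine Finset.sum_congr rfl fun s _ => ?_
  rw [coproductTerm, coproductTerm, coproductTerm, ← Set.preimage_compl, ← Set.preimage_compl]
  by_cases hv : S.comp (Sum.inr v) ∈ s
  · have hv' : S.comp (Sum.inr v) ∉ sᶜ := fun h' => h' hv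
    rw [diagramClass_eq_of_equivalent R (h1.equivalent_sub _ hv'),
      diagramClass_eq_of_equivalent R (h1.symm.equivalent_sub _ hv'), stu s hv,
      TensorProduct.sub_tmul]
  · rw [diagramClass_eq_of_equivalent R (h1.equivalent_sub _ hv),
      diagramClass_eq_of_equivalent R (h1.symm.equivalent_sub _ hv), stu sᶜ hv,
      TensorProduct.tmul_sub]

end Resolve

end TrivalentDiagram

theorem exists_isCoproduct (R : Type*) [Field R] : ∃ Δ, IsCoproduct R Δ :=
  exists_linearMap_diagramClass R
    (fun D => ∑ s : Set D.Component, TrivalentDiagram.coproductTerm R D s)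
    (fun _ _ h => h.sum_coproductTerm R)
    (fun _ _ _ _ h => TrivalentDiagram.sum_coproductTerm_stu R h)

/-! ### Faces of combinatorial maps -/

theorem quot_mk_eq_iff_of_involutive {X : Type*} {α : X → X} (hα : ∀ x, α (α x) = x)
    {r : X → X → Prop} (hr : ∀ x y, r x y ↔ y = α x) (x y : X) :
    Quot.mk r x = Quot.mk r y ↔ y = x ∨ y = α x := by
  constructor
  · intro h
    replace h := Quot.eqvGen_exact h
    induction h with
    | rel x y h => exact Or.inr ((hr x y).1 h)
    | refl x => exact Or.inl rfl
    | symm x y _ ih =>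
      rcases ih with rfl | rfl
      · exact Or.inl rfl
      · exact Or.inr (hα x).symm
    | trans x y z _ _ ih1 ih2 =>
      rcases ih1 with rfl | rfl <;> rcases ih2 with rfl | rfl
      · exact Or.inl rfl
      · exact Or.inr rfl
      · exact Or.inr rfl
      · exact Or.inl (hα x)
  · rintro (rfl | rfl)
    · rfl
    · exact Quot.sound ((hr _ _).2 rfl)

theorem two_mul_card_quot_of_involutive {X : Type*} [Finite X] {α : X → X}
    (hα : ∀ x, α (α x) = x) (hα' : ∀ x, α x ≠ x) {r : X → X → Prop}
    (hr : ∀ x y, r x y ↔ y = α x) : 2 * Nat.card (Quot r) = Nat.card X := by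
  classical
  have := Fintype.ofFinite (Quot r)
  rw [Nat.card_congr (Equiv.sigmaFiberEquiv (Quot.mk r)).symm, Nat.card_sigma]
  have h2 : ∀ q : Quot r, Nat.card {x // Quot.mk r x = q} = 2 := by
    rintro ⟨x⟩
    have : {y | Quot.mk r y = Quot.mk r x} = {x, α x} := by
      ext y
      rw [Set.mem_ofPred_eq, eq_comm, quot_mk_eq_iff_of_involutive hα hr]
      rfl
    change Nat.card {y | Quot.mk r y = Quot.mk r x} = 2
    rw [this, Nat.card_coe_set_eq, Set.ncard_pair (hα' x).symm]
  rw [Finset.sum_congr rfl fun q _ => h2 q, Finset.sum_const, Finset.card_univ, smul_eq_mul,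
    Nat.card_eq_fintype_card, mul_comm]

section Contraction

variable {X Y : Type*}

open Classical in
/-- The rotation at the vertex that arises when the edge with the half-edges `e₁` and `e₂` is
contracted. -/
noncomputable def contractedRotation (ρ : X → X) (e₁ e₂ x : X) : X :=
  if ρ x = e₁ then ρ e₂ else if ρ x = e₂ then ρ e₁ else ρ x

/-- The half-edges `e₁` and `e₂` form an edge joining two different vertices. -/
structure IsContractible (α ρ : X → X) (e₁ e₂ : X) : Prop where
  invol : ∀ x, α (α x) = x
  join : α e₁ = e₂
  rot₁ : ρ e₁ ≠ e₁ ∧ ρ e₁ ≠ e₂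
  rot₂ : ρ e₂ ≠ e₁ ∧ ρ e₂ ≠ e₂

variable {α ρ : X → X} {e₁ e₂ : X}

theorem IsContractible.join' (h : IsContractible α ρ e₁ e₂) : α e₂ = e₁ := by
  rw [← h.join, h.invol]

theorem IsContractible.contractedRotation_ne (h : IsContractible α ρ e₁ e₂) (x : X) :
    contractedRotation ρ e₁ e₂ x ≠ e₁ ∧ contractedRotation ρ e₁ e₂ x ≠ e₂ := by
  unfold contractedRotation
  split_ifs with h1 h2
  · exact h.rot₂
  · exact h.rot₁
  · exact ⟨h1, h2⟩

theorem IsContractible.ne_of_ne (h : IsContractible α ρ e₁ e₂) {x : X} (h1 : x ≠ e₁)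
    (h2 : x ≠ e₂) : α x ≠ e₁ ∧ α x ≠ e₂ :=
  ⟨fun h' => h2 (by rw [← h.invol x, h', h.join]), fun h' => h1 (by rw [← h.invol x, h', h.join'])⟩

/-- The boundaries of the faces after the contraction are parts of the boundaries of the faces
before. -/
theorem IsContractible.mk_contractedRotation (h : IsContractible α ρ e₁ e₂) (x : X) :
    Quot.mk (fun d d' => d' = ρ (α d)) (contractedRotation ρ e₁ e₂ (α x)) = Quot.mk _ x := by
  have step : ∀ x, Quot.mk (fun d d' => d' = ρ (α d)) (ρ (α x)) = Quot.mk _ x :=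
    fun x => (Quot.sound (r := fun d d' => d' = ρ (α d)) rfl).symm
  unfold contractedRotation
  split_ifs with h1 h2
  · rw [← step x, ← step (ρ (α x)), h1, h.join]
  · rw [← step x, ← step (ρ (α x)), h2, h.join']
  · exact step x

variable {β σ : Y → Y} {g₁ g₂ : Y}

open Classical in
/-- The map between the sets of faces induced by a map of the half-edges that remain after the
contraction of an edge. -/
noncomputable def contractionFaceMap (hX : IsContractible α ρ e₁ e₂)
    (hY : IsContractible β σ g₁ g₂) (m : X → Y)
    (hα : ∀ x, x ≠ e₁ → x ≠ e₂ → β (m x) = m (α x))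
    (hρ : ∀ x, x ≠ e₁ → x ≠ e₂ →
      contractedRotation σ g₁ g₂ (m x) = m (contractedRotation ρ e₁ e₂ x)) :
    Quot (fun d d' => d' = ρ (α d)) → Quot (fun d d' => d' = σ (β d)) :=
  Quot.lift (fun x => if x = e₁ ∨ x = e₂ then Quot.mk _ (m (ρ (α x))) else Quot.mk _ (m x)) (by
    rintro x _ rfl
    by_cases hx : x = e₁ ∨ x = e₂
    · have : ¬ (ρ (α x) = e₁ ∨ ρ (α x) = e₂) := by
        rcases hx with rfl | rfl
        · rw [hX.join]; exact not_or.2 hX.rot₂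
        · rw [hX.join']; exact not_or.2 hX.rot₁
      simp only [if_pos hx, if_neg this]
    · simp only [if_neg hx]
      obtain ⟨h1, h2⟩ := not_or.1 hx
      rw [← hY.mk_contractedRotation (m x), hα x h1 h2,
        hρ _ (hX.ne_of_ne h1 h2).1 (hX.ne_of_ne h1 h2).2]
      unfold contractedRotation
      by_cases k1 : ρ (α x) = e₁
      · rw [if_pos k1, if_pos (Or.inl k1), k1, hX.join]
      · by_cases k2 : ρ (α x) = e₂
        · rw [if_neg k1, if_pos k2, if_pos (Or.inr k2), k2, hX.join']
        · rw [if_neg k1, if_neg k2, if_neg (not_or.2 ⟨k1, k2⟩)])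

theorem contractionFaceMap_mk (hX : IsContractible α ρ e₁ e₂)
    (hY : IsContractible β σ g₁ g₂) (m : X → Y)
    (hα : ∀ x, x ≠ e₁ → x ≠ e₂ → β (m x) = m (α x))
    (hρ : ∀ x, x ≠ e₁ → x ≠ e₂ →
      contractedRotation σ g₁ g₂ (m x) = m (contractedRotation ρ e₁ e₂ x)) {x : X} (h1 : x ≠ e₁)
    (h2 : x ≠ e₂) : contractionFaceMap hX hY m hα hρ (Quot.mk _ x) = Quot.mk _ (m x) :=
  if_neg (not_or.2 ⟨h1, h2⟩)

/-- Every face has a half-edge that survives the contraction. -/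
theorem IsContractible.exists_rep (h : IsContractible α ρ e₁ e₂)
    (q : Quot (fun d d' => d' = ρ (α d))) : ∃ x, x ≠ e₁ ∧ x ≠ e₂ ∧ Quot.mk _ x = q := by
  obtain ⟨x⟩ := q
  have := h.contractedRotation_ne (α x)
  exact ⟨_, this.1, this.2, h.mk_contractedRotation x⟩

/-- Two combinatorial maps have the same number of faces if they become isomorphic when an edge of
each of them is contracted. -/
theorem card_faces_eq_of_contraction (hX : IsContractible α ρ e₁ e₂)
    (hY : IsContractible β σ g₁ g₂) (m : X → Y) (n : Y → X)
    (hm : ∀ x, x ≠ e₁ → x ≠ e₂ → m x ≠ g₁ ∧ m x ≠ g₂ ∧ n (m x) = x)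
    (hn : ∀ y, y ≠ g₁ → y ≠ g₂ → n y ≠ e₁ ∧ n y ≠ e₂ ∧ m (n y) = y)
    (hα : ∀ x, x ≠ e₁ → x ≠ e₂ → β (m x) = m (α x))
    (hρ : ∀ x, x ≠ e₁ → x ≠ e₂ →
      contractedRotation σ g₁ g₂ (m x) = m (contractedRotation ρ e₁ e₂ x)) :
    Nat.card (Quot (fun d d' => d' = ρ (α d))) = Nat.card (Quot (fun d d' => d' = σ (β d))) := by
  have hα' : ∀ y, y ≠ g₁ → y ≠ g₂ → α (n y) = n (β y) := by
    intro y h1 h2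
    obtain ⟨k1, k2, k3⟩ := hn y h1 h2
    obtain ⟨l1, l2⟩ := hX.ne_of_ne k1 k2
    rw [← (hm _ l1 l2).2.2, ← hα _ k1 k2, k3]
  have hρ' : ∀ y, y ≠ g₁ → y ≠ g₂ →
      contractedRotation ρ e₁ e₂ (n y) = n (contractedRotation σ g₁ g₂ y) := by
    intro y h1 h2
    obtain ⟨k1, k2, k3⟩ := hn y h1 h2
    obtain ⟨l1, l2⟩ := hX.contractedRotation_ne (n y)
    rw [← (hm _ l1 l2).2.2, ← hρ _ k1 k2, k3]
  refine Nat.card_congr ⟨contractionFaceMap hX hY m hα hρ, contractionFaceMap hY hX n hα' hρ',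
    fun q => ?_, fun q => ?_⟩
  · obtain ⟨x, h1, h2, rfl⟩ := hX.exists_rep q
    obtain ⟨k1, k2, k3⟩ := hm x h1 h2
    rw [contractionFaceMap_mk _ _ _ _ _ h1 h2, contractionFaceMap_mk _ _ _ _ _ k1 k2, k3]
  · obtain ⟨x, h1, h2, rfl⟩ := hY.exists_rep q
    obtain ⟨k1, k2, k3⟩ := hn x h1 h2
    rw [contractionFaceMap_mk _ _ _ _ _ h1 h2, contractionFaceMap_mk _ _ _ _ _ k1 k2, k3]

end Contraction

/-! ### Edges and faces of diagrams -/

namespace TrivalentDiagram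

/-- The successor of a vertex on the oriented circle. -/
noncomputable def next (D : TrivalentDiagram) : Equiv.Perm D.Circ :=
  Equiv.ofBijective (fun a => (exists_isCircularNext a).choose)
    (Finite.injective_iff_bijective.1 fun a b h =>
      (exists_isCircularNext a).choose_spec.eq_left (by
        change (exists_isCircularNext a).choose = _ at h
        rw [h]; exact (exists_isCircularNext b).choose_spec))

theorem isCircularNext_next (D : TrivalentDiagram) (a : D.Circ) : IsCircularNext a (D.next a) :=
  (exists_isCircularNext a).choose_spec

theorem isNext_iff (D : TrivalentDiagram) (a b : D.Circ) : D.IsNext a b ↔ b = D.next a :=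
  ⟨fun h => IsCircularNext.eq h (D.isCircularNext_next a), fun h => h ▸ D.isCircularNext_next a⟩

/-- The other half-edge of the edge of a half-edge. -/
noncomputable def opp (D : TrivalentDiagram) : D.Dart → D.Dart
  | (Sum.inl c, 0) => (Sum.inl (D.next c), 2)
  | (Sum.inl c, 1) => D.legDart (D.pair (Sum.inl c))
  | (Sum.inl c, 2) => (Sum.inl (D.next.symm c), 0)
  | (Sum.inr i, m) => D.legDart (D.pair (Sum.inr (i, m)))

theorem opp_legDart (D : TrivalentDiagram) (l : D.Leg) :
    D.opp (D.legDart l) = D.legDart (D.pair l) := by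
  rcases l with c | ⟨i, m⟩ <;> rfl

theorem dart_cases (D : TrivalentDiagram) (d : D.Dart) :
    (∃ l, d = D.legDart l) ∨ (∃ c, d = (Sum.inl c, 0)) ∨ ∃ c, d = (Sum.inl c, 2) := by
  rcases d with ⟨c | i, m⟩
  · fin_cases m
    · exact Or.inr (Or.inl ⟨c, rfl⟩)
    · exact Or.inl ⟨Sum.inl c, rfl⟩
    · exact Or.inr (Or.inr ⟨c, rfl⟩)
  · exact Or.inl ⟨Sum.inr (i, m), rfl⟩

theorem opp_opp (D : TrivalentDiagram) (d : D.Dart) : D.opp (D.opp d) = d := by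
  rcases D.dart_cases d with ⟨l, rfl⟩ | ⟨c, rfl⟩ | ⟨c, rfl⟩
  · rw [opp_legDart, opp_legDart, D.pair_pair]
  · simp [opp]
  · simp [opp]

theorem legDart_injective (D : TrivalentDiagram) : Function.Injective D.legDart := by
  rintro (c | ⟨i, m⟩) (c' | ⟨i', m'⟩) h <;> simp_all [legDart]

theorem opp_ne (D : TrivalentDiagram) (d : D.Dart) : D.opp d ≠ d := by
  rcases D.dart_cases d with ⟨l, rfl⟩ | ⟨c, rfl⟩ | ⟨c, rfl⟩
  · rw [opp_legDart]
    exact fun h => D.pair_ne l (D.legDart_injective h)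
  · simp [opp]
  · simp [opp]

theorem joined_iff (D : TrivalentDiagram) (d e : D.Dart) : D.Joined d e ↔ e = D.opp d := by
  constructor
  · rintro (⟨l, rfl, rfl⟩ | ⟨a, b, h, ⟨rfl, rfl⟩ | ⟨rfl, rfl⟩⟩)
    · rw [opp_legDart]
    · rw [isNext_iff] at h
      rw [h]; rfl
    · rw [isNext_iff] at h
      simp [h, opp]
  · rintro rfl
    rcases D.dart_cases d with ⟨l, rfl⟩ | ⟨c, rfl⟩ | ⟨c, rfl⟩
    · exact Or.inl ⟨l, rfl, opp_legDart D l⟩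
    · exact Or.inr ⟨c, D.next c, (isNext_iff D _ _).2 rfl, Or.inl ⟨rfl, rfl⟩⟩
    · exact Or.inr ⟨D.next.symm c, c, (isNext_iff D _ _).2 (D.next.apply_symm_apply c).symm,
        Or.inr ⟨rfl, rfl⟩⟩

theorem faceStep_iff (D : TrivalentDiagram) (F : Finset D.Vertex) (d d' : D.Dart) :
    D.FaceStep F d d' ↔ d' = D.turn F (D.opp d) := by
  simp [FaceStep, joined_iff]

theorem faceStep_eq (D : TrivalentDiagram) (F : Finset D.Vertex) :
    D.FaceStep F = fun d d' => d' = D.turn F (D.opp d) := by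
  ext; exact D.faceStep_iff F _ _

theorem two_mul_card_edges (D : TrivalentDiagram) :
    2 * Nat.card (Quot D.Joined) = 3 * Nat.card D.Vertex := by
  rw [two_mul_card_quot_of_involutive D.opp_opp D.opp_ne D.joined_iff, Nat.card_prod,
    Nat.card_eq_fintype_card (α := Fin 3), Fintype.card_fin, mul_comm]

theorem isSphereEmbedding_congr {D D' : TrivalentDiagram} {F : Finset D.Vertex}
    {F' : Finset D'.Vertex} (hV : Nat.card D.Vertex = Nat.card D'.Vertex)
    (hF : Nat.card (Quot (D.FaceStep F)) = Nat.card (Quot (D'.FaceStep F'))) :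
    D.IsSphereEmbedding F ↔ D'.IsSphereEmbedding F' := by
  have h1 := D.two_mul_card_edges
  have h2 := D'.two_mul_card_edges
  have h3 : ∀ D : TrivalentDiagram, IsEmpty D.Vertex ↔ Nat.card D.Vertex = 0 := fun D => by
    rw [Nat.card_eq_zero]
    exact ⟨Or.inl, fun h => h.resolve_right fun h' => not_finite D.Vertex⟩
  rw [IsSphereEmbedding, IsSphereEmbedding, h3, h3]
  omega

/-- `F` is an embedding into an oriented 2-sphere; if `b` is false, `D` is moreover required to lie in
the disk to the left of the circle. -/
def IsCounted (b : Prop) (D : TrivalentDiagram) (F : Finset D.Vertex) : Prop :=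
  D.IsSphereEmbedding F ∧ (b ∨ ∀ c, Sum.inl c ∉ F)

open Classical in
/-- The signed number of embeddings of `D` into an oriented 2-sphere; if `b` is false, only those
embeddings are counted for which `D` lies in the disk to the left of the circle. -/
noncomputable def signedCount (b : Prop) (D : TrivalentDiagram) : ℤ :=
  ∑ F : Finset D.Vertex,
    if IsCounted b D F then (-1) ^ F.card else 0

theorem signedCount_true (D : TrivalentDiagram) : signedCount True D = D.embeddingNumber := by
  classical
  simp only [signedCount, IsCounted, embeddingNumber, true_or, and_true, Finset.sum_filter]

theorem Equivalent.signedCount_eq (b : Prop) {D D' : TrivalentDiagram} (h : D.Equivalent D') :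
    signedCount b D = signedCount b D' := by
  classical
  obtain ⟨e, f, r, h1, h2⟩ := h
  let V : D.Vertex ≃ D'.Vertex := Equiv.sumCongr e f
  let ε : D.Dart ≃ D'.Dart :=
    { toFun := fun d => (V d.1, d.2 + Sum.elim (fun _ => 0) r d.1)
      invFun := fun d => (V.symm d.1, d.2 - Sum.elim (fun _ => 0) r (V.symm d.1))
      left_inv := fun d => by simp
      right_inv := fun d => by simp }
  have hleg : ∀ l, ε (D.legDart l) = D'.legDart (mapLeg e f r l) := by
    rintro (c | ⟨i, m⟩)
    · simp [ε, legDart, mapLeg, V]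
    · simp [ε, legDart, mapLeg, V]
  have hnext : ∀ c, e (D.next c) = D'.next (e c) := by
    intro c
    have hc := D.isCircularNext_next c
    rw [← isNext_iff]
    refine ⟨fun x hx => ?_, fun hx x => ?_⟩
    · obtain ⟨x, rfl⟩ := e.surjective x
      exact hc.1 x ((h1 _ _ _).2 hx)
    · obtain ⟨x, rfl⟩ := e.surjective x
      rw [hc.2 (e.injective hx) x]
  have hopp : ∀ d, D'.opp (ε d) = ε (D.opp d) := by
    intro d
    rcases D.dart_cases d with ⟨l, rfl⟩ | ⟨c, rfl⟩ | ⟨c, rfl⟩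
    · rw [opp_legDart, hleg, hleg, opp_legDart]
      exact congrArg _ (h2 l)
    · simp [ε, opp, V, hnext]
    · have : D'.next.symm (e c) = e (D.next.symm c) := by
        rw [Equiv.symm_apply_eq, ← hnext, Equiv.apply_symm_apply]
      simp [ε, opp, V, this]
  refine Fintype.sum_equiv (Equiv.finsetCongr V) _ _ fun F => ?_
  have hmem : ∀ u, V u ∈ Equiv.finsetCongr V F ↔ u ∈ F := fun u => by
    simp [Equiv.finsetCongr_apply]
  have hturn : ∀ d, D'.turn (Equiv.finsetCongr V F) (ε d) = ε (D.turn F d) := by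
    intro d
    by_cases hd : d.1 ∈ F
    · simp [turn, ε, hd]; abel
    · simp [turn, ε, hd]; abel
  have hcard : Nat.card (Quot (D.FaceStep F)) =
      Nat.card (Quot (D'.FaceStep (Equiv.finsetCongr V F))) := by
    refine Nat.card_congr (Quot.congr ε fun d d' => ?_)
    rw [faceStep_iff, faceStep_iff, hopp, hturn, ε.injective.eq_iff]
  have hQ : (∀ c, Sum.inl c ∉ F) ↔ ∀ c, Sum.inl c ∉ Equiv.finsetCongr V F := by
    rw [← e.forall_congr_right]
    exact forall_congr' fun c => not_iff_not.2 (hmem (Sum.inl c)).symm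
  have hcount : IsCounted b D F ↔ IsCounted b D' (Equiv.finsetCongr V F) :=
    and_congr (isSphereEmbedding_congr (Nat.card_congr V) hcard) (or_congr Iff.rfl hQ)
  rw [if_congr hcount rfl rfl, Equiv.finsetCongr_apply, Finset.card_map]

end TrivalentDiagram

/-! ### The (STU)-relation for signed counts of embeddings -/

namespace TrivalentDiagram

theorem turn_of_mem {D : TrivalentDiagram} {F : Finset D.Vertex} {u : D.Vertex} (h : u ∈ F)
    (j : Fin 3) : D.turn F (u, j) = (u, j - 1) := by
  simp [turn, h]

theorem turn_of_notMem {D : TrivalentDiagram} {F : Finset D.Vertex} {u : D.Vertex} (h : u ∉ F)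
    (j : Fin 3) : D.turn F (u, j) = (u, j + 1) := by
  simp [turn, h]

theorem turn_ne {D : TrivalentDiagram} (F : Finset D.Vertex) (d : D.Dart) : D.turn F d ≠ d := by
  have : ∀ j : Fin 3, j - 1 ≠ j ∧ j + 1 ≠ j := by decide
  rcases d with ⟨u, j⟩
  by_cases h : u ∈ F
  · rw [turn_of_mem h]
    exact fun h' => (this j).1 (Prod.ext_iff.1 h').2
  · rw [turn_of_notMem h]
    exact fun h' => (this j).2 (Prod.ext_iff.1 h').2

theorem isContractible_opp {D : TrivalentDiagram} (F : Finset D.Vertex) (d : D.Dart)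
    (h : d.1 ≠ (D.opp d).1) : IsContractible D.opp (D.turn F) d (D.opp d) where
  invol := D.opp_opp
  join := rfl
  rot₁ := ⟨turn_ne F d, fun h' => h (show (D.turn F d).1 = _ from congrArg Prod.fst h')⟩
  rot₂ := ⟨fun h' => h (show (D.turn F (D.opp d)).1 = _ from congrArg Prod.fst h').symm,
    turn_ne F _⟩

section Resolve

variable {S : TrivalentDiagram} {p : S.Circ} {v : S.Inner} {k a b : Fin 3}

theorem IsStem.next_none (h : S.IsStem p v k a b) :
    h.resolve.next (none : Option S.Circ) = (some p : Option S.Circ) := by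
  refine ((h.resolve.isNext_iff _ _).1 ?_).symm
  let := insertCircularOrder p
  refine ⟨fun (x : Option S.Circ) (hx : sbtw none x (some p)) => ?_, fun h' => nomatch h'⟩
  have := sbtw_insert_pair p x hx.ne_left.symm hx.ne_right
  exact hx.not_sbtw this.cyclic_left

open Classical in
theorem IsStem.next_some (h : S.IsStem p v k a b) (c : S.Circ) :
    h.resolve.next (some c : Option S.Circ) =
      (if S.next c = p then none else some (S.next c) : Option S.Circ) := by
  refine ((h.resolve.isNext_iff _ _).1 ?_).symm
  let := insertCircularOrder p
  have hc := S.isCircularNext_next c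
  split_ifs with hp
  · rw [hp] at hc
    refine ⟨fun (x : Option S.Circ) (hx : sbtw (some c) x none) => ?_, fun h' => nomatch h'⟩
    by_cases hcp : c = p
    · rcases x with _ | x
      · exact sbtw_irrefl_right hx
      · rw [hc.2 hcp x] at hx
        exact sbtw_irrefl_left hx
    · have h1 := sbtw_insert_pair p (some c) (by simp) (by simpa using hcp)
      by_cases hxp : x = some p
      · subst hxp
        exact h1.not_sbtw hx
      · have := (sbtw_insert_iff p _ _ _ (by simp [hcp, hxp])).1 hx
        exact hc.1 _ this
  · refine ⟨fun (x : Option S.Circ) (hx : sbtw (some c) x (some (S.next c))) => ?_,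
      fun h' (x : Option S.Circ) => ?_⟩
    · rcases x with _ | x
      · have := (sbtw_insert_none p _ _).1 hx.cyclic_left
        rcases this with h' | h'
        · exact hp h'.1
        · exact hc.1 p h'.cyclic_right
      · exact hc.1 x ((sbtw_insert_some p _ _ _).1 hx)
    · have h1 := Option.some_injective _ h'
      exact (hp (h1.symm.trans (hc.2 h1 p).symm)).elim

open Classical in
/-- The half-edges of `S` that correspond to those of the resolution (apart from the ones of the new
arc of the circle). -/
noncomputable def resolveDart (S : TrivalentDiagram) (p : S.Circ) (v : S.Inner) (a b : Fin 3) :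
    (Option S.Circ ⊕ {i : S.Inner // i ≠ v}) × Fin 3 → S.Dart
  | (Sum.inl none, 1) => (Sum.inr v, a)
  | (Sum.inl none, _) => (Sum.inl p, 2)
  | (Sum.inl (some c), j) => if c = p ∧ j = 1 then (Sum.inr v, b) else (Sum.inl c, j)
  | (Sum.inr i, j) => (Sum.inr i.1, j)

open Classical in
/-- The half-edges of the resolution that correspond to those of `S` (apart from the ones of the
edge joining `p` and `v`). -/
noncomputable def unresolveDart (S : TrivalentDiagram) (p : S.Circ) (v : S.Inner) (a : Fin 3) :
    S.Dart → (Option S.Circ ⊕ {i : S.Inner // i ≠ v}) × Fin 3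
  | (Sum.inl c, j) => if c = p ∧ j = 2 then (Sum.inl none, 2) else (Sum.inl (some c), j)
  | (Sum.inr i, j) => if h : i = v then
      (if j = a then (Sum.inl none, 1) else (Sum.inl (some p), 1)) else (Sum.inr ⟨i, h⟩, j)

theorem IsStem.resolveDart_legDart (h : S.IsStem p v k a b) (l : h.resolve.Leg) :
    S.resolveDart p v a b (h.resolve.legDart l) = S.legDart (S.resolveLeg p v a b l) := by
  rcases l with (_ | c) | ⟨i, m⟩
  · rfl
  · change S.resolveDart p v a b (Sum.inl (some c), 1) = _
    by_cases hc : c = p <;> simp [legDart, resolveDart, resolveLeg, hc]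
  · rfl

theorem IsStem.opp_resolveDart (h : S.IsStem p v k a b) (d : h.resolve.Dart)
    (h1 : d ≠ (h.circVertex none, 0)) (h2 : d ≠ (h.circVertex (some p), 2)) :
    S.opp (S.resolveDart p v a b d) = S.resolveDart p v a b (h.resolve.opp d) := by
  classical
  have out : ∀ c : S.Circ, S.opp (S.resolveDart p v a b (Sum.inl (some c), 0)) =
      S.resolveDart p v a b (h.resolve.opp (h.circVertex (some c), 0)) := by
    intro c
    have e : h.resolve.opp (h.circVertex (some c), 0) =
      (h.circVertex (if S.next c = p then none else some (S.next c)), 2) :=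
      congrArg (fun o => (h.circVertex o, (2 : Fin 3))) (h.next_some c)
    rw [e]
    split_ifs with hp
    · simp [resolveDart, opp, hp]
      rfl
    · simp [resolveDart, opp]
  rcases h.resolve.dart_cases d with ⟨l, rfl⟩ | ⟨c, rfl⟩ | ⟨c, rfl⟩
  · rw [opp_legDart, h.resolveDart_legDart, h.resolveDart_legDart, opp_legDart]
    exact congrArg _ (h.resolveLeg_resolvePair l).symm
  · rcases c with _ | c
    · exact (h1 rfl).elim
    · exact out c
  · obtain ⟨(_ | c), rfl⟩ : ∃ o : Option S.Circ, h.resolve.next o = c :=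
      ⟨h.resolve.next.symm c, h.resolve.next.apply_symm_apply c⟩
    · exact (h2 (congrArg (fun o => (h.circVertex o, (2 : Fin 3))) h.next_none)).elim
    · have e : h.resolve.opp (h.circVertex (some c), 0) =
        (Sum.inl (h.resolve.next (some c : Option S.Circ)), 2) := rfl
      have := out c
      rw [e] at this
      have e' : h.resolve.opp (Sum.inl (h.resolve.next (some c : Option S.Circ)), 2) =
        (h.circVertex (some c), 0) := by rw [← e, opp_opp]
      rw [e']
      exact (congrArg S.opp this.symm).trans (S.opp_opp _)

theorem IsStem.opp_circ (h : S.IsStem p v k a b) :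
    h.resolve.opp (h.circVertex none, 0) = (h.circVertex (some p), 2) :=
  congrArg (fun o => (h.circVertex o, (2 : Fin 3))) h.next_none

theorem IsStem.isContractible_resolve (h : S.IsStem p v k a b) (F : Finset h.resolve.Vertex) :
    IsContractible h.resolve.opp (h.resolve.turn F) (h.circVertex none, 0)
      (h.circVertex (some p), 2) := by
  have := isContractible_opp F (h.circVertex none, 0) (by
    rw [h.opp_circ]; exact fun h' => nomatch h')
  rwa [h.opp_circ] at this

theorem IsStem.isContractible (h : S.IsStem p v k a b) (F : Finset S.Vertex) :
    IsContractible S.opp (S.turn F) (Sum.inl p, 1) (Sum.inr v, k) := by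
  have e : S.opp (Sum.inl p, 1) = (Sum.inr v, k) := by
    simp [opp, h.pair_eq, legDart]
  have := isContractible_opp F (Sum.inl p, 1) (by rw [e]; simp)
  rwa [e] at this

end Resolve

open Classical in
/-- The rotation on half-edges that is reversed exactly at the vertices satisfying `P`. -/
noncomputable def turnBy {V : Type} (P : V → Prop) (d : V × Fin 3) : V × Fin 3 :=
  (d.1, if P d.1 then d.2 - 1 else d.2 + 1)

theorem turn_eq_turnBy (D : TrivalentDiagram) (F : Finset D.Vertex) :
    D.turn F = turnBy (fun u => u ∈ F) := by
  funext d
  by_cases h : d.1 ∈ F <;> simp [turn, turnBy, h]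

section Resolve

variable {S : TrivalentDiagram} {p : S.Circ} {v : S.Inner} {k a b : Fin 3}

/-- The rotation at `v` runs through the strands in the same direction as the rotation at `p`, if the
strands `b`, `a` are placed to the right and to the left of the half-edge joining `v` to `p`. -/
def RotationsMatch (S : TrivalentDiagram) (p : S.Circ) (v : S.Inner) (k a b : Fin 3)
    (Q : S.Vertex → Prop) : Prop :=
  (b = k + 1 ∧ a = k + 2 ∧ (Q (Sum.inr v) ↔ Q (Sum.inl p))) ∨
    (b = k + 2 ∧ a = k + 1 ∧ (Q (Sum.inr v) ↔ ¬ Q (Sum.inl p)))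

theorem contractedRotation_resolveDart {Q : S.Vertex → Prop}
    {P : Option S.Circ ⊕ {i : S.Inner // i ≠ v} → Prop}
    (hPQ : ∀ u, u ≠ Sum.inl none → (Q (resolveVertex S v u) ↔ P u))
    (hP : P (Sum.inl none) ↔ P (Sum.inl (some p))) (hQ : RotationsMatch S p v k a b Q)
    (x : (Option S.Circ ⊕ {i : S.Inner // i ≠ v}) × Fin 3)
    (h1 : x ≠ (Sum.inl none, 0)) (h2 : x ≠ (Sum.inl (some p), 2)) :
    contractedRotation (turnBy Q) (Sum.inl p, 1) (Sum.inr v, k) (S.resolveDart p v a b x) =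
      S.resolveDart p v a b
        (contractedRotation (turnBy P) (Sum.inl none, 0) (Sum.inl (some p), 2) x) := by
  have hp : Q (Sum.inl p) ↔ P (Sum.inl (some p)) := hPQ (Sum.inl (some p)) (by simp)
  have f3 : ∀ k : Fin 3, k + 2 + 1 = k ∧ k + 1 + 1 = k + 2 ∧ k + 2 - 1 = k + 1 ∧ k + 1 - 1 = k ∧
      k - 1 = k + 2 ∧ k + 1 ≠ k ∧ k + 2 ≠ k ∧ k + 1 ≠ k + 2 ∧ k + 2 ≠ k + 1 := by decide
  obtain ⟨i1, i2, i3, i4, i5, i6, i7, i8, i9⟩ := f3 k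
  have n1 : (1 : Fin 3) + 1 = 2 := rfl
  have n2 : (2 : Fin 3) + 1 = 0 := rfl
  have n3 : (2 : Fin 3) - 1 = 1 := rfl
  have n4 : (0 : Fin 3) - 1 = 2 := rfl
  have n5 : (0 : Fin 3) + 1 = 1 := rfl
  have n6 : (1 : Fin 3) - 1 = 0 := rfl
  rcases x with ⟨(_ | c) | ⟨i, hi⟩, j⟩
  · rcases hQ with ⟨rfl, rfl, hQ⟩ | ⟨rfl, rfl, hQ⟩ <;> by_cases hf : P (Sum.inl (some p)) <;>
      rw [hp] at hQ <;>
      have hf' := hf <;> rw [← hp] at hf' <;>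
      have hf'' := hf <;> rw [← hP] at hf'' <;>
      simp only [hf, not_true, not_false_iff, iff_true, iff_false] at hQ <;>
      fin_cases j <;>
      simp_all [contractedRotation, turnBy, resolveDart]
  · by_cases hc : c = p
    · subst hc
      rcases hQ with ⟨rfl, rfl, hQ⟩ | ⟨rfl, rfl, hQ⟩ <;> by_cases hf : P (Sum.inl (some c)) <;>
      rw [hp] at hQ <;>
      have hf' := hf <;> rw [← hp] at hf' <;>
      have hf'' := hf <;> rw [← hP] at hf'' <;>
      simp only [hf, not_true, not_false_iff, iff_true, iff_false] at hQ <;>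
      fin_cases j <;>
      simp_all [contractedRotation, turnBy, resolveDart]
    · have hc' : Q (Sum.inl c) ↔ P (Sum.inl (some c)) := hPQ (Sum.inl (some c)) (by simp)
      by_cases hq : P (Sum.inl (some c)) <;> rw [← hc'] at hq <;>
        simp [contractedRotation, turnBy, resolveDart, hc, ← hc', hq]
  · have hi' : Q (Sum.inr i) ↔ P (Sum.inr ⟨i, hi⟩) := hPQ (Sum.inr ⟨i, hi⟩) (by simp)
    by_cases hq : P (Sum.inr ⟨i, hi⟩) <;> rw [← hi'] at hq <;>
      simp [contractedRotation, turnBy, resolveDart, hi, ← hi', hq]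

end Resolve

end TrivalentDiagram

namespace TrivalentDiagram

section Resolve

variable {S : TrivalentDiagram} {p : S.Circ} {v : S.Inner} {k a b : Fin 3}

theorem IsStem.resolveDart_spec (h : S.IsStem p v k a b)
    (x : (Option S.Circ ⊕ {i : S.Inner // i ≠ v}) × Fin 3)
    (h1 : x ≠ (Sum.inl none, 0)) (h2 : x ≠ (Sum.inl (some p), 2)) :
    S.resolveDart p v a b x ≠ (Sum.inl p, 1) ∧ S.resolveDart p v a b x ≠ (Sum.inr v, k) ∧
      S.unresolveDart p v a (S.resolveDart p v a b x) = x := by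
  have := h.ne_left
  have := h.ne_right
  have := h.ne.symm
  rcases x with ⟨(_ | c) | ⟨i, hi⟩, j⟩
  · fin_cases j <;> simp_all [resolveDart, unresolveDart]
  · by_cases hc : c = p
    · subst hc
      fin_cases j <;> simp_all [resolveDart, unresolveDart]
    · simp [resolveDart, unresolveDart, hc]
  · simp [resolveDart, unresolveDart, hi]

theorem IsStem.unresolveDart_spec (h : S.IsStem p v k a b) (y : S.Dart)
    (h1 : y ≠ (Sum.inl p, 1)) (h2 : y ≠ (Sum.inr v, k)) :
    S.unresolveDart p v a y ≠ (Sum.inl none, 0) ∧ S.unresolveDart p v a y ≠ (Sum.inl (some p), 2) ∧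
      S.resolveDart p v a b (S.unresolveDart p v a y) = y := by
  have := h.ne_left
  have := h.ne_right
  have := h.ne.symm
  rcases y with ⟨c | i, j⟩
  · by_cases hc : c = p
    · subst hc
      fin_cases j <;> simp_all [resolveDart, unresolveDart]
    · simp [resolveDart, unresolveDart, hc]
  · by_cases hi : i = v
    · subst hi
      rcases h.eq_or j with rfl | rfl | rfl <;> simp_all [resolveDart, unresolveDart]
    · simp [resolveDart, unresolveDart, hi]

/-- The embeddings of the resolution that are the same at both new circle vertices correspond to
embeddings of `S`: contract the new arc of the circle and the edge joining `p` and `v`. -/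
theorem IsStem.card_faces_resolve (h : S.IsStem p v k a b) {F : Finset S.Vertex}
    {F' : Finset h.resolve.Vertex}
    (hF : ∀ u : h.resolve.Vertex, u ≠ h.circVertex none → (resolveVertex S v u ∈ F ↔ u ∈ F'))
    (hF' : h.circVertex none ∈ F' ↔ h.circVertex (some p) ∈ F')
    (hv : RotationsMatch S p v k a b (fun u => u ∈ F)) :
    Nat.card (Quot (h.resolve.FaceStep F')) = Nat.card (Quot (S.FaceStep F)) := by
  rw [faceStep_eq, faceStep_eq]
  refine card_faces_eq_of_contraction (h.isContractible_resolve F') (h.isContractible F)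
    (S.resolveDart p v a b) (S.unresolveDart p v a) h.resolveDart_spec h.unresolveDart_spec
    h.opp_resolveDart ?_
  rw [turn_eq_turnBy, turn_eq_turnBy]
  exact contractedRotation_resolveDart (P := fun u => (u : h.resolve.Vertex) ∈ F') hF hF' hv

open Classical in
/-- The exchange of the half-edges off the circle at `none` and `some p`. -/
noncomputable def swapDart (S : TrivalentDiagram) (p : S.Circ) (v : S.Inner)
    (d : (Option S.Circ ⊕ {i : S.Inner // i ≠ v}) × Fin 3) :
    (Option S.Circ ⊕ {i : S.Inner // i ≠ v}) × Fin 3 :=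
  if d = (Sum.inl none, 1) then (Sum.inl (some p), 1)
  else if d = (Sum.inl (some p), 1) then (Sum.inl none, 1) else d

theorem swapDart_swapDart (d : (Option S.Circ ⊕ {i : S.Inner // i ≠ v}) × Fin 3) :
    S.swapDart p v (S.swapDart p v d) = d := by
  unfold swapDart
  by_cases h1 : d = (Sum.inl none, 1)
  · simp [h1]
  · by_cases h2 : d = (Sum.inl (some p), 1) <;> simp [h1, h2]

theorem swapDart_ne (d : (Option S.Circ ⊕ {i : S.Inner // i ≠ v}) × Fin 3)
    (h1 : d ≠ (Sum.inl none, 0)) (h2 : d ≠ (Sum.inl (some p), 2)) :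
    S.swapDart p v d ≠ (Sum.inl none, 0) ∧ S.swapDart p v d ≠ (Sum.inl (some p), 2) := by
  unfold swapDart
  split_ifs <;> simp_all

theorem IsStem.opp_swapDart (h : S.IsStem p v k a b) (d : h.resolve.Dart) :
    h.symm.resolve.opp (S.swapDart p v d) = S.swapDart p v (h.resolve.opp d) := by
  classical
  have hnext : ∀ o : Option S.Circ, h.symm.resolve.next o = h.resolve.next o := by
    rintro (_ | c)
    · exact h.symm.next_none.trans h.next_none.symm
    · exact (h.symm.next_some c).trans (h.next_some c).symm
  have hnext' : ∀ o : Option S.Circ, h.symm.resolve.next.symm o = h.resolve.next.symm o := by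
    intro o
    refine (Equiv.symm_apply_eq _).2 ?_
    exact ((hnext _).trans (h.resolve.next.apply_symm_apply o)).symm
  have hleg : ∀ l : Option S.Circ ⊕ {i : S.Inner // i ≠ v} × Fin 3,
      S.swapDart p v (h.resolve.legDart l) = h.symm.resolve.legDart
        (mapLeg (Equiv.swap none (some p)) (Equiv.refl _) (fun _ => 0) l) := by
    rintro ((_ | c) | ⟨i, m⟩)
    · change S.swapDart p v (Sum.inl none, 1) = (Sum.inl (Equiv.swap none (some p) none), 1)
      rw [Equiv.swap_apply_left]
      simp [swapDart]
    · change S.swapDart p v (Sum.inl (some c), 1) =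
        (Sum.inl (Equiv.swap none (some p) (some c)), 1)
      by_cases hc : c = p
      · rw [hc, Equiv.swap_apply_right]
        simp [swapDart]
      · rw [Equiv.swap_apply_of_ne_of_ne (by simp) (by simpa using hc)]
        simp [swapDart, hc]
    · change S.swapDart p v (Sum.inr i, m) = (Sum.inr i, m + 0)
      simp [swapDart]
  have arc : ∀ (o : Option S.Circ) (j : Fin 3), j ≠ 1 →
      S.swapDart p v (Sum.inl o, j) = (Sum.inl o, j) := by
    intro o j hj
    simp [swapDart, hj]
  rcases h.resolve.dart_cases d with ⟨l, rfl⟩ | ⟨c, rfl⟩ | ⟨c, rfl⟩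
  · rw [opp_legDart]
    refine (congrArg _ (hleg l)).trans (Eq.trans ?_ (hleg _).symm)
    rw [opp_legDart]
    exact congrArg _ (h.pair_swap l)
  · refine (congrArg _ (arc c 0 (by decide))).trans (Eq.trans ?_ (arc _ 2 (by decide)).symm)
    exact congrArg (fun o => (Sum.inl o, (2 : Fin 3))) (hnext c)
  · refine (congrArg _ (arc c 2 (by decide))).trans (Eq.trans ?_ (arc _ 0 (by decide)).symm)
    exact congrArg (fun o => (Sum.inl o, (0 : Fin 3))) (hnext' c)

theorem contractedRotation_swapDart
    {P P' : Option S.Circ ⊕ {i : S.Inner // i ≠ v} → Prop}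
    (hP : ∀ u, u ≠ Sum.inl none → u ≠ Sum.inl (some p) → (P' u ↔ P u))
    (h1 : P (Sum.inl none) ↔ ¬ P (Sum.inl (some p)))
    (h2 : P' (Sum.inl none) ↔ P (Sum.inl (some p)))
    (h3 : P' (Sum.inl (some p)) ↔ P (Sum.inl none))
    (x : (Option S.Circ ⊕ {i : S.Inner // i ≠ v}) × Fin 3)
    (hx1 : x ≠ (Sum.inl none, 0)) (hx2 : x ≠ (Sum.inl (some p), 2)) :
    contractedRotation (turnBy P') (Sum.inl none, 0) (Sum.inl (some p), 2) (S.swapDart p v x) =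
      S.swapDart p v
        (contractedRotation (turnBy P) (Sum.inl none, 0) (Sum.inl (some p), 2) x) := by
  have n1 : (1 : Fin 3) + 1 = 2 := rfl
  have n2 : (2 : Fin 3) + 1 = 0 := rfl
  have n3 : (2 : Fin 3) - 1 = 1 := rfl
  have n4 : (0 : Fin 3) - 1 = 2 := rfl
  have n5 : (0 : Fin 3) + 1 = 1 := rfl
  have n6 : (1 : Fin 3) - 1 = 0 := rfl
  by_cases hu1 : x.1 = Sum.inl none ∨ x.1 = Sum.inl (some p)
  · rcases x with ⟨u, j⟩
    rcases hu1 with rfl | rfl <;> by_cases hf : P (Sum.inl (some p)) <;>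
      simp only [hf, not_true, not_false_iff, iff_true, iff_false] at h1 h2 <;>
      simp only [h1, iff_true, iff_false] at h3 <;> fin_cases j <;>
      simp_all [contractedRotation, turnBy, swapDart]
  · obtain ⟨k1, k2⟩ := not_or.1 hu1
    have := hP _ k1 k2
    rcases x with ⟨u, j⟩
    have k1' : u ≠ Sum.inl none := k1
    have k2' : u ≠ Sum.inl (some p) := k2
    by_cases hq : P u <;> rw [← this] at hq <;>
      simp [contractedRotation, turnBy, swapDart, k1', k2', ← this, hq]

/-- The embeddings of the two resolutions that are different at the two new circle vertices
correspond to each other: contract the new arcs of the circle. -/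
theorem IsStem.card_faces_swap (h : S.IsStem p v k a b) {F : Finset h.resolve.Vertex}
    {F' : Finset h.symm.resolve.Vertex}
    (hF : ∀ u : Option S.Circ ⊕ {i : S.Inner // i ≠ v}, u ≠ Sum.inl none → u ≠ Sum.inl (some p) →
      ((u : h.symm.resolve.Vertex) ∈ F' ↔ (u : h.resolve.Vertex) ∈ F))
    (h1 : h.circVertex none ∈ F ↔ ¬ h.circVertex (some p) ∈ F)
    (h2 : h.symm.circVertex none ∈ F' ↔ h.circVertex (some p) ∈ F)
    (h3 : h.symm.circVertex (some p) ∈ F' ↔ h.circVertex none ∈ F) :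
    Nat.card (Quot (h.resolve.FaceStep F)) = Nat.card (Quot (h.symm.resolve.FaceStep F')) := by
  rw [faceStep_eq, faceStep_eq]
  refine card_faces_eq_of_contraction (h.isContractible_resolve F) (h.symm.isContractible_resolve F')
    (S.swapDart p v) (S.swapDart p v)
    (fun x k1 k2 => ⟨(swapDart_ne x k1 k2).1, (swapDart_ne x k1 k2).2, swapDart_swapDart x⟩)
    (fun x k1 k2 => ⟨(swapDart_ne x k1 k2).1, (swapDart_ne x k1 k2).2, swapDart_swapDart x⟩)
    (fun d _ _ => h.opp_swapDart d) ?_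
  rw [turn_eq_turnBy, turn_eq_turnBy]
  exact contractedRotation_swapDart (P := fun u => (u : h.resolve.Vertex) ∈ F)
    (P' := fun u => (u : h.symm.resolve.Vertex) ∈ F') hF h1 h2 h3

theorem IsStem.card_vertex_resolve (h : S.IsStem p v k a b) :
    Nat.card h.resolve.Vertex = Nat.card S.Vertex :=
  Nat.card_congr (resolveVertex S v)

/-- The embeddings of the resolution, indexed by sets of vertices of `S`. -/
noncomputable def IsStem.pullFlags (h : S.IsStem p v k a b) (F : Finset S.Vertex) :
    Finset h.resolve.Vertex :=
  Equiv.finsetCongr (resolveVertex S v).symm F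

theorem IsStem.mem_pullFlags (h : S.IsStem p v k a b) (F : Finset S.Vertex)
    (u : h.resolve.Vertex) : u ∈ h.pullFlags F ↔ resolveVertex S v u ∈ F := by
  exact (Finset.mem_map_equiv (f := (resolveVertex S v).symm) (s := F) (b := u))

theorem IsStem.forall_circ_pullFlags (h : S.IsStem p v k a b) (F : Finset S.Vertex) :
    (∀ o : h.resolve.Circ, Sum.inl o ∉ h.pullFlags F) ↔
      Sum.inr v ∉ F ∧ ∀ c, Sum.inl c ∉ F := by
  constructor
  · intro H
    exact ⟨fun hv => H (none : Option S.Circ) ((h.mem_pullFlags F _).2 hv),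
      fun c hc => H (some c : Option S.Circ) ((h.mem_pullFlags F _).2 hc)⟩
  · rintro ⟨h1, h2⟩ (_ | c) ho
    · exact h1 ((h.mem_pullFlags F _).1 ho)
    · exact h2 c ((h.mem_pullFlags F _).1 ho)

theorem IsStem.signedCount_resolve (b' : Prop) (h : S.IsStem p v k a b) :
    signedCount b' h.resolve = ∑ F : Finset S.Vertex,
      open Classical in if IsCounted b' h.resolve (h.pullFlags F) then (-1) ^ F.card else 0 := by
  classical
  refine (Fintype.sum_equiv (κ := Finset h.resolve.Vertex)
    (Equiv.finsetCongr (resolveVertex S v).symm) _ _ fun F => ?_).symm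
  have : (Equiv.finsetCongr (resolveVertex S v).symm F).card = F.card := by
    rw [Equiv.finsetCongr_apply, Finset.card_map]
  exact if_congr Iff.rfl (congrArg _ this.symm) rfl

open Classical in
/-- The embedding in which the rotation at `w` is reversed. -/
noncomputable def toggle {V : Type} (w : V) (F : Finset V) : Finset V := symmDiff F {w}

theorem mem_toggle {V : Type} {w u : V} {F : Finset V} :
    u ∈ toggle w F ↔ (u ∈ F ↔ u ≠ w) := by
  classical
  rw [toggle, Finset.mem_symmDiff, Finset.mem_singleton]
  tauto

theorem toggle_toggle {V : Type} (w : V) (F : Finset V) : toggle w (toggle w F) = F := by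
  classical
  exact symmDiff_symmDiff_cancel_right {w} F

theorem neg_one_pow_card_toggle {V : Type} (w : V) (F : Finset V) :
    (-1 : ℤ) ^ (toggle w F).card = - (-1) ^ F.card := by
  classical
  have key : ∀ F : Finset V, w ∉ F → (-1 : ℤ) ^ (toggle w F).card = - (-1) ^ F.card := by
    intro F hw
    have : toggle w F = insert w F := by
      ext u
      rw [mem_toggle, Finset.mem_insert]
      by_cases hu : u = w
      · simp [hu, hw]
      · simp [hu]
    rw [this, Finset.card_insert_of_notMem hw, pow_succ, mul_neg_one]
  by_cases hw : w ∈ F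
  · have h1 : w ∉ toggle w F := by simp [mem_toggle, hw]
    have := key _ h1
    rw [toggle_toggle] at this
    rw [this, neg_neg]
  · exact key F hw

/-- The signed count of embeddings satisfies the (STU)-relation. The embeddings of `S` that agree at
`p` and `v` correspond to the embeddings of `T` that agree at the two new vertices, those
that do not agree correspond to the embeddings of `U` that agree at the two new vertices. The
remaining embeddings of `T` and `U` correspond to each other. -/
theorem signedCount_stu (b' : Prop) (hpv : S.pair (Sum.inl p) = Sum.inr (v, k)) :
    signedCount b' S = signedCount b' (isStem_standard hpv).resolve -
      signedCount b' (isStem_standard hpv).symm.resolve := by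
  classical
  set h := isStem_standard hpv
  -- embeddings of `S` that agree at `p` and `v`, and embeddings of `T`
  have hA : ∀ F : Finset S.Vertex, (Sum.inr v ∈ F ↔ Sum.inl p ∈ F) →
      (IsCounted b' S F ↔ IsCounted b' h.resolve (h.pullFlags F)) := by
    intro F hF
    refine and_congr (isSphereEmbedding_congr h.card_vertex_resolve.symm
      (h.card_faces_resolve (fun u _ => (h.mem_pullFlags F u).symm) ?_
        (Or.inl ⟨rfl, rfl, hF⟩)).symm) (or_congr Iff.rfl ?_)
    · rw [h.mem_pullFlags, h.mem_pullFlags]; exact hF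
    · rw [h.forall_circ_pullFlags]
      exact ⟨fun H => ⟨fun hv => H p (hF.1 hv), H⟩, fun H => H.2⟩
  -- embeddings of `S` that disagree at `p` and `v`, and embeddings of `U`; the rotation at `v` has
  -- to be reversed, which is responsible for the sign in the relation
  have hB : ∀ F : Finset S.Vertex, ¬ (Sum.inr v ∈ F ↔ Sum.inl p ∈ F) →
      (IsCounted b' S F ↔
        IsCounted b' h.symm.resolve (h.symm.pullFlags (toggle (Sum.inr v) F))) := by
    intro F hF
    refine and_congr (isSphereEmbedding_congr h.symm.card_vertex_resolve.symm
      (h.symm.card_faces_resolve (fun u hu => ?_) ?_ (Or.inr ⟨rfl, rfl, by tauto⟩)).symm)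
      (or_congr Iff.rfl ?_)
    · have : resolveVertex S v u ≠ Sum.inr v := fun h' => hu ((resolveVertex S v).injective h')
      rw [h.symm.mem_pullFlags, mem_toggle]
      tauto
    · rw [h.symm.mem_pullFlags, h.symm.mem_pullFlags, mem_toggle, mem_toggle]
      change ((Sum.inr v : S.Vertex) ∈ F ↔ (Sum.inr v : S.Vertex) ≠ Sum.inr v) ↔
        ((Sum.inl p : S.Vertex) ∈ F ↔ (Sum.inl p : S.Vertex) ≠ Sum.inr v)
      simp only [ne_eq, not_true, iff_false, reduceCtorEq, not_false_iff, iff_true]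
      tauto
    · rw [h.symm.forall_circ_pullFlags]
      simp only [mem_toggle, ne_eq, not_true, iff_false, reduceCtorEq, not_false_iff, iff_true,
        not_not]
      refine ⟨fun H => ⟨?_, H⟩, fun H => H.2⟩
      have := H p
      tauto
  -- embeddings of `T` and `U` that disagree at the two new vertices; for the count on one side of
  -- the circle there are none
  have hC : ∀ F : Finset S.Vertex, ¬ (Sum.inr v ∈ F ↔ Sum.inl p ∈ F) →
      (IsCounted b' h.resolve (h.pullFlags F) ↔
        IsCounted b' h.symm.resolve
          (h.symm.pullFlags (toggle (Sum.inr v) (toggle (Sum.inl p) F)))) := by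
    intro F hF
    refine and_congr (isSphereEmbedding_congr
      (h.card_vertex_resolve.trans h.symm.card_vertex_resolve.symm)
      (h.card_faces_swap (fun u hu hu' => ?_) ?_ ?_ ?_)) (or_congr Iff.rfl ?_)
    · have h1 : resolveVertex S v u ≠ Sum.inr v := fun h' => hu ((resolveVertex S v).injective h')
      have h2 : resolveVertex S v u ≠ Sum.inl p := fun h' => hu' ((resolveVertex S v).injective h')
      refine (h.symm.mem_pullFlags _ u).trans (Iff.trans ?_ (h.mem_pullFlags F u).symm)
      rw [mem_toggle, mem_toggle]
      tauto
    · rw [h.mem_pullFlags, h.mem_pullFlags]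
      change (Sum.inr v : S.Vertex) ∈ F ↔ ¬ (Sum.inl p : S.Vertex) ∈ F
      tauto
    · rw [h.symm.mem_pullFlags, h.mem_pullFlags, mem_toggle, mem_toggle]
      change (((Sum.inr v : S.Vertex) ∈ F ↔ (Sum.inr v : S.Vertex) ≠ Sum.inl p) ↔
        (Sum.inr v : S.Vertex) ≠ Sum.inr v) ↔ (Sum.inl p : S.Vertex) ∈ F
      simp only [ne_eq, not_true, iff_false, reduceCtorEq, not_false_iff, iff_true]
      tauto
    · rw [h.symm.mem_pullFlags, h.mem_pullFlags, mem_toggle, mem_toggle]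
      change (((Sum.inl p : S.Vertex) ∈ F ↔ (Sum.inl p : S.Vertex) ≠ Sum.inl p) ↔
        (Sum.inl p : S.Vertex) ≠ Sum.inr v) ↔ (Sum.inr v : S.Vertex) ∈ F
      simp only [ne_eq, not_true, iff_false, reduceCtorEq, not_false_iff, iff_true]
      tauto
    · rw [h.symm.forall_circ_pullFlags, h.forall_circ_pullFlags]
      refine iff_of_false (fun H => hF (iff_of_false H.1 (H.2 p))) (fun H => ?_)
      have h1 := H.1
      have h2 := H.2 p
      simp only [mem_toggle, ne_eq, not_true, iff_false, reduceCtorEq, not_false_iff, iff_true,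
        not_not] at h1 h2
      exact hF (iff_of_true h1 h2)
  have hagree : ∀ F : Finset S.Vertex, (Sum.inr v ∈ toggle (Sum.inr v) F ↔
      Sum.inl p ∈ toggle (Sum.inr v) F) ↔ ¬ (Sum.inr v ∈ F ↔ Sum.inl p ∈ F) := by
    intro F
    simp only [mem_toggle, ne_eq, not_true, iff_false, reduceCtorEq, not_false_iff, iff_true]
    tauto
  have hagree' : ∀ F : Finset S.Vertex, (Sum.inr v ∈ toggle (Sum.inl p) F ↔
      Sum.inl p ∈ toggle (Sum.inl p) F) ↔ ¬ (Sum.inr v ∈ F ↔ Sum.inl p ∈ F) := by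
    intro F
    simp only [mem_toggle, ne_eq, not_true, iff_false, reduceCtorEq, not_false_iff, iff_true]
    tauto
  have invol : ∀ w : S.Vertex, Function.Bijective (toggle w) := fun w =>
    Function.Involutive.bijective (toggle_toggle w)
  rw [h.signedCount_resolve, h.symm.signedCount_resolve]
  let T : Finset S.Vertex → ℤ := fun F =>
    if IsCounted b' h.resolve (h.pullFlags F) then (-1) ^ F.card else 0
  let U : Finset S.Vertex → ℤ := fun F =>
    if IsCounted b' h.symm.resolve (h.symm.pullFlags F) then (-1) ^ F.card else 0
  let A : Finset S.Vertex → Prop := fun F => Sum.inr v ∈ F ↔ Sum.inl p ∈ F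
  have hS : signedCount b' S = ∑ F, ((if A F then T F else 0) +
      if A F then 0 else - U (toggle (Sum.inr v) F)) := by
    refine Finset.sum_congr rfl fun F _ => ?_
    by_cases hF : A F
    · simp only [if_pos hF, add_zero, T]
      exact if_congr (hA F hF) rfl rfl
    · simp only [if_neg hF, zero_add, U]
      rw [if_congr (hB F hF) rfl rfl, neg_one_pow_card_toggle]
      split_ifs <;> simp
  have hU : ∑ F, (if A F then 0 else - U (toggle (Sum.inr v) F)) =
      - ∑ F, (if A F then U F else 0) := by
    rw [← Finset.sum_neg_distrib]
    refine Fintype.sum_bijective _ (invol (Sum.inr v)) _ _ fun F => ?_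
    by_cases hF : A F
    · rw [if_pos hF, if_neg fun h' => (hagree F).1 h' hF, neg_zero]
    · rw [if_neg hF, if_pos ((hagree F).2 hF)]
  have hTU : ∑ F, (if A F then 0 else T F) = ∑ F, (if A F then 0 else U F) := by
    refine Fintype.sum_bijective _ ((invol (Sum.inr v)).comp (invol (Sum.inl p))) _ _ fun F => ?_
    have e : A (toggle (Sum.inr v) (toggle (Sum.inl p) F)) ↔ A F :=
      (hagree _).trans ((not_congr (hagree' F)).trans not_not)
    by_cases hF : A F
    · rw [if_pos hF, Function.comp_apply, if_pos (e.2 hF)]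
    · rw [if_neg hF, Function.comp_apply, if_neg fun h' => hF (e.1 h')]
      simp only [T, U]
      rw [if_congr (hC F hF) rfl rfl, neg_one_pow_card_toggle, neg_one_pow_card_toggle, neg_neg]
  have split : ∀ G : Finset S.Vertex → ℤ,
      ∑ F, G F = ∑ F, (if A F then G F else 0) + ∑ F, (if A F then 0 else G F) := by
    intro G
    rw [← Finset.sum_add_distrib]
    refine Finset.sum_congr rfl fun F _ => ?_
    by_cases hF : A F <;> simp [hF]
  change signedCount b' S = ∑ F, T F - ∑ F, U F
  rw [hS, Finset.sum_add_distrib, hU, split T, split U, hTU]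
  ring

end Resolve

end TrivalentDiagram

theorem exists_signedCount (R : Type*) [Field R] (b : Prop) :
    ∃ E : DiagramSpace R →ₗ[R] R, ∀ D, E (diagramClass R D) = (D.signedCount b : R) :=
  exists_linearMap_diagramClass R (fun D => (D.signedCount b : R))
    (fun D D' h => by rw [h.signedCount_eq])
    (fun S p v k h => by rw [S.signedCount_stu b h, Int.cast_sub])

/-! ### Planar embeddings of chord diagrams -/

namespace TrivalentDiagram

/-- In a chord diagram, the other end of the chord at a circle vertex. -/
def mate (D : TrivalentDiagram) (c : D.Circ) : D.Circ := Sum.elim id (fun _ => c) (D.pair (Sum.inl c))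

variable {D : TrivalentDiagram}

theorem IsChordDiagram.pair_inl (hD : D.IsChordDiagram) (c : D.Circ) :
    D.pair (Sum.inl c) = Sum.inl (D.mate c) := by
  have : IsEmpty D.Inner := hD
  unfold mate
  rcases D.pair (Sum.inl c) with x | x
  · rfl
  · exact isEmptyElim x.1

theorem IsChordDiagram.mate_mate (hD : D.IsChordDiagram) (c : D.Circ) : D.mate (D.mate c) = c := by
  have h := D.pair_pair (Sum.inl c)
  rw [hD.pair_inl, hD.pair_inl] at h
  exact Sum.inl_injective h

theorem IsChordDiagram.mate_ne (hD : D.IsChordDiagram) (c : D.Circ) : D.mate c ≠ c := by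
  intro h
  have := D.pair_ne (Sum.inl c)
  rw [hD.pair_inl, h] at this
  exact this rfl

theorem IsChordDiagram.legAdj_iff (hD : D.IsChordDiagram) (u w : D.Vertex) :
    LegAdj D.pair u w ↔ w = Sum.map D.mate id u := by
  have : IsEmpty D.Inner := hD
  constructor
  · rintro ⟨h, rfl, rfl⟩
    rcases h with c | x
    · rw [hD.pair_inl]; rfl
    · exact isEmptyElim x.1
  · rintro rfl
    rcases u with c | x
    · exact ⟨Sum.inl c, rfl, by rw [hD.pair_inl]; rfl⟩
    · exact isEmptyElim x

theorem IsChordDiagram.comp_eq_iff (hD : D.IsChordDiagram) (x y : D.Circ) :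
    D.comp (Sum.inl x) = D.comp (Sum.inl y) ↔ y = x ∨ y = D.mate x := by
  have h : ∀ u : D.Vertex, Sum.map D.mate id (Sum.map D.mate id u) = u := by
    rintro (c | c)
    · exact congrArg Sum.inl (hD.mate_mate c)
    · rfl
  refine (quot_mk_eq_iff_of_involutive h hD.legAdj_iff _ _).trans ?_
  simp

theorem IsChordDiagram.comp_mate (hD : D.IsChordDiagram) (x : D.Circ) :
    D.comp (Sum.inl (D.mate x)) = D.comp (Sum.inl x) :=
  ((hD.comp_eq_iff _ _).2 (Or.inr rfl)).symm

theorem IsChordDiagram.two_mul_card_component (hD : D.IsChordDiagram) :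
    2 * Nat.card D.Component = Nat.card D.Vertex := by
  have : IsEmpty D.Inner := hD
  refine two_mul_card_quot_of_involutive (α := Sum.map D.mate id) ?_ ?_ hD.legAdj_iff
  · rintro (c | c)
    · exact congrArg Sum.inl (hD.mate_mate c)
    · rfl
  · rintro (c | c)
    · exact fun h => hD.mate_ne c (Sum.inl_injective h)
    · exact isEmptyElim c

theorem IsChordDiagram.exists_comp (hD : D.IsChordDiagram) (q : D.Component) :
    ∃ c, D.comp (Sum.inl c) = q := by
  have : IsEmpty D.Inner := hD
  rcases q with ⟨c | i⟩
  · exact ⟨c, rfl⟩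
  · exact isEmptyElim i

/-- The chords at `x` and `y` cross. -/
def Crossing (D : TrivalentDiagram) (x y : D.Circ) : Prop :=
  sbtw x y (D.mate x) ∧ sbtw (D.mate x) (D.mate y) x

/-- A function on the half-edges is constant along the boundaries of the faces. -/
def IsFaceFunction (D : TrivalentDiagram) (F : Finset D.Vertex) (f : D.Dart → ZMod 2) : Prop :=
  ∀ d, f d = f (D.turn F (D.opp d))

theorem IsChordDiagram.opp_leg (hD : D.IsChordDiagram) (c : D.Circ) :
    D.opp (Sum.inl c, 1) = (Sum.inl (D.mate c), 1) := by
  have h := D.opp_legDart (Sum.inl c)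
  rw [hD.pair_inl] at h
  exact h

/-- The face condition in terms of the values `O`, `L`, `I` at the outgoing arcs, the half-edges
off the circle, and the incoming arcs. -/
theorem IsChordDiagram.isFaceFunction_iff (hD : D.IsChordDiagram) (F : Finset D.Vertex)
    (f : D.Dart → ZMod 2) : D.IsFaceFunction F f ↔ ∀ c : D.Circ,
      (Sum.inl c ∉ F → f (Sum.inl (D.next c), 2) = f (Sum.inl c, 1) ∧
        f (Sum.inl (D.mate c), 1) = f (Sum.inl c, 2) ∧
        f (Sum.inl (D.next.symm c), 0) = f (Sum.inl c, 0)) ∧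
      (Sum.inl c ∈ F → f (Sum.inl (D.next c), 2) = f (Sum.inl c, 2) ∧
        f (Sum.inl (D.mate c), 1) = f (Sum.inl c, 0) ∧
        f (Sum.inl (D.next.symm c), 0) = f (Sum.inl c, 1)) := by
  have : IsEmpty D.Inner := hD
  have h0 : D.IsFaceFunction F f ↔ ∀ d, f (D.opp d) = f (D.turn F d) :=
    ⟨fun h d => by rw [h (D.opp d), D.opp_opp], fun h d => by rw [← h, D.opp_opp]⟩
  have h1 : (∀ d, f (D.opp d) = f (D.turn F d)) ↔ ∀ c : D.Circ,
      f (Sum.inl (D.next c), 2) = f (D.turn F (Sum.inl c, 0)) ∧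
      f (Sum.inl (D.mate c), 1) = f (D.turn F (Sum.inl c, 1)) ∧
      f (Sum.inl (D.next.symm c), 0) = f (D.turn F (Sum.inl c, 2)) := by
    constructor
    · intro h c
      exact ⟨h (Sum.inl c, 0), hD.opp_leg c ▸ h (Sum.inl c, 1), h (Sum.inl c, 2)⟩
    · rintro h ⟨c | i, k⟩
      · fin_cases k
        · exact (h c).1
        · exact (congrArg f (hD.opp_leg c)).trans (h c).2.1
        · exact (h c).2.2
      · exact isEmptyElim i
  rw [h0, h1]
  refine forall_congr' fun c => ?_
  by_cases hc : (Sum.inl c : D.Vertex) ∈ F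
  · simp only [turn_of_mem hc, hc, not_true, false_imp_iff, true_imp_iff, true_and]; rfl
  · simp only [turn_of_notMem hc, hc, not_false_iff, false_imp_iff, true_imp_iff, and_true]; rfl

/-- The jump of a face function across the chord at a circle vertex is the difference of its jumps
across the two arcs at this vertex. -/
theorem IsChordDiagram.jump_next (hD : D.IsChordDiagram) {F : Finset D.Vertex}
    {f : D.Dart → ZMod 2} (hf : D.IsFaceFunction F f) (c : D.Circ) :
    f (Sum.inl (D.next c), 0) + f (Sum.inl (D.next (D.next c)), 2) =
      f (Sum.inl c, 0) + f (Sum.inl (D.next c), 2) +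
      (f (Sum.inl (D.next c), 1) + f (Sum.inl (D.mate (D.next c)), 1)) := by
  have h := (hD.isFaceFunction_iff F f).1 hf (D.next c)
  rw [Equiv.symm_apply_apply] at h
  by_cases hc : (Sum.inl (D.next c) : D.Vertex) ∈ F
  · obtain ⟨h1, h2, h3⟩ := h.2 hc
    grind
  · obtain ⟨h1, h2, h3⟩ := h.1 hc
    grind

theorem next_induction (D : TrivalentDiagram) {P : D.Circ → Prop} (x : D.Circ) (hx : P x)
    (hP : ∀ a, P a → P (D.next a)) (y : D.Circ) : P y :=
  circular_induction hx y fun a b hab _ _ ha => by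
    rw [hab.eq (D.isCircularNext_next a)]; exact hP a ha

/-- The jumps of a face function across the chords and across the arc starting at `a`. -/
noncomputable def jumps (D : TrivalentDiagram) (hD : D.IsChordDiagram) (F : Finset D.Vertex)
    (a : D.Circ) :
    (Quot (D.FaceStep F) → ZMod 2) →ₗ[ZMod 2] (D.Component → ZMod 2) × ZMod 2 where
  toFun f := (fun q => f (Quot.mk _ (Sum.inl (hD.exists_comp q).choose, 1)) +
      f (Quot.mk _ (Sum.inl (D.mate (hD.exists_comp q).choose), 1)),
    f (Quot.mk _ (Sum.inl a, 0)) + f (Quot.mk _ (Sum.inl (D.next a), 2)))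
  map_add' f f' := Prod.ext (funext fun q => by simp only [Pi.add_apply, Prod.fst_add]; ring)
    (by simp only [Pi.add_apply, Prod.snd_add]; ring)
  map_smul' r f := Prod.ext (funext fun q => by
      simp only [Pi.smul_apply, Prod.smul_fst, smul_eq_mul, RingHom.id_apply]; ring)
    (by simp only [Pi.smul_apply, Prod.smul_snd, smul_eq_mul, RingHom.id_apply]; ring)

theorem isFaceFunction_mk {F : Finset D.Vertex} (f : Quot (D.FaceStep F) → ZMod 2) :
    D.IsFaceFunction F fun d => f (Quot.mk _ d) := fun _ =>
  congrArg f (Quot.sound ((D.faceStep_iff F _ _).2 rfl))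

theorem IsChordDiagram.jumps_comp (hD : D.IsChordDiagram) {F : Finset D.Vertex} (a : D.Circ)
    (f : Quot (D.FaceStep F) → ZMod 2) (c : D.Circ) :
    (D.jumps hD F a f).1 (D.comp (Sum.inl c)) =
      f (Quot.mk _ (Sum.inl c, 1)) + f (Quot.mk _ (Sum.inl (D.mate c), 1)) := by
  change f (Quot.mk _ (Sum.inl (hD.exists_comp (D.comp (Sum.inl c))).choose, 1)) +
    f (Quot.mk _ (Sum.inl (D.mate (hD.exists_comp (D.comp (Sum.inl c))).choose), 1)) = _
  generalize hb : (hD.exists_comp (D.comp (Sum.inl c))).choose = b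
  have h := (hD.exists_comp (D.comp (Sum.inl c))).choose_spec
  rw [hb] at h
  rcases (hD.comp_eq_iff _ _).1 h with rfl | rfl
  · rfl
  · rw [hD.mate_mate, add_comm]

/-- A face function without jumps is constant. -/
theorem IsChordDiagram.ker_jumps (hD : D.IsChordDiagram) (F : Finset D.Vertex) (a : D.Circ) :
    LinearMap.ker (D.jumps hD F a) = Submodule.span (ZMod 2) {fun _ => (1 : ZMod 2)} := by
  have : IsEmpty D.Inner := hD
  have two : ∀ x : ZMod 2, x + x = 0 := CharTwo.add_self_eq_zero
  refine le_antisymm (fun f hf => ?_) ?_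
  · have hf0 : D.jumps hD F a f = 0 := hf
    have ff := isFaceFunction_mk f
    have hL : ∀ c, f (Quot.mk _ (Sum.inl c, 1)) = f (Quot.mk _ (Sum.inl (D.mate c), 1)) := by
      intro c
      have h := hD.jumps_comp a f c
      rw [hf0] at h
      exact CharTwo.add_eq_zero.1 h.symm
    have ht : ∀ c, f (Quot.mk _ (Sum.inl c, 0)) + f (Quot.mk _ (Sum.inl (D.next c), 2)) = 0 := by
      refine D.next_induction a (congrArg Prod.snd hf0) fun c hc => ?_
      have := hD.jump_next ff c
      rw [hc, ← hL, two] at this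
      simpa using this
    have hc := (hD.isFaceFunction_iff F _).1 ff
    have hO : ∀ c, f (Quot.mk _ (Sum.inl c, 0)) = f (Quot.mk _ (Sum.inl a, 0)) ∧
        f (Quot.mk _ (Sum.inl c, 1)) = f (Quot.mk _ (Sum.inl c, 0)) ∧
        f (Quot.mk _ (Sum.inl c, 2)) = f (Quot.mk _ (Sum.inl c, 0)) := by
      have h1 : ∀ c, f (Quot.mk _ (Sum.inl c, 1)) = f (Quot.mk _ (Sum.inl c, 0)) ∧
          f (Quot.mk _ (Sum.inl c, 2)) = f (Quot.mk _ (Sum.inl c, 0)) ∧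
          f (Quot.mk _ (Sum.inl (D.next.symm c), 0)) = f (Quot.mk _ (Sum.inl c, 0)) := by
        intro c
        have h2 := hL c
        have h3 := ht c
        have h4 := ht (D.next.symm c)
        rw [Equiv.apply_symm_apply] at h4
        by_cases hF : (Sum.inl c : D.Vertex) ∈ F
        · obtain ⟨e1, e2, e3⟩ := (hc c).2 hF
          grind
        · obtain ⟨e1, e2, e3⟩ := (hc c).1 hF
          grind
      intro c
      refine ⟨?_, (h1 c).1, (h1 c).2.1⟩
      refine D.next_induction (P := fun c => f (Quot.mk _ (Sum.inl c, 0)) = _) a rfl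
        (fun c hc => ?_) c
      have := (h1 (D.next c)).2.2
      rw [Equiv.symm_apply_apply] at this
      rw [← this, hc]
    refine Submodule.mem_span_singleton.2 ⟨f (Quot.mk _ (Sum.inl a, 0)), funext ?_⟩
    rintro ⟨⟨c | i, k⟩⟩
    · rw [Pi.smul_apply, smul_eq_mul, mul_one]
      fin_cases k
      · exact (hO c).1.symm
      · exact ((hO c).2.1.trans (hO c).1).symm
      · exact ((hO c).2.2.trans (hO c).1).symm
    · exact isEmptyElim i
  · rw [Submodule.span_singleton_le_iff_mem, LinearMap.mem_ker]
    exact Prod.ext (funext fun q => two 1) (two 1)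

theorem IsChordDiagram.isSphereEmbedding_iff_surjective (hD : D.IsChordDiagram)
    (F : Finset D.Vertex) (a : D.Circ) :
    D.IsSphereEmbedding F ↔ Function.Surjective (D.jumps hD F a) := by
  have : Finite (Quot (D.FaceStep F)) := inferInstance
  have := Fintype.ofFinite (Quot (D.FaceStep F))
  have := Fintype.ofFinite D.Component
  have h1 := LinearMap.finrank_range_add_finrank_ker (D.jumps hD F a)
  have hne : (fun _ => 1 : Quot (D.FaceStep F) → ZMod 2) ≠ 0 := fun h =>
    one_ne_zero (congrFun h (Quot.mk _ (Sum.inl a, 0)))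
  rw [hD.ker_jumps, finrank_span_singleton hne, Module.finrank_fintype_fun_eq_card] at h1
  have h2 : Module.finrank (ZMod 2) ((D.Component → ZMod 2) × ZMod 2) =
      Fintype.card D.Component + 1 := by
    rw [Module.finrank_prod, Module.finrank_fintype_fun_eq_card, Module.finrank_self]
  have h6 : LinearMap.range (D.jumps hD F a) = ⊤ ↔
      Module.finrank (ZMod 2) (LinearMap.range (D.jumps hD F a)) = Fintype.card D.Component + 1 :=
    ⟨fun h => by rw [h, finrank_top, h2], fun h => Submodule.eq_top_of_finrank_eq (h.trans h2.symm)⟩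
  rw [← LinearMap.range_eq_top, h6]
  have h3 := hD.two_mul_card_component
  have h4 := D.two_mul_card_edges
  have h5 : ¬ IsEmpty D.Vertex := fun h => h.elim (Sum.inl a)
  unfold IsSphereEmbedding
  simp only [Nat.card_eq_fintype_card (α := D.Component),
    Nat.card_eq_fintype_card (α := Quot (D.FaceStep F))] at *
  simp only [h5, false_or]
  omega

/-- If the surface of an embedding of a chord diagram is a sphere, the two ends of a chord lie on
the same side of the circle: there is a face function that jumps across the circle only. -/
theorem IsChordDiagram.mem_mate_iff (hD : D.IsChordDiagram) {F : Finset D.Vertex}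
    (h : D.IsSphereEmbedding F) (c : D.Circ) :
    Sum.inl (D.mate c) ∈ F ↔ (Sum.inl c : D.Vertex) ∈ F := by
  obtain ⟨f, hf⟩ := (hD.isSphereEmbedding_iff_surjective F c).1 h (0, 1)
  have ff := isFaceFunction_mk f
  have hc := (hD.isFaceFunction_iff F _).1 ff
  have hL : ∀ x, f (Quot.mk _ (Sum.inl x, 1)) = f (Quot.mk _ (Sum.inl (D.mate x), 1)) := by
    intro x
    have h := hD.jumps_comp c f x
    rw [hf] at h
    exact CharTwo.add_eq_zero.1 h.symm
  have ht : ∀ x, f (Quot.mk _ (Sum.inl x, 0)) + f (Quot.mk _ (Sum.inl (D.next x), 2)) = 1 := by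
    refine D.next_induction c (congrArg Prod.snd hf) fun x hx => ?_
    have := hD.jump_next ff x
    rw [hx, ← hL, CharTwo.add_self_eq_zero, add_zero] at this
    exact this
  have h1 : ∀ x, f (Quot.mk _ (Sum.inl (D.next.symm x), 0)) = f (Quot.mk _ (Sum.inl x, 0)) := by
    intro x
    by_cases hF : (Sum.inl x : D.Vertex) ∈ F
    · obtain ⟨e1, e2, e3⟩ := (hc x).2 hF
      rw [e3, hL, e2]
    · exact ((hc x).1 hF).2.2
  have hO : ∀ x, f (Quot.mk _ (Sum.inl x, 0)) = f (Quot.mk _ (Sum.inl c, 0)) := by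
    refine D.next_induction c rfl fun x hx => ?_
    have := h1 (D.next x)
    rw [Equiv.symm_apply_apply] at this
    rw [← this, hx]
  have hI : ∀ x, (Sum.inl x : D.Vertex) ∈ F ↔
      f (Quot.mk _ (Sum.inl x, 1)) = f (Quot.mk _ (Sum.inl c, 0)) := by
    intro x
    by_cases hF : (Sum.inl x : D.Vertex) ∈ F
    · obtain ⟨e1, e2, e3⟩ := (hc x).2 hF
      exact ⟨fun _ => by rw [hL, e2, hO], fun _ => hF⟩
    · obtain ⟨e1, e2, e3⟩ := (hc x).1 hF
      refine ⟨fun h => (hF h).elim, fun h => ?_⟩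
      have := ht x
      rw [hO, e1, h, CharTwo.add_self_eq_zero] at this
      exact (zero_ne_one this).elim
  rw [hI, hI, hL c]

/-- If the surface of an embedding of a chord diagram is a sphere, crossing chords lie on
different sides of the circle: there is a face function that jumps across one of the chords only. -/
theorem IsChordDiagram.mem_iff_notMem (hD : D.IsChordDiagram) {F : Finset D.Vertex}
    (h : D.IsSphereEmbedding F) {x y : D.Circ} (hxy : D.Crossing x y) :
    (Sum.inl x : D.Vertex) ∈ F ↔ (Sum.inl y : D.Vertex) ∉ F := by
  classical
  obtain ⟨f, hf⟩ := (hD.isSphereEmbedding_iff_surjective F x).1 h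
    (fun q => if q = D.comp (Sum.inl x) then 1 else 0, 0)
  have ff := isFaceFunction_mk f
  have hc := (hD.isFaceFunction_iff F _).1 ff
  have hg : ∀ b, f (Quot.mk _ (Sum.inl b, 1)) + f (Quot.mk _ (Sum.inl (D.mate b), 1)) =
      if b = x ∨ b = D.mate x then 1 else 0 := by
    intro b
    rw [← hD.jumps_comp x f b, hf]
    simp only [eq_comm (b := D.comp (Sum.inl x)), hD.comp_eq_iff]
  have hL : ∀ b, b ≠ x → b ≠ D.mate x →
      f (Quot.mk _ (Sum.inl b, 1)) = f (Quot.mk _ (Sum.inl (D.mate b), 1)) := by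
    intro b h1 h2
    have := hg b
    rw [if_neg (by tauto)] at this
    exact CharTwo.add_eq_zero.1 this
  have ht : ∀ b, f (Quot.mk _ (Sum.inl b, 0)) + f (Quot.mk _ (Sum.inl (D.next b), 2)) =
      if b = D.mate x ∨ sbtw x (D.mate x) b then 1 else 0 := by
    intro b
    refine circular_induction (x := x) (P := fun b =>
      f (Quot.mk _ (Sum.inl b, 0)) + f (Quot.mk _ (Sum.inl (D.next b), 2)) =
      if b = D.mate x ∨ sbtw x (D.mate x) b then 1 else 0) ?_ b fun a b hab hbx _ ha => ?_
    · rw [if_neg]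
      · exact congrArg Prod.snd hf
      · rintro (h | h)
        · exact hD.mate_ne x h.symm
        · exact sbtw_irrefl_left_right h
    · obtain rfl := hab.eq (D.isCircularNext_next a)
      rw [hD.jump_next ff a, ha, hg]
      let := cutOrder x
      have hlt : ∀ u, sbtw x (D.mate x) u ↔ D.mate x < u := fun u =>
        ⟨Or.inr, fun h => h.resolve_left fun h => hD.mate_ne x h.1⟩
      have hax : a < D.next a := by
        by_cases hax : a = x
        · exact Or.inl ⟨hax, hbx⟩
        · exact Or.inr ((sbtw_or_sbtw_of_ne (Ne.symm hax)
            (fun h => hax ((hab.2 h x).symm)) hbx).resolve_right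
            fun h => hab.1 x h.cyclic_left)
      have hno : ∀ u, ¬ (a < u ∧ u < D.next a) := fun u hu =>
        hab.1 u ((sbtw_iff_cutOrder x _ _ _).2 (Or.inl hu))
      simp only [hlt, hbx, false_or]
      rcases lt_trichotomy (D.next a) (D.mate x) with h | h | h
      · have h' := hax.trans h
        simp [h.ne, h'.ne, h.not_gt, h'.not_gt]
      · have h' : a < D.mate x := h ▸ hax
        simp [h, h'.ne, h'.not_gt]
      · have h' : D.mate x ≤ a := not_lt.1 fun h' => hno _ ⟨h', h⟩
        rw [if_pos (h'.eq_or_lt.imp_left Eq.symm), if_neg h.ne', if_pos (Or.inr h), add_zero]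
  have hyx : y ≠ x := hxy.1.ne_left.symm
  have hyx' : y ≠ D.mate x := hxy.1.ne_right
  have hty := ht y
  have hty' := ht (D.mate y)
  rw [if_neg (fun h => h.elim hyx' fun h => h.cyclic_left.not_sbtw hxy.1.cyclic_left.cyclic_left.cyclic_left)] at hty
  rw [if_pos (Or.inr hxy.2.cyclic_right)] at hty'
  have hLy := hL y hyx hyx'
  have hm := hD.mem_mate_iff h
  have hne : ∀ b, (Sum.inl b ∈ F ↔ ¬ (Sum.inl x : D.Vertex) ∈ F) → b ≠ x ∧ b ≠ D.mate x := by
    refine fun b hb => ⟨?_, ?_⟩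
    · rintro rfl; tauto
    · rintro rfl; rw [hm] at hb; tauto
  by_contra hcon
  have hF' : (Sum.inl y : D.Vertex) ∈ F ↔ (Sum.inl x : D.Vertex) ∈ F := by tauto
  by_cases hF : (Sum.inl x : D.Vertex) ∈ F
  · -- the function takes the same value at all incoming arcs
    have hI : ∀ b, f (Quot.mk _ (Sum.inl b, 2)) = f (Quot.mk _ (Sum.inl x, 2)) := by
      refine D.next_induction x rfl fun b hb => ?_
      by_cases hbF : (Sum.inl b : D.Vertex) ∈ F
      · rw [((hc b).2 hbF).1, hb]
      · obtain ⟨h1, h2⟩ := hne b (by tauto)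
        rw [((hc b).1 hbF).1, hL b h1 h2, ((hc b).1 hbF).2.1, hb]
    have h1 := ((hc y).2 (hF'.2 hF)).2.1
    have h2 := ((hc (D.mate y)).2 ((hm y).2 (hF'.2 hF))).2.1
    rw [hD.mate_mate] at h2
    rw [hI] at hty hty'
    rw [← h2, ← hLy.symm, h1, hty] at hty'
    exact zero_ne_one hty'
  · -- the function takes the same value at all outgoing arcs
    have hO : ∀ b, f (Quot.mk _ (Sum.inl b, 0)) = f (Quot.mk _ (Sum.inl x, 0)) := by
      refine D.next_induction x rfl fun b hb => ?_
      rw [← hb]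
      by_cases hbF : (Sum.inl (D.next b) : D.Vertex) ∈ F
      · obtain ⟨h1, h2⟩ := hne (D.next b) (by tauto)
        have h3 := ((hc _).2 hbF).2.2
        rw [Equiv.symm_apply_apply] at h3
        rw [h3, hL _ h1 h2, ((hc _).2 hbF).2.1]
      · have h3 := ((hc _).1 hbF).2.2
        rw [Equiv.symm_apply_apply] at h3
        exact h3.symm
    have h1 := ((hc y).1 (by tauto)).1
    have h2 := ((hc (D.mate y)).1 (by rw [hm]; tauto)).1
    rw [hO, h1] at hty
    rw [hO, h2, ← hLy, hty] at hty'
    exact zero_ne_one hty'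

/-- A function on the arcs of the circle that changes by `g` at the points of `P`: it is the
restriction of a function on the regions of the disk, cut along the chords ending in `P`, which
do not cross. -/
theorem IsChordDiagram.exists_potential (hD : D.IsChordDiagram) (P : D.Circ → Prop)
    (hP : ∀ c, P (D.mate c) ↔ P c) (hcross : ∀ x y, P x → P y → ¬ D.Crossing x y)
    (g : D.Circ → ZMod 2) (hg : ∀ c, g (D.mate c) = g c) :
    ∃ ψ : D.Circ → ZMod 2, (∀ a, P (D.next a) → ψ (D.next a) = ψ a + g (D.next a)) ∧
      (∀ a, ¬ P (D.next a) → ψ (D.next a) = ψ a) ∧ ∀ a, P a → ψ (D.mate a) = ψ a + g a := by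
  classical
  rcases isEmpty_or_nonempty D.Circ with h0 | ⟨⟨o⟩⟩
  · exact ⟨0, fun a => isEmptyElim a, fun a => isEmptyElim a, fun a => isEmptyElim a⟩
  let := cutOrder o
  have hzero : ∀ S : Finset D.Circ, (∀ b ∈ S, D.mate b ∈ S) →
      ∑ b ∈ S, (if P b then g b else 0) = 0 := by
    intro S hS
    refine Finset.sum_involution (fun b _ => D.mate b) (fun b _ => ?_)
      (fun b _ _ => hD.mate_ne b) hS (fun b _ => hD.mate_mate b)
    simp only [hP, hg, CharTwo.add_self_eq_zero]
  have hlt : ∀ a, D.next a ≠ o → a < D.next a := fun a h => by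
    by_cases hax : a = o
    · exact Or.inl ⟨hax, h⟩
    · exact Or.inr ((sbtw_or_sbtw_of_ne (Ne.symm hax)
        (fun h => hax (((D.isCircularNext_next a).2 h o).symm)) h).resolve_right
        fun h => (D.isCircularNext_next a).1 o h.cyclic_left)
  have hno : ∀ a u, a < u → u < D.next a → False := fun a u h1 h2 =>
    (D.isCircularNext_next a).1 u ((sbtw_iff_cutOrder o _ _ _).2 (Or.inl ⟨h1, h2⟩))
  have hbot : ∀ u, o ≤ u := fun u => Or.inl rfl
  let ψ : D.Circ → ZMod 2 := fun a => ∑ b with b ≤ a, if P b then g b else 0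
  have hnext : ∀ a, ψ (D.next a) = ψ a + if P (D.next a) then g (D.next a) else 0 := by
    intro a
    by_cases hao : D.next a = o
    · have h1 : ψ a = 0 := by
        refine hzero _ fun b _ => ?_
        rw [Finset.mem_filter]
        refine ⟨Finset.mem_univ _, not_lt.1 fun h => ?_⟩
        refine (D.isCircularNext_next a).1 (D.mate b) ((sbtw_iff_cutOrder o _ _ _).2 ?_)
        rw [hao]
        by_cases ha : a = o
        · have := (D.isCircularNext_next a).2 (ha.trans hao.symm) (D.mate b)
          exact absurd this h.ne'
        · exact Or.inr (Or.inr ⟨lt_of_le_of_ne (hbot a) (Ne.symm ha), h⟩)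
      have h2 : Finset.univ.filter (· ≤ o) = {o} := by
        ext u
        simp only [Finset.mem_filter, Finset.mem_univ, true_and, Finset.mem_singleton]
        exact ⟨fun h => le_antisymm h (hbot u), fun h => h.le⟩
      change ∑ b with b ≤ D.next a, _ = _
      rw [h1, hao, h2, Finset.sum_singleton, zero_add]
    · have h2 : Finset.univ.filter (· ≤ D.next a) =
          insert (D.next a) (Finset.univ.filter (· ≤ a)) := by
        ext u
        simp only [Finset.mem_filter, Finset.mem_univ, true_and, Finset.mem_insert]
        constructor
        · intro h
          rcases h.eq_or_lt with h | h
          · exact Or.inl h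
          · exact Or.inr (not_lt.1 fun h' => hno a u h' h)
        · rintro (h | h)
          · exact h.le
          · exact h.trans (hlt a hao).le
      change ∑ b with b ≤ D.next a, _ = _
      rw [h2, Finset.sum_insert, add_comm]
      simp only [Finset.mem_filter, Finset.mem_univ, true_and, not_le]
      exact hlt a hao
  have hmate : ∀ a, a < D.mate a → P a → ψ (D.mate a) = ψ a + g a := by
    intro a ha hPa
    have h1 : Finset.univ.filter (· ≤ D.mate a) =
        insert (D.mate a) (Finset.univ.filter (· ≤ a) ∪
          Finset.univ.filter fun u => a < u ∧ u < D.mate a) := by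
      ext u
      simp only [Finset.mem_filter, Finset.mem_univ, true_and, Finset.mem_insert, Finset.mem_union]
      grind
    have h2 : ∑ b with a < b ∧ b < D.mate a, (if P b then g b else 0) = 0 := by
      rw [← Finset.sum_filter, Finset.filter_filter]
      have : ∀ b, (a < b ∧ b < D.mate a) ∧ P b → (a < D.mate b ∧ D.mate b < D.mate a) := by
        rintro b ⟨⟨h3, h4⟩, hPb⟩
        by_contra hcon
        refine hcross a b hPa hPb ⟨(sbtw_iff_cutOrder o _ _ _).2 (Or.inl ⟨h3, h4⟩),
          (sbtw_iff_cutOrder o _ _ _).2 ?_⟩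
        have h5 : D.mate b ≠ a := fun h => h4.ne (by rw [← h, hD.mate_mate])
        have h6 : D.mate b ≠ D.mate a := fun h => h3.ne'
          (by rw [← hD.mate_mate b, h, hD.mate_mate])
        grind
      refine Finset.sum_involution (fun b _ => D.mate b) (fun b _ => ?_)
        (fun b _ _ => hD.mate_ne b) (fun b hb => ?_) (fun b _ => hD.mate_mate b)
      · simp only [hg, CharTwo.add_self_eq_zero]
      · rw [Finset.mem_filter] at hb ⊢
        exact ⟨Finset.mem_univ _, this b hb.2, (hP b).2 hb.2.2⟩
    change ∑ b with b ≤ D.mate a, _ = _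
    rw [h1, Finset.sum_insert, Finset.sum_union, h2, add_zero, if_pos ((hP a).2 hPa), hg, add_comm]
    · rw [Finset.disjoint_filter]
      exact fun u _ h h' => h'.1.not_ge h
    · simp only [Finset.mem_filter, Finset.mem_univ, true_and, Finset.mem_union]
      grind
  refine ⟨ψ, fun a ha => ?_, fun a ha => ?_, fun a ha => ?_⟩
  · rw [hnext, if_pos ha]
  · rw [hnext, if_neg ha, add_zero]
  · rcases lt_trichotomy a (D.mate a) with h | h | h
    · exact hmate a h ha
    · exact (hD.mate_ne a h.symm).elim
    · have := hmate (D.mate a) (by rwa [hD.mate_mate]) ((hP a).2 ha)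
      rw [hD.mate_mate, hg] at this
      rw [this, add_assoc, CharTwo.add_self_eq_zero, add_zero]

/-- An embedding of a chord diagram is spherical if crossing chords lie on different sides of the
circle. -/
theorem IsChordDiagram.isSphereEmbedding_of_sides (hD : D.IsChordDiagram) {F : Finset D.Vertex}
    (h1 : ∀ c, Sum.inl (D.mate c) ∈ F ↔ (Sum.inl c : D.Vertex) ∈ F)
    (h2 : ∀ x y, D.Crossing x y → ((Sum.inl x : D.Vertex) ∈ F ↔ (Sum.inl y : D.Vertex) ∉ F)) :
    D.IsSphereEmbedding F := by
  classical
  have : IsEmpty D.Inner := hD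
  rcases isEmpty_or_nonempty D.Circ with h0 | ⟨⟨o⟩⟩
  · exact Or.inl inferInstance
  rw [hD.isSphereEmbedding_iff_surjective F o]
  rintro ⟨G, t⟩
  have hg : ∀ c, G (D.comp (Sum.inl (D.mate c))) = G (D.comp (Sum.inl c)) := fun c => by
    rw [hD.comp_mate]
  obtain ⟨O, hO1, hO2, hO3⟩ := hD.exists_potential (fun c => Sum.inl c ∈ F) h1
    (fun x y hx hy h => (h2 x y h).1 hx hy) (fun c => G (D.comp (Sum.inl c))) hg
  obtain ⟨J, hJ1, hJ2, hJ3⟩ := hD.exists_potential (fun c => Sum.inl c ∉ F)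
    (fun c => not_congr (h1 c))
    (fun x y hx hy h => hx ((h2 x y h).2 hy)) (fun c => G (D.comp (Sum.inl c))) hg
  simp only [not_not] at hJ2
  have hO1' := fun a => hO1 (D.next.symm a)
  have hO2' := fun a => hO2 (D.next.symm a)
  simp only [Equiv.apply_symm_apply] at hO1' hO2'
  -- the constant by which `J` has to be shifted to get the jump `t` across the arc at `o`
  obtain ⟨t', ht'⟩ : ∃ t', t' = t + O o + J o := ⟨_, rfl⟩
  let I : D.Circ → ZMod 2 := fun c => t' + J (D.next.symm c)
  let L : D.Circ → ZMod 2 := fun c => if Sum.inl c ∈ F then O (D.next.symm c) else t' + J c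
  let f : D.Dart → ZMod 2 := fun d => Sum.elim (fun c => ![O c, L c, I c] d.2) isEmptyElim d.1
  have hf0 : ∀ c, f (Sum.inl c, 0) = O c := fun c => rfl
  have hf1 : ∀ c, f (Sum.inl c, 1) = L c := fun c => rfl
  have hf2 : ∀ c, f (Sum.inl c, 2) = I c := fun c => rfl
  have hLp : ∀ c, Sum.inl c ∈ F → L c = O (D.next.symm c) := fun c h => if_pos h
  have hLn : ∀ c, Sum.inl c ∉ F → L c = t' + J c := fun c h => if_neg h
  have hI : ∀ c, I (D.next c) = t' + J c := fun c => by
    simp only [I, Equiv.symm_apply_apply]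
  have ff : D.IsFaceFunction F f := by
    rw [hD.isFaceFunction_iff]
    intro c
    simp only [hf0, hf1, hf2, hI]
    refine ⟨fun hc => ⟨(hLn c hc).symm, ?_, (hO2' c hc).symm⟩, fun hc => ⟨?_, ?_, (hLp c hc).symm⟩⟩
    · have e1 := hJ1 (D.next.symm c)
      simp only [Equiv.apply_symm_apply] at e1
      rw [hLn _ (by rwa [h1]), hJ3 c hc, e1 hc]
      change _ = t' + _
      grind
    · have e1 := hJ2 (D.next.symm c)
      simp only [Equiv.apply_symm_apply] at e1
      rw [e1 hc]
    · have e1 := hO1' _ ((h1 c).2 hc)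
      have e2 := hO3 c hc
      have e3 := hg c
      rw [hLp _ ((h1 c).2 hc)]
      grind
  refine ⟨Quot.lift f fun d d' hd => ?_, Prod.ext (funext fun q => ?_) ?_⟩
  · rw [(D.faceStep_iff F _ _).1 hd]; exact ff d
  · obtain ⟨c, rfl⟩ := hD.exists_comp q
    rw [hD.jumps_comp]
    change L c + L (D.mate c) = G (D.comp (Sum.inl c))
    by_cases hc : Sum.inl c ∈ F
    · have e1 := hO1' _ ((h1 c).2 hc)
      have e2 := hO1' _ hc
      have e3 := hO3 c hc
      have e4 := hg c
      rw [hLp _ hc, hLp _ ((h1 c).2 hc)]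
      grind
    · have e3 := hJ3 c hc
      rw [hLn _ hc, hLn _ (by rwa [h1])]
      grind
  · change O o + I (D.next o) = t
    rw [hI, ht']
    grind

/-- The embeddings of a chord diagram into the sphere: every chord is drawn on one side of the
circle, and crossing chords are drawn on different sides. -/
theorem IsChordDiagram.isSphereEmbedding_iff (hD : D.IsChordDiagram) (F : Finset D.Vertex) :
    D.IsSphereEmbedding F ↔ (∀ c, Sum.inl (D.mate c) ∈ F ↔ (Sum.inl c : D.Vertex) ∈ F) ∧
      ∀ x y, D.Crossing x y → ((Sum.inl x : D.Vertex) ∈ F ↔ (Sum.inl y : D.Vertex) ∉ F) :=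
  ⟨fun h => ⟨hD.mem_mate_iff h, fun _ _ => hD.mem_iff_notMem h⟩,
    fun h => hD.isSphereEmbedding_of_sides h.1 h.2⟩

end TrivalentDiagram

namespace TrivalentDiagram

variable {D : TrivalentDiagram}

theorem IsChordDiagram.sub (hD : D.IsChordDiagram) (s : Set D.Component) :
    (D.sub s).IsChordDiagram := by
  have : IsEmpty D.Inner := hD
  exact Subtype.isEmpty_of_false fun i => isEmptyElim i

theorem IsChordDiagram.mate_sub (hD : D.IsChordDiagram) (s : Set D.Component)
    (c : (D.sub s).Circ) : ((D.sub s).mate c).1 = D.mate c.1 := by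
  have h := D.subIncl_subPair s (Sum.inl c)
  have h' := (hD.sub s).pair_inl c
  change D.subPair s (Sum.inl c) = _ at h'
  rw [h'] at h
  exact Sum.inl_injective (h.trans (hD.pair_inl c.1))

theorem IsChordDiagram.crossing_sub (hD : D.IsChordDiagram) (s : Set D.Component)
    (x y : (D.sub s).Circ) : (D.sub s).Crossing x y ↔ D.Crossing x.1 y.1 := by
  unfold Crossing
  rw [← hD.mate_sub, ← hD.mate_sub]
  exact Iff.rfl

theorem intersectionGraph_adj (a b : D.Component) : D.intersectionGraph.graph.Adj a b ↔ a ≠ b ∧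
    ((∃ x x' y y' : D.Circ, D.comp (Sum.inl x) = a ∧ D.comp (Sum.inl x') = a ∧
      D.comp (Sum.inl y) = b ∧ D.comp (Sum.inl y') = b ∧ sbtw x y x' ∧ sbtw x' y' x) ∨
    (∃ x x' y y' : D.Circ, D.comp (Sum.inl x) = b ∧ D.comp (Sum.inl x') = b ∧
      D.comp (Sum.inl y) = a ∧ D.comp (Sum.inl y') = a ∧ sbtw x y x' ∧ sbtw x' y' x)) :=
  SimpleGraph.fromRel_adj _ _ _

theorem IsChordDiagram.crossing_of_sbtw (hD : D.IsChordDiagram) {x x' y y' : D.Circ}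
    (h1 : D.comp (Sum.inl x) = D.comp (Sum.inl x')) (h2 : D.comp (Sum.inl y) = D.comp (Sum.inl y'))
    (h3 : sbtw x y x') (h4 : sbtw x' y' x) : D.Crossing x y := by
  rcases (hD.comp_eq_iff _ _).1 h1 with rfl | rfl
  · exact (sbtw_irrefl_left_right h3).elim
  rcases (hD.comp_eq_iff _ _).1 h2 with rfl | rfl
  · exact (h3.not_sbtw h4).elim
  exact ⟨h3, h4⟩

theorem IsChordDiagram.forall_not_crossing_iff (hD : D.IsChordDiagram) :
    (∀ x y, ¬ D.Crossing x y) ↔ D.intersectionGraph.graph = ⊥ := by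
  constructor
  · intro h
    ext a b
    simp only [SimpleGraph.bot_adj, iff_false]
    intro hab
    rcases ((intersectionGraph_adj a b).1 hab).2 with
      ⟨x, x', y, y', h1, h2, h3, h4, h5, h6⟩ | ⟨x, x', y, y', h1, h2, h3, h4, h5, h6⟩
    · exact h x y (hD.crossing_of_sbtw (h1.trans h2.symm) (h3.trans h4.symm) h5 h6)
    · exact h x y (hD.crossing_of_sbtw (h1.trans h2.symm) (h3.trans h4.symm) h5 h6)
  · intro h x y hxy
    have : D.intersectionGraph.graph.Adj (D.comp (Sum.inl x)) (D.comp (Sum.inl y)) := by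
      refine (intersectionGraph_adj _ _).2 ⟨fun h => ?_,
        Or.inl ⟨x, D.mate x, y, D.mate y, rfl, hD.comp_mate x, rfl, hD.comp_mate y, hxy.1, hxy.2⟩⟩
      rcases (hD.comp_eq_iff _ _).1 h with rfl | rfl
      · exact sbtw_irrefl_left hxy.1
      · exact sbtw_irrefl_right hxy.1
    rw [h] at this
    exact this

open Classical in
/-- The embeddings with all chords on the inner side of the circle. -/
theorem IsChordDiagram.signedCount_false (hD : D.IsChordDiagram) :
    signedCount False D = if D.intersectionGraph.graph = ⊥ then 1 else 0 := by
  have : IsEmpty D.Inner := hD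
  unfold signedCount
  rw [Finset.sum_eq_single ∅]
  · rw [Finset.card_empty, pow_zero]
    refine if_congr ?_ rfl rfl
    unfold IsCounted
    rw [hD.isSphereEmbedding_iff, ← hD.forall_not_crossing_iff]
    simp
  · intro F _ hF
    refine if_neg fun h => hF (Finset.eq_empty_of_forall_notMem ?_)
    rintro (c | i)
    · exact (h.2.resolve_left id) c
    · exact isEmptyElim i
  · exact fun h => (h (Finset.mem_univ _)).elim

open Classical in
/-- An embedding of a chord diagram distributes the chords over the two sides of the circle. -/
theorem IsChordDiagram.signedCount_true_eq_sum (hD : D.IsChordDiagram) :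
    signedCount True D =
      ∑ s : Set D.Component, signedCount False (D.sub s) * signedCount False (D.sub sᶜ) := by
  have : IsEmpty D.Inner := hD
  symm
  refine Finset.sum_of_injOn (fun s => Finset.univ.filter fun v => D.comp v ∈ s) ?_
    (fun _ _ => Finset.mem_univ _) ?_ ?_
  · intro s _ s' _ h
    ext q
    obtain ⟨c, rfl⟩ := hD.exists_comp q
    have := congrArg (Sum.inl c ∈ ·) h
    simpa using this
  · intro F _ hF
    refine if_neg fun h => hF ⟨{q | ∃ c, D.comp (Sum.inl c) = q ∧ Sum.inl c ∈ F},
      Finset.mem_univ _, ?_⟩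
    have h1 := ((hD.isSphereEmbedding_iff F).1 h.1).1
    ext v
    rcases v with c | i
    · simp only [Finset.mem_filter, Finset.mem_univ, true_and, Set.mem_ofPred_eq]
      constructor
      · rintro ⟨b, hb, hbF⟩
        rcases (hD.comp_eq_iff _ _).1 hb with rfl | rfl
        · exact hbF
        · exact (h1 b).2 hbF
      · exact fun hc => ⟨c, rfl, hc⟩
    · exact isEmptyElim i
  · intro s _
    have hsub : ∀ s : Set D.Component, (D.sub s).intersectionGraph.graph = ⊥ ↔
        ∀ x y, D.comp (Sum.inl x) ∈ s → D.comp (Sum.inl y) ∈ s → ¬ D.Crossing x y := by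
      intro s
      rw [← (hD.sub s).forall_not_crossing_iff]
      simp only [hD.crossing_sub]
      exact ⟨fun h x y hx hy => h ⟨x, hx⟩ ⟨y, hy⟩, fun h x y => h x.1 y.1 x.2 y.2⟩
    have hsign : (-1 : ℤ) ^ (Finset.univ.filter fun v : D.Vertex => D.comp v ∈ s).card = 1 := by
      rw [← Finset.prod_const]
      refine Finset.prod_involution (fun v _ => Sum.map D.mate id v) (fun _ _ => by norm_num)
        ?_ ?_ ?_
      · rintro (c | i) _ _
        · exact fun h => hD.mate_ne c (Sum.inl_injective h)
        · exact isEmptyElim i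
      · rintro (c | i) h
        · simpa [hD.comp_mate] using h
        · exact isEmptyElim i
      · rintro (c | i) _
        · exact congrArg Sum.inl (hD.mate_mate c)
        · exact isEmptyElim i
    rw [(hD.sub s).signedCount_false, (hD.sub sᶜ).signedCount_false, hsign,
      ite_zero_mul_ite_zero, one_mul]
    refine if_congr ?_ rfl rfl
    unfold IsCounted
    rw [hD.isSphereEmbedding_iff, hsub, hsub]
    simp only [Finset.mem_filter, Finset.mem_univ, true_and, hD.comp_mate, true_or, and_true,
      Set.mem_compl_iff, implies_true]
    constructor
    · rintro ⟨h1, h2⟩ x y hxy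
      have := h1 x y
      have := h2 x y
      tauto
    · intro h
      exact ⟨fun x y hx hy hxy => (h x y hxy).1 hx hy, fun x y hx hy hxy => hx ((h x y hxy).2 hy)⟩

end TrivalentDiagram

/-! ### Colourings and the expansion of graphs in complete graphs -/

namespace WeightedGraph

noncomputable instance fintypeVertex (G : WeightedGraph) : Fintype G.V := Fintype.ofFinite _

/-- The total weights of the colour classes of a colouring. -/
noncomputable def colorWeight (G : WeightedGraph) {k : ℕ} (κ : G.V → Fin k) (i : Fin k) : ℕ :=
  ∑ x, if κ x = i then (G.weight x : ℕ) else 0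

/-- A proper colouring that uses all colours. -/
def IsColoring (G : WeightedGraph) {k : ℕ} (κ : G.V → Fin k) : Prop :=
  Function.Surjective κ ∧ ∀ x y, G.graph.Adj x y → κ x ≠ κ y

open Classical in
/-- The sum of all proper colourings with exactly `k` colours, each of them recorded by the weights
of its colour classes. -/
noncomputable def coloringSum (R : Type*) [Field R] (k : ℕ) (G : WeightedGraph) :
    (Fin k → ℕ) →₀ R :=
  ∑ κ : G.V → Fin k, if G.IsColoring κ then Finsupp.single (G.colorWeight κ) 1 else 0

/-- The induced subgraph. -/
def induce (G : WeightedGraph) (s : Set G.V) : WeightedGraph where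
  V := s
  graph := G.graph.induce s
  weight x := G.weight x

/-- The complete graph with vertices of the given weights. -/
def complete {k : ℕ} (u : Fin k → ℕ) : WeightedGraph where
  V := Fin k
  graph := ⊤
  weight i := (u i).toPNat'

variable (R : Type*) [Field R]

theorem Isomorphic.coloringSum_eq (k : ℕ) {G H : WeightedGraph} (h : G.Isomorphic H) :
    G.coloringSum R k = H.coloringSum R k := by
  classical
  obtain ⟨e, he⟩ := h
  unfold coloringSum
  refine Fintype.sum_equiv (Equiv.arrowCongr e.toEquiv (Equiv.refl _)) _ _ fun κ => ?_
  have h1 : ∀ y, (Equiv.arrowCongr e.toEquiv (Equiv.refl (Fin k)) κ) y = κ (e.symm y) := fun y => rfl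
  have h2 : G.colorWeight κ = H.colorWeight (Equiv.arrowCongr e.toEquiv (Equiv.refl (Fin k)) κ) := by
    funext i
    refine Fintype.sum_equiv e.toEquiv _ _ fun x => ?_
    have : H.weight (e.toEquiv x) = G.weight x := he x
    rw [h1, this]
    change _ = if κ (e.symm (e x)) = i then _ else _
    rw [e.symm_apply_apply]
  have h3 : G.IsColoring κ ↔ H.IsColoring (Equiv.arrowCongr e.toEquiv (Equiv.refl (Fin k)) κ) := by
    refine and_congr ?_ ?_
    · exact (e.symm.toEquiv.surjective_comp κ).symm
    · simp only [h1]
      constructor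
      · intro h x y hxy
        exact h _ _ (e.symm.map_adj_iff.2 hxy)
      · intro h x y hxy
        have := h (e x) (e y) (e.map_adj_iff.2 hxy)
        rwa [e.symm_apply_apply, e.symm_apply_apply] at this
  rw [h2]
  exact if_congr h3 rfl rfl

theorem Isomorphic.graph_eq_bot_iff {G H : WeightedGraph} (h : G.Isomorphic H) :
    G.graph = ⊥ ↔ H.graph = ⊥ := by
  obtain ⟨e, -⟩ := h
  constructor
  · intro hG
    refine SimpleGraph.ext (funext fun x => funext fun y => propext ⟨fun h => ?_, False.elim⟩)
    have := e.symm.map_adj_iff.2 h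
    exact (congrArg (fun K : SimpleGraph G.V => K.Adj _ _) hG).mp this
  · intro hH
    refine SimpleGraph.ext (funext fun x => funext fun y => propext ⟨fun h => ?_, False.elim⟩)
    have := e.map_adj_iff.2 h
    exact (congrArg (fun K : SimpleGraph H.V => K.Adj _ _) hH).mp this

theorem graphClass_eq_of_isomorphic {G H : WeightedGraph} (h : G.Isomorphic H) :
    graphClass R G = graphClass R H := by
  refine (Submodule.Quotient.eq _).2 (Submodule.subset_span ?_)
  exact .isomorphic G H h

theorem graphClass_chromatic (G : WeightedGraph) (v w : G.V) (h : G.graph.Adj v w) :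
    graphClass R (G.deleteEdge v w) =
      graphClass R G + graphClass R (G.contractEdge v w h.ne) := by
  have : graphClass R G = graphClass R (G.deleteEdge v w) -
      graphClass R (G.contractEdge v w h.ne) :=
    (Submodule.Quotient.eq _).2 (Submodule.subset_span (.chromatic G v w h))
  rw [this, sub_add_cancel]

open Classical in
/-- The projection to the vertices of the contracted graph. -/
noncomputable def contractVertex (G : WeightedGraph) {v w : G.V} (hvw : v ≠ w) (x : G.V) :
    (G.contractEdge v w hvw).V :=
  if h : x = w then ⟨v, hvw⟩ else ⟨x, h⟩

variable {G : WeightedGraph} {v w : G.V}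

theorem contractVertex_of_ne (hvw : v ≠ w) {x : G.V} (h : x ≠ w) :
    G.contractVertex hvw x = ⟨x, h⟩ := dif_neg h

theorem contractVertex_self (hvw : v ≠ w) : G.contractVertex hvw w = ⟨v, hvw⟩ := dif_pos rfl

theorem contractVertex_surjective (hvw : v ≠ w) : Function.Surjective (G.contractVertex hvw) :=
  fun x => ⟨x.1, contractVertex_of_ne hvw x.2⟩

theorem contractVertex_eq_iff (hvw : v ≠ w) {x y : G.V} (hxy : x ≠ y) :
    G.contractVertex hvw x = G.contractVertex hvw y ↔ s(x, y) = s(v, w) := by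
  rw [Sym2.eq_iff]
  by_cases hx : x = w
  · have hy : y ≠ w := fun h => hxy (hx.trans h.symm)
    rw [hx, contractVertex_self, contractVertex_of_ne hvw hy]
    refine (Subtype.ext_iff).trans ⟨fun h => Or.inr ⟨rfl, h.symm⟩, fun h => ?_⟩
    rcases h with ⟨h, h'⟩ | ⟨-, h⟩
    · exact (hvw h.symm).elim
    · exact h.symm
  · rw [contractVertex_of_ne hvw hx]
    by_cases hy : y = w
    · rw [hy, contractVertex_self]
      exact (Subtype.ext_iff).trans ⟨fun h => Or.inl ⟨h, rfl⟩, fun h => h.elim And.left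
        fun h => (hx h.1).elim⟩
    · rw [contractVertex_of_ne hvw hy]
      refine (Subtype.ext_iff).trans ⟨fun h => (hxy h).elim, fun h => ?_⟩
      rcases h with ⟨-, h⟩ | ⟨h, -⟩
      · exact (hy h).elim
      · exact (hx h).elim

theorem contractEdge_adj (hvw : v ≠ w) (a b : (G.contractEdge v w hvw).V) :
    (G.contractEdge v w hvw).graph.Adj a b ↔ a ≠ b ∧ ∃ x y, G.contractVertex hvw x = a ∧
      G.contractVertex hvw y = b ∧ G.graph.Adj x y := by
  refine (SimpleGraph.fromRel_adj _ _ _).trans (and_congr_right fun _ => ⟨?_, Or.inl⟩)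
  rintro (h | ⟨x, y, h1, h2, h3⟩)
  · exact h
  · exact ⟨y, x, h2, h1, h3.symm⟩

/-- Colourings of the contracted graph are colourings of the vertices of `G` that are equal at `v` and
`w`; this does not change the weights of the colour classes. -/
theorem colorWeight_contractVertex (hvw : v ≠ w) {k : ℕ}
    (κ : (G.contractEdge v w hvw).V → Fin k) :
    G.colorWeight (κ ∘ G.contractVertex hvw) = (G.contractEdge v w hvw).colorWeight κ := by
  classical
  funext i
  unfold colorWeight
  have h1 := Fintype.sum_eq_add_sum_subtype_ne
    (fun x => if (κ ∘ G.contractVertex hvw) x = i then (G.weight x : ℕ) else 0) w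
  refine h1.trans ?_
  have h2 : ∀ a : (G.contractEdge v w hvw).V, ((G.contractEdge v w hvw).weight a : ℕ) =
      G.weight a.1 + if a = ⟨v, hvw⟩ then (G.weight w : ℕ) else 0 := by
    intro a
    change ((if a.1 = v then G.weight v + G.weight w else G.weight a.1 : ℕ+) : ℕ) = _
    have ha' : a = ⟨v, hvw⟩ ↔ a.1 = v := Subtype.ext_iff
    by_cases ha : a.1 = v
    · refine (congrArg PNat.val (if_pos ha)).trans ?_
      refine .trans ?_ (congrArg (_ + ·) (if_pos (ha'.2 ha)).symm)
      exact (PNat.add_coe _ _).trans (congrArg (fun x => (G.weight x : ℕ) + G.weight w) ha.symm)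
    · refine (congrArg PNat.val (if_neg ha)).trans ?_
      refine .trans ?_ (congrArg (_ + ·) (if_neg fun h => ha (ha'.1 h)).symm)
      rfl
  have h3 : ∀ a : (G.contractEdge v w hvw).V,
      (if κ a = i then ((G.contractEdge v w hvw).weight a : ℕ) else 0) =
      (if κ a = i then (G.weight a.1 : ℕ) else 0) +
        if a = ⟨v, hvw⟩ then (if κ a = i then (G.weight w : ℕ) else 0) else 0 := by
    intro a
    rw [h2]
    split_ifs <;> rfl
  have h4 : ∑ a : (G.contractEdge v w hvw).V, (if a = ⟨v, hvw⟩ then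
      (if κ a = i then (G.weight w : ℕ) else 0) else 0) =
      if κ ⟨v, hvw⟩ = i then (G.weight w : ℕ) else 0 :=
    (Finset.sum_ite_eq' _ _ _).trans (if_pos (Finset.mem_univ _))
  refine .trans ?_ ((Finset.sum_congr rfl fun a _ => h3 a).trans
    (Finset.sum_add_distrib.trans (congrArg (_ + ·) h4))).symm
  refine (add_comm _ _).trans (congrArg₂ (· + ·) ?_ ?_)
  · refine Fintype.sum_equiv (κ := (G.contractEdge v w hvw).V)
      (show {i // i ≠ w} ≃ (G.contractEdge v w hvw).V from Equiv.refl _) _ _ fun a => ?_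
    change (if κ (G.contractVertex hvw a.1) = i then _ else _) = _
    rw [contractVertex_of_ne hvw a.2]; rfl
  · change (if κ (G.contractVertex hvw w) = i then _ else _) = _
    rw [contractVertex_self]

/-- Colourings in which `v` and `w` have different colours are colourings of `G`, the others are
colourings of the contracted graph. -/
theorem coloringSum_chromatic (k : ℕ) (h : G.graph.Adj v w) :
    (G.deleteEdge v w).coloringSum R k =
      G.coloringSum R k + (G.contractEdge v w h.ne).coloringSum R k := by
  classical
  have hdel : ∀ x y, (G.deleteEdge v w).graph.Adj x y ↔ G.graph.Adj x y ∧ s(x, y) ≠ s(v, w) :=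
    fun x y => SimpleGraph.deleteEdges_adj.trans
      (and_congr_right fun _ => not_congr Set.mem_singleton_iff)
  have h1 : ∀ κ : G.V → Fin k, G.IsColoring κ ↔ (G.deleteEdge v w).IsColoring κ ∧ κ v ≠ κ w := by
    intro κ
    constructor
    · exact fun hκ => ⟨⟨hκ.1, fun x y hxy => hκ.2 x y ((hdel x y).1 hxy).1⟩, hκ.2 v w h⟩
    · rintro ⟨hκ, hvw⟩
      refine ⟨hκ.1, fun x y hxy => ?_⟩
      by_cases he : s(x, y) = s(v, w)
      · rcases Sym2.eq_iff.1 he with ⟨rfl, rfl⟩ | ⟨rfl, rfl⟩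
        · exact hvw
        · exact hvw.symm
      · exact hκ.2 x y ((hdel x y).2 ⟨hxy, he⟩)
  have h2 : (G.contractEdge v w h.ne).coloringSum R k =
      ∑ κ : G.V → Fin k, if (G.deleteEdge v w).IsColoring κ ∧ κ v = κ w then
        Finsupp.single (G.colorWeight κ) (1 : R) else 0 := by
    unfold coloringSum
    refine Finset.sum_of_injOn (fun κ => κ ∘ G.contractVertex h.ne) ?_
      (fun _ _ => Finset.mem_univ _) ?_ ?_
    · exact fun κ _ κ' _ hκ => (contractVertex_surjective h.ne).injective_comp_right hκ
    · intro κ _ hκ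
      refine if_neg fun hc => hκ ⟨fun a => κ a.1, Finset.mem_univ _, funext fun x => ?_⟩
      by_cases hx : x = w
      · change κ (G.contractVertex h.ne x).1 = _
        rw [hx, contractVertex_self]; exact hc.2
      · change κ (G.contractVertex h.ne x).1 = _
        rw [contractVertex_of_ne _ hx]
    · intro κ _
      rw [colorWeight_contractVertex]
      refine if_congr ⟨fun hκ => ⟨⟨hκ.1.comp (contractVertex_surjective h.ne), fun x y hxy => ?_⟩, ?_⟩,
        fun hκ => ⟨hκ.1.1.of_comp, fun a b hab => ?_⟩⟩ rfl rfl
      · obtain ⟨hxy, he⟩ := (hdel x y).1 hxy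
        exact hκ.2 _ _ ((contractEdge_adj h.ne _ _).2
          ⟨fun h' => he ((contractVertex_eq_iff h.ne hxy.ne).1 h'), x, y, rfl, rfl, hxy⟩)
      · change κ (G.contractVertex h.ne v) = κ (G.contractVertex h.ne w)
        rw [(contractVertex_eq_iff h.ne h.ne).2 rfl]
      · obtain ⟨hne, x, y, rfl, rfl, hxy⟩ := (contractEdge_adj h.ne _ _).1 hab
        exact hκ.1.2 x y ((hdel x y).2
          ⟨hxy, fun h' => hne ((contractVertex_eq_iff h.ne hxy.ne).2 h')⟩)
  rw [h2]
  unfold coloringSum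
  rw [← Finset.sum_add_distrib]
  refine Finset.sum_congr rfl fun κ _ => ?_
  have h3 := h1 κ
  change (if (G.deleteEdge v w).IsColoring κ then Finsupp.single (G.colorWeight κ) 1 else 0) = _
  by_cases hκ : (G.deleteEdge v w).IsColoring κ <;> by_cases he : κ v = κ w <;>
    simp [h3, hκ, he]

/-- The class of a complete graph, extended linearly. -/
noncomputable def completeClass (k : ℕ) : ((Fin k → ℕ) →₀ R) →ₗ[R] ChromaticSpace R :=
  Finsupp.linearCombination R fun u => graphClass R (complete u)

theorem isColoring_top_iff (hG : G.graph = ⊤) {k : ℕ} (κ : G.V → Fin k) :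
    G.IsColoring κ ↔ Function.Bijective κ := by
  unfold IsColoring
  rw [hG, Function.Bijective, and_comm]
  refine and_congr_left fun _ => ⟨fun h x y hxy => ?_, fun h x y hxy hκ => hxy (h hκ)⟩
  by_contra hne
  exact h x y hne hxy

theorem isomorphic_complete (hG : G.graph = ⊤) {k : ℕ} {κ : G.V → Fin k}
    (hκ : Function.Bijective κ) : G.Isomorphic (complete (G.colorWeight κ)) := by
  refine ⟨⟨Equiv.ofBijective κ hκ, fun {x y} => ?_⟩, fun x => ?_⟩
  · rw [hG]
    exact not_congr (Equiv.ofBijective κ hκ).apply_eq_iff_eq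
  · change (G.colorWeight κ (κ x)).toPNat' = _
    have : G.colorWeight κ (κ x) = G.weight x := by
      classical
      unfold colorWeight
      simp only [hκ.1.eq_iff]
      rw [Finset.sum_ite_eq', if_pos (Finset.mem_univ _)]
    rw [this, PNat.coe_toPNat']

/-- The proper colourings of a complete graph that use all colours are the bijections to the set of
colours. -/
theorem completeClass_coloringSum_top (hG : G.graph = ⊤) (k : ℕ) :
    completeClass R k (G.coloringSum R k) =
      if k = Nat.card G.V then (k.factorial : R) • graphClass R G else 0 := by
  classical
  have h1 : ∀ κ : G.V → Fin k, completeClass R k (if G.IsColoring κ then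
      Finsupp.single (G.colorWeight κ) 1 else 0) =
      if Function.Bijective κ then graphClass R G else 0 := by
    intro κ
    by_cases h : Function.Bijective κ
    · rw [if_pos ((isColoring_top_iff hG κ).2 h), if_pos h, completeClass,
        Finsupp.linearCombination_single, one_smul]
      exact (graphClass_eq_of_isomorphic R (isomorphic_complete hG h)).symm
    · rw [if_neg fun h' => h ((isColoring_top_iff hG κ).1 h'), if_neg h, map_zero]
  unfold coloringSum
  rw [map_sum, Finset.sum_congr rfl fun κ _ => h1 κ, ← Finset.sum_filter, Finset.sum_const,
    ← Nat.cast_smul_eq_nsmul R]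
  rw [Nat.card_eq_fintype_card]
  split_ifs with hk
  · have h2 : Fintype.card (G.V ≃ Fin k) = k.factorial := by
      rw [Fintype.card_equiv (Fintype.equivFinOfCardEq hk.symm), ← hk]
    rw [← h2, ← Fintype.card_subtype]
    congr 2
    exact Fintype.card_congr (Equiv.ofBijective (fun κ => Equiv.ofBijective κ.1 κ.2)
      ⟨fun κ κ' h => Subtype.ext (congrArg (fun e : G.V ≃ Fin k => (e : G.V → Fin k)) h),
        fun e => ⟨⟨e, e.bijective⟩, Equiv.ext fun _ => rfl⟩⟩)
  · rw [Finset.filter_false_of_mem, Finset.card_empty, Nat.cast_zero, zero_smul]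
    intro κ _ h
    exact hk (by rw [Fintype.card_of_bijective h, Fintype.card_fin])

theorem natCard_lt_of_injective {α β : Type*} [Finite α] [Finite β] {f : α → β} {b : β}
    (hf : Function.Injective f) (hb : ∀ a, f a ≠ b) : Nat.card α < Nat.card β := by
  have := Fintype.ofFinite α
  have := Fintype.ofFinite β
  rw [Nat.card_eq_fintype_card, Nat.card_eq_fintype_card]
  exact Fintype.card_lt_of_injective_of_notMem f hf fun ⟨a, ha⟩ => hb a ha

/-- The expansion of a graph in complete graphs: every proper colouring contributes the complete
graph on its colour classes. -/
theorem graphClass_eq_sum [CharZero R] (G : WeightedGraph) (N : ℕ) (hN : Nat.card G.V ≤ N) :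
    graphClass R G = ∑ k ∈ Finset.range (N + 1),
      ((k.factorial : R)⁻¹) • completeClass R k (G.coloringSum R k) := by
  classical
  -- adding an edge and contracting it both decrease the number of pairs of nonadjacent vertices;
  -- pairs of equal vertices are included, so that a contraction decreases it strictly
  induction hn : Nat.card {p : G.V × G.V // ¬ G.graph.Adj p.1 p.2} using Nat.strong_induction_on
    generalizing G with
  | _ n ih =>
  by_cases hG : G.graph = ⊤
  · simp only [completeClass_coloringSum_top R hG]
    rw [Finset.sum_eq_single (Nat.card G.V)]
    · rw [if_pos rfl, smul_smul, inv_mul_cancel₀, one_smul]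
      exact_mod_cast Nat.factorial_ne_zero _
    · intro k _ hk
      rw [if_neg hk, smul_zero]
    · intro h
      exact (h (Finset.mem_range.2 (by omega))).elim
  · obtain ⟨v, w, hvw, hnadj⟩ : ∃ v w, v ≠ w ∧ ¬ G.graph.Adj v w := by
      by_contra! h
      refine hG (SimpleGraph.ext (funext fun v => funext fun w => propext ⟨fun h => h.ne, h v w⟩))
    let H : WeightedGraph := ⟨G.V, G.graph ⊔ SimpleGraph.edge v w, G.weight⟩
    have hadj : ∀ x y : G.V, H.graph.Adj x y ↔ G.graph.Adj x y ∨ s(v, w) = s(x, y) ∧ x ≠ y :=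
      fun x y => by
        change (G.graph ⊔ SimpleGraph.edge v w).Adj x y ↔ _
        rw [SimpleGraph.sup_adj, SimpleGraph.adj_edge]
    have hH : H.graph.Adj v w := (hadj v w).2 (Or.inr ⟨rfl, hvw⟩)
    have hiso : (H.deleteEdge v w).Isomorphic G := by
      refine ⟨⟨Equiv.refl _, fun {x y} => ?_⟩, fun _ => rfl⟩
      change G.graph.Adj x y ↔ (H.graph.deleteEdges {s(v, w)}).Adj x y
      refine .trans ?_ SimpleGraph.deleteEdges_adj.symm
      constructor
      · refine fun h => ⟨(hadj x y).2 (Or.inl h), fun he => ?_⟩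
        exact hnadj ((congrArg (· ∈ G.graph.edgeSet) (Set.mem_singleton_iff.1 he)).mp h)
      · rintro ⟨h, h'⟩
        rcases (hadj x y).1 h with h | h
        · exact h
        · exact (h' (Set.mem_singleton_iff.2 h.1.symm)).elim
    have e1 := ih (Nat.card {p : H.V × H.V // ¬ H.graph.Adj p.1 p.2}) (by
      rw [← hn]
      refine natCard_lt_of_injective
        (f := fun p : {p : H.V × H.V // ¬ H.graph.Adj p.1 p.2} =>
          ⟨p.1, fun h => p.2 ((hadj _ _).2 (Or.inl h))⟩)
        (b := (⟨(v, w), hnadj⟩ : {p : G.V × G.V // ¬ G.graph.Adj p.1 p.2}))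
        (fun p q h => by exact Subtype.ext (congrArg (fun p => p.1) h)) fun p h => ?_
      refine p.2 ?_
      rw [show p.1 = (v, w) from Subtype.ext_iff.1 h]
      exact hH) H hN rfl
    have e2 := ih (Nat.card {p : (H.contractEdge v w hvw).V × (H.contractEdge v w hvw).V //
        ¬ (H.contractEdge v w hvw).graph.Adj p.1 p.2}) (by
      rw [← hn]
      refine natCard_lt_of_injective
        (f := fun p : {p : (H.contractEdge v w hvw).V × (H.contractEdge v w hvw).V //
            ¬ (H.contractEdge v w hvw).graph.Adj p.1 p.2} => ⟨(p.1.1.1, p.1.2.1), fun h => p.2 ((contractEdge_adj (G := H) hvw _ _).2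
            ⟨fun h' => h.ne (congrArg Subtype.val h'), p.1.1.1, p.1.2.1,
              contractVertex_of_ne (G := H) hvw p.1.1.2, contractVertex_of_ne (G := H) hvw p.1.2.2,
              (hadj p.1.1.1 p.1.2.1).2 (Or.inl h)⟩)⟩)
        (b := (⟨(w, w), G.graph.loopless.irrefl w⟩ : {p : G.V × G.V // ¬ G.graph.Adj p.1 p.2}))
        (fun p q h => ?_) fun p h => ?_
      · have h' := Prod.ext_iff.1 (Subtype.ext_iff.1 h)
        exact Subtype.ext (Prod.ext (Subtype.ext h'.1) (Subtype.ext h'.2))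
      · exact p.1.1.2 (Prod.ext_iff.1 (Subtype.ext_iff.1 h)).1) (H.contractEdge v w hvw)
      ((Nat.card_le_card_of_injective (Subtype.val : {x : G.V // x ≠ w} → G.V)
        Subtype.val_injective).trans hN) rfl
    rw [← graphClass_eq_of_isomorphic R hiso, graphClass_chromatic R H v w hH, e1, e2,
      ← Finset.sum_add_distrib]
    refine Finset.sum_congr rfl fun k _ => ?_
    rw [← hiso.coloringSum_eq R k, coloringSum_chromatic R k hH, map_add, smul_add]

open Classical in
theorem coloringSum_zero (G : WeightedGraph) :
    G.coloringSum R 0 = if IsEmpty G.V then Finsupp.single 0 1 else 0 := by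
  unfold coloringSum
  by_cases h : IsEmpty G.V
  · rw [if_pos h, Fintype.sum_eq_single isEmptyElim fun κ hκ => (hκ (Subsingleton.elim _ _)).elim]
    rw [if_pos ⟨fun i => i.elim0, fun x => isEmptyElim x⟩, Subsingleton.elim (G.colorWeight _) 0]
  · rw [not_isEmpty_iff] at h
    rw [if_neg (not_isEmpty_iff.2 h)]
    exact Finset.sum_eq_zero fun κ _ => (κ h.some).elim0

/-- Extend a colouring of the complement of `s` by giving the colour `0` to the elements of `s`. -/
noncomputable def consColoring (G : WeightedGraph) (s : Set G.V) {k : ℕ}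
    (κ : (G.induce sᶜ).V → Fin k) (x : G.V) : Fin (k + 1) :=
  open Classical in if h : x ∈ s then 0 else (κ ⟨x, h⟩).succ

theorem consColoring_of_mem {s : Set G.V} {k : ℕ} (κ : (G.induce sᶜ).V → Fin k) {x : G.V} (h : x ∈ s) :
    G.consColoring s κ x = 0 := dif_pos h

theorem consColoring_of_notMem {s : Set G.V} {k : ℕ} (κ : (G.induce sᶜ).V → Fin k) {x : G.V}
    (h : x ∉ s) : G.consColoring s κ x = (κ ⟨x, h⟩).succ := dif_neg h

theorem consColoring_eq_zero_iff {s : Set G.V} {k : ℕ} (κ : (G.induce sᶜ).V → Fin k) {x : G.V} :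
    G.consColoring s κ x = 0 ↔ x ∈ s := by
  by_cases h : x ∈ s
  · simp [consColoring_of_mem κ h, h]
  · simp [consColoring_of_notMem κ h, h]

theorem isColoring_consColoring (G : WeightedGraph) (s : Set G.V) {k : ℕ}
    (κ : (G.induce sᶜ).V → Fin k) : G.IsColoring (G.consColoring s κ) ↔
      (s.Nonempty ∧ (G.induce s).graph = ⊥) ∧ (G.induce sᶜ).IsColoring κ := by
  have hs : ∀ x (hx : x ∉ s), G.consColoring s κ x = (κ ⟨x, hx⟩).succ :=
    fun x hx => consColoring_of_notMem κ hx
  constructor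
  · rintro ⟨h1, h2⟩
    refine ⟨⟨?_, ?_⟩, fun i => ?_, fun x y hxy hκ => ?_⟩
    · obtain ⟨x, hx⟩ := h1 0
      exact ⟨x, (consColoring_eq_zero_iff κ).1 hx⟩
    · refine SimpleGraph.ext (funext fun x => funext fun y => propext ⟨fun h => ?_, False.elim⟩)
      have h' : G.graph.Adj x.1 y.1 := h
      exact h2 _ _ h' ((consColoring_of_mem κ x.2).trans (consColoring_of_mem κ y.2).symm)
    · obtain ⟨x, hx⟩ := h1 i.succ
      have hxs : x ∉ s := fun h => (Fin.succ_ne_zero i) (hx.symm.trans (consColoring_of_mem κ h))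
      exact ⟨⟨x, hxs⟩, Fin.succ_injective _ ((hs x hxs).symm.trans hx)⟩
    · have h' : G.graph.Adj x.1 y.1 := hxy
      exact h2 _ _ h' ((hs x.1 x.2).trans ((congrArg Fin.succ hκ).trans (hs y.1 y.2).symm))
  · rintro ⟨⟨⟨x, hx⟩, hbot⟩, h1, h2⟩
    refine ⟨fun i => ?_, fun x y hxy hκ => ?_⟩
    · refine Fin.cases ⟨x, consColoring_of_mem κ hx⟩ (fun i => ?_) i
      obtain ⟨y, hy⟩ := h1 i
      exact ⟨y.1, (hs y.1 y.2).trans (congrArg Fin.succ hy)⟩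
    · by_cases hx : x ∈ s
      · have hy : y ∈ s := by
          rwa [← consColoring_eq_zero_iff κ, ← hκ, consColoring_eq_zero_iff]
        have : (G.induce s).graph.Adj ⟨x, hx⟩ ⟨y, hy⟩ := hxy
        rw [hbot] at this
        exact this
      · have hy : y ∉ s := by
          rwa [← consColoring_eq_zero_iff κ, ← hκ, consColoring_eq_zero_iff]
        refine h2 ⟨x, hx⟩ ⟨y, hy⟩ hxy (Fin.succ_injective _ ?_)
        exact (hs x hx).symm.trans (hκ.trans (hs y hy))

theorem colorWeight_consColoring (G : WeightedGraph) (s : Set G.V) {k : ℕ}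
    (κ : (G.induce sᶜ).V → Fin k) : G.colorWeight (G.consColoring s κ) =
      Fin.cons (∑ x, ((G.induce s).weight x : ℕ)) ((G.induce sᶜ).colorWeight κ) := by
  classical
  funext i
  unfold colorWeight
  have hsplit := (Fintype.sum_subtype_add_sum_subtype (fun x => x ∈ s)
    fun x => if G.consColoring s κ x = i then (G.weight x : ℕ) else 0).symm
  refine hsplit.trans ?_
  have h1 : ∀ x : {x // x ∈ s}, (if G.consColoring s κ x.1 = i then (G.weight x : ℕ) else 0) =
      if 0 = i then (G.weight x : ℕ) else 0 := fun x => by rw [consColoring_of_mem κ x.2]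
  have h2 : ∀ x : {x // x ∉ s}, (if G.consColoring s κ x.1 = i then (G.weight x : ℕ) else 0) =
      if (κ x).succ = i then (G.weight x : ℕ) else 0 := fun x => by
    rw [consColoring_of_notMem κ x.2]; rfl
  rw [Finset.sum_congr rfl fun x _ => h1 x, Finset.sum_congr rfl fun x _ => h2 x]
  refine Fin.cases ?_ (fun i => ?_) i
  · simp only [if_true, Fin.succ_ne_zero, if_false, Finset.sum_const_zero, add_zero, Fin.cons_zero]
    exact Fintype.sum_equiv (κ := (G.induce s).V)
      (show {x // x ∈ s} ≃ (G.induce s).V from Equiv.refl _) _ _ fun _ => rfl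
  · simp only [(Fin.succ_ne_zero i).symm, if_false, Finset.sum_const_zero, zero_add, Fin.cons_succ,
      Fin.succ_inj]
    exact Fintype.sum_equiv (κ := (G.induce sᶜ).V)
      (show {x // x ∉ s} ≃ (G.induce sᶜ).V from Equiv.refl _) _ _ fun _ => rfl

open Classical in
/-- A colouring consists of its first colour class, a nonempty independent set, and a colouring of
the rest. -/
theorem coloringSum_succ (G : WeightedGraph) [Fintype (Set G.V)] (k : ℕ) :
    G.coloringSum R (k + 1) = ∑ s : Set G.V, if s.Nonempty ∧ (G.induce s).graph = ⊥ then
      Finsupp.lmapDomain R R (Fin.cons (α := fun _ => ℕ) (∑ x, ((G.induce s).weight x : ℕ)))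
        ((G.induce sᶜ).coloringSum R k) else 0 := by
  unfold coloringSum
  rw [← Finset.sum_fiberwise_of_maps_to (t := (Finset.univ : Finset (Set G.V)))
    (g := fun κ : G.V → Fin (k + 1) => {x | κ x = 0}) fun _ _ => Finset.mem_univ _]
  refine Finset.sum_congr rfl fun s _ => ?_
  have h1 : ∀ κ : (G.induce sᶜ).V → Fin k, (if G.IsColoring (G.consColoring s κ) then
      Finsupp.single (G.colorWeight (G.consColoring s κ)) (1 : R) else 0) =
      if s.Nonempty ∧ (G.induce s).graph = ⊥ then
        Finsupp.lmapDomain R R (Fin.cons (α := fun _ => ℕ) (∑ x, ((G.induce s).weight x : ℕ)))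
        (if (G.induce sᶜ).IsColoring κ then
          Finsupp.single ((G.induce sᶜ).colorWeight κ) (1 : R) else 0) else 0 := by
    intro κ
    rw [colorWeight_consColoring]
    by_cases h : s.Nonempty ∧ (G.induce s).graph = ⊥
    · by_cases hκ : (G.induce sᶜ).IsColoring κ
      · rw [if_pos ((isColoring_consColoring G s κ).2 ⟨h, hκ⟩), if_pos h, if_pos hκ,
          Finsupp.lmapDomain_apply, Finsupp.mapDomain_single]
      · rw [if_neg fun h' => hκ ((isColoring_consColoring G s κ).1 h').2, if_pos h, if_neg hκ,
          map_zero]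
    · rw [if_neg fun h' => h ((isColoring_consColoring G s κ).1 h').1, if_neg h]
  have h2 : ∑ κ : (G.induce sᶜ).V → Fin k, (if G.IsColoring (G.consColoring s κ) then
      Finsupp.single (G.colorWeight (G.consColoring s κ)) (1 : R) else 0) =
      ∑ κ : G.V → Fin (k + 1) with {x | κ x = 0} = s,
        if G.IsColoring κ then Finsupp.single (G.colorWeight κ) (1 : R) else 0 := by
    refine Finset.sum_of_injOn (fun κ => G.consColoring s κ) ?_ ?_ ?_ (fun _ _ => rfl)
    · intro κ _ κ' _ h
      funext x
      have := congrFun h x.1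
      exact Fin.succ_injective _ ((consColoring_of_notMem κ x.2).symm.trans
        (this.trans (consColoring_of_notMem κ' x.2)))
    · intro κ _
      refine Finset.mem_coe.2 (Finset.mem_filter.2 ⟨Finset.mem_univ _, Set.ext fun x => ?_⟩)
      exact consColoring_eq_zero_iff κ
    · intro κ hκ hn
      have hs : ∀ x, κ x = 0 ↔ x ∈ s := fun x => by rw [← (Finset.mem_filter.1 hκ).2]; rfl
      refine (hn ⟨fun x => (κ x.1).pred fun h => x.2 ((hs x.1).1 h), Finset.mem_univ _,
        funext fun x => ?_⟩).elim
      by_cases hx : x ∈ s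
      · exact (consColoring_of_mem _ hx).trans ((hs x).2 hx).symm
      · exact (consColoring_of_notMem _ hx).trans (Fin.succ_pred _ _)
  rw [← h2, Finset.sum_congr rfl fun κ _ => h1 κ]
  split_ifs
  · rw [map_sum]
  · exact Finset.sum_const_zero

end WeightedGraph

/-! ### Intersection graphs of subdiagrams -/

namespace TrivalentDiagram

variable {D : TrivalentDiagram}

/-- The component of the diagram given by a component of a subdiagram. -/
def subComponent (D : TrivalentDiagram) (s : Set D.Component) (q : (D.sub s).Component) : s :=
  Quot.lift (fun v : (D.sub s).Vertex => (⟨D.comp (Sum.map Subtype.val Subtype.val v), by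
      rcases v with c | i
      · exact c.2
      · exact i.2⟩ : s))
    (fun u w ⟨h, hu, hw⟩ => Subtype.ext (by
      subst hu hw
      have h1 : ∀ l : (D.sub s).Leg, Sum.map Subtype.val Subtype.val (legVertex l) =
          legVertex (D.subIncl s l) := by
        rintro (c | x) <;> rfl
      have h2 : D.subIncl s ((D.sub s).pair h) = D.pair (D.subIncl s h) := D.subIncl_subPair s h
      exact (congrArg D.comp (h1 _)).trans ((D.comp_legVertex_pair _).symm.trans
        (congrArg D.comp ((congrArg legVertex h2).symm.trans (h1 _).symm)))) ) q

theorem IsChordDiagram.subComponent_bijective (hD : D.IsChordDiagram) (s : Set D.Component) :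
    Function.Bijective (D.subComponent s) := by
  constructor
  · intro q q' h
    obtain ⟨c, rfl⟩ := (hD.sub s).exists_comp q
    obtain ⟨c', rfl⟩ := (hD.sub s).exists_comp q'
    have h' : D.comp (Sum.inl c.1) = D.comp (Sum.inl c'.1) := congrArg Subtype.val h
    refine ((hD.sub s).comp_eq_iff c c').2 ?_
    rcases (hD.comp_eq_iff _ _).1 h' with h' | h'
    · exact Or.inl (Subtype.ext h')
    · exact Or.inr (Subtype.ext (h'.trans (hD.mate_sub s c).symm))
  · rintro ⟨q, hq⟩
    obtain ⟨c, rfl⟩ := hD.exists_comp q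
    exact ⟨(D.sub s).comp (Sum.inl ⟨c, hq⟩), rfl⟩

/-- The intersection graph of a subdiagram is an induced subgraph. -/
theorem IsChordDiagram.intersectionGraph_sub (hD : D.IsChordDiagram) (s : Set D.Component) :
    (D.sub s).intersectionGraph.Isomorphic (D.intersectionGraph.induce s) := by
  let e := Equiv.ofBijective (D.subComponent s) (hD.subComponent_bijective s)
  have he : ∀ q q', e q = e q' ↔ q = q' := fun q q' => e.apply_eq_iff_eq
  have aux : ∀ q q' : (D.sub s).Component,
      (∃ x x' y y' : (D.sub s).Circ, (D.sub s).comp (Sum.inl x) = q ∧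
        (D.sub s).comp (Sum.inl x') = q ∧ (D.sub s).comp (Sum.inl y) = q' ∧
        (D.sub s).comp (Sum.inl y') = q' ∧ sbtw x y x' ∧ sbtw x' y' x) ↔
      ∃ x x' y y' : D.Circ, D.comp (Sum.inl x) = (e q).1 ∧ D.comp (Sum.inl x') = (e q).1 ∧
        D.comp (Sum.inl y) = (e q').1 ∧ D.comp (Sum.inl y') = (e q').1 ∧
        sbtw x y x' ∧ sbtw x' y' x := by
    intro q q'
    constructor
    · rintro ⟨x, x', y, y', rfl, h2, rfl, h4, h5, h6⟩
      exact ⟨x.1, x'.1, y.1, y'.1, rfl, congrArg (fun q => (e q).1) h2, rfl,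
        congrArg (fun q => (e q).1) h4, h5, h6⟩
    · rintro ⟨x, x', y, y', h1, h2, h3, h4, h5, h6⟩
      have hs : ∀ (z : D.Circ) (r : (D.sub s).Component) (hz : D.comp (Sum.inl z) = (e r).1),
          ∃ hz' : D.comp (Sum.inl z) ∈ s, (D.sub s).comp (Sum.inl ⟨z, hz'⟩) = r :=
        fun z r hz => ⟨hz ▸ (e r).2, (he _ _).1 (Subtype.ext hz)⟩
      obtain ⟨_, h1⟩ := hs x q h1
      obtain ⟨_, h2⟩ := hs x' q h2
      obtain ⟨_, h3⟩ := hs y q' h3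
      obtain ⟨_, h4⟩ := hs y' q' h4
      exact ⟨_, _, _, _, h1, h2, h3, h4, h5, h6⟩
  refine ⟨⟨e, fun {q q'} => ?_⟩, fun _ => rfl⟩
  refine (intersectionGraph_adj _ _).trans (.trans ?_ (intersectionGraph_adj _ _).symm)
  exact and_congr (not_congr (Subtype.ext_iff.symm.trans (he _ _)))
    (or_congr (aux q q').symm (aux q' q).symm)

theorem IsChordDiagram.deg_eq (hD : D.IsChordDiagram) : D.deg = Nat.card D.Component := by
  have h := hD.two_mul_card_component
  rw [Nat.card_eq_fintype_card (α := D.Vertex)] at h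
  unfold deg
  omega

theorem IsChordDiagram.deg_sub (hD : D.IsChordDiagram) (s : Set D.Component) :
    (D.sub s).deg = ∑ x, ((D.intersectionGraph.induce s).weight x : ℕ) := by
  rw [(hD.sub s).deg_eq, Nat.card_congr (Equiv.ofBijective _ (hD.subComponent_bijective s))]
  have h : ∀ x, ((D.intersectionGraph.induce s).weight x : ℕ) = 1 := fun _ => rfl
  rw [Finset.sum_congr rfl fun x _ => h x, Finset.sum_const, Finset.card_univ, smul_eq_mul, mul_one,
    ← Nat.card_eq_fintype_card]
  rfl

theorem IsChordDiagram.deg_eq_zero_iff (hD : D.IsChordDiagram) :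
    D.deg = 0 ↔ IsEmpty D.Component := by
  rw [hD.deg_eq, Nat.card_eq_zero]
  exact ⟨fun h => h.resolve_right fun h => not_finite D.Component, Or.inl⟩

/-! ### Diagrams of degree zero -/

/-- A diagram of degree zero has no vertices, since the number of vertices is even. -/
theorem isEmpty_vertex_of_deg_eq_zero (h : D.deg = 0) : IsEmpty D.Vertex := by
  have h1 := two_mul_card_quot_of_involutive (r := fun l l' : D.Leg => l' = D.pair l) D.pair_pair
    D.pair_ne fun _ _ => Iff.rfl
  rw [deg_eq_card] at h
  rw [Nat.card_eq_fintype_card (α := D.Leg), Fintype.card_sum, Fintype.card_prod,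
    Fintype.card_fin] at h1
  rw [← Fintype.card_eq_zero_iff, Fintype.card_sum]
  omega

theorem equivalent_circle_of_isEmpty (h : IsEmpty D.Vertex) : D.Equivalent circle := by
  have h1 : IsEmpty D.Circ := (isEmpty_sum.1 h).1
  have h2 : IsEmpty D.Inner := (isEmpty_sum.1 h).2
  exact ⟨Equiv.equivOfIsEmpty _ Empty, Equiv.equivOfIsEmpty _ Empty, fun _ => 0,
    fun a => isEmptyElim a, fun l => l.elim (fun c => isEmptyElim c) fun x => isEmptyElim x.1⟩

theorem isChordDiagram_circle : circle.IsChordDiagram := inferInstanceAs (IsEmpty Empty)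

instance isEmpty_component_circle : IsEmpty circle.Component :=
  ⟨fun q => by
    rcases q with ⟨c | i⟩
    · exact Empty.elim c
    · exact Empty.elim i⟩

theorem deg_circle : circle.deg = 0 := isChordDiagram_circle.deg_eq_zero_iff.2 inferInstance

theorem signedCount_circle : signedCount False circle = 1 := by
  rw [isChordDiagram_circle.signedCount_false, if_pos]
  exact SimpleGraph.ext (funext fun x => isEmptyElim (α := circle.Component) x)

theorem sub_circle_equivalent (s : Set circle.Component) : (circle.sub s).Equivalent circle :=
  equivalent_circle_of_isEmpty ⟨fun v => v.elim (fun c => Empty.elim c.1) fun i => Empty.elim i.1⟩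

end TrivalentDiagram

open TrivalentDiagram

section Expansion

variable {R : Type*} [Field R]

/-- The class of the circle without vertices is group-like. -/
theorem IsCoproduct.map_circle {Δ : DiagramSpace R →ₗ[R] DiagramSpace R ⊗[R] DiagramSpace R} (hΔ : IsCoproduct R Δ) :
    Δ (diagramClass R circle) = diagramClass R circle ⊗ₜ[R] diagramClass R circle := by
  rw [hΔ, Fintype.sum_eq_single ∅ fun s hs => (hs (Set.eq_empty_of_isEmpty s)).elim,
    diagramClass_eq_of_equivalent R (sub_circle_equivalent _),
    diagramClass_eq_of_equivalent R (sub_circle_equivalent _)]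

variable (R)

/-- The part of degree zero is spanned by the circle without vertices. -/
theorem DiagramSpace.homogeneous_zero_le :
    DiagramSpace.homogeneous R 0 ≤ Submodule.span R {diagramClass R circle} := by
  refine Submodule.span_le.2 ?_
  rintro _ ⟨D, hD, rfl⟩
  rw [diagramClass_eq_of_equivalent R
    (equivalent_circle_of_isEmpty (isEmpty_vertex_of_deg_eq_zero hD))]
  exact Submodule.mem_span_singleton_self _

/-- Linear maps that agree on diagrams of degree `d` agree on the homogeneous part of degree `d`. -/
theorem DiagramSpace.eqOn_homogeneous {M : Type*} [AddCommGroup M] [Module R M]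
    {φ ψ : DiagramSpace R →ₗ[R] M} {d : ℕ}
    (h : ∀ D : TrivalentDiagram, D.deg = d → φ (diagramClass R D) = ψ (diagramClass R D))
    {a : DiagramSpace R} (ha : a ∈ DiagramSpace.homogeneous R d) : φ a = ψ a := by
  refine LinearMap.eqOn_span (s := {x | ∃ D : TrivalentDiagram, D.deg = d ∧ x = diagramClass R D})
    ?_ ha
  rintro _ ⟨D, hD, rfl⟩
  exact h D hD

/-! ### Expansion of the universal chromatic weight system -/

/-- Adding a colour class: the weight of the new class is put in front of the weights of the other
classes. -/
noncomputable def consMap (k : ℕ) :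
    (ℕ →₀ R) →ₗ[R] ((Fin k → ℕ) →₀ R) →ₗ[R] ((Fin (k + 1) → ℕ) →₀ R) :=
  Finsupp.linearCombination R fun n => Finsupp.lmapDomain R R (Fin.cons (α := fun _ => ℕ) n)

theorem consMap_single (k n : ℕ) (r : R) (x : (Fin k → ℕ) →₀ R) :
    consMap R k (Finsupp.single n r) x =
      r • Finsupp.lmapDomain R R (Fin.cons (α := fun _ => ℕ) n) x := by
  rw [consMap, Finsupp.linearCombination_single, LinearMap.smul_apply]

/-- The signed number of embeddings to one side of the circle, recorded in the degree and omitted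
in degree zero. -/
theorem exists_reducedCount : ∃ Z : DiagramSpace R →ₗ[R] (ℕ →₀ R), ∀ D, Z (diagramClass R D) =
    if D.deg = 0 then 0 else Finsupp.single D.deg (D.signedCount False : R) :=
  exists_linearMap_diagramClass R
    (fun D => if D.deg = 0 then 0 else Finsupp.single D.deg (D.signedCount False : R))
    (fun D D' h => by simp only [h.deg_eq, h.signedCount_eq])
    (fun S p v k h => by
      simp only [IsStem.deg_resolve]
      rw [S.signedCount_stu False h, Int.cast_sub]
      split_ifs
      · rw [sub_zero]
      · rw [Finsupp.single_sub])

/-- The projection to the part of degree zero. It serves as the last factor of the iterated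
coproduct and corresponds to the colouring of the empty graph without colours. -/
theorem exists_degreeZeroPart : ∃ Z : DiagramSpace R →ₗ[R] ((Fin 0 → ℕ) →₀ R),
    ∀ D, Z (diagramClass R D) = if D.deg = 0 then Finsupp.single 0 1 else 0 :=
  exists_linearMap_diagramClass R (fun D => if D.deg = 0 then Finsupp.single 0 1 else 0)
    (fun D D' h => by simp only [h.deg_eq])
    (fun S p v k h => by
      have : S.deg ≠ 0 := fun h => (isEmpty_vertex_of_deg_eq_zero h).elim (Sum.inl p)
      simp only [IsStem.deg_resolve, this, if_false, sub_zero])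

variable {R}

/-- The iterated coproduct, with the reduced count `Z` applied to `k` factors and `Z₀` to the last
one. -/
noncomputable def iteratedCount
    (Δ : DiagramSpace R →ₗ[R] DiagramSpace R ⊗[R] DiagramSpace R)
    (Z : DiagramSpace R →ₗ[R] (ℕ →₀ R)) (Z₀ : DiagramSpace R →ₗ[R] ((Fin 0 → ℕ) →₀ R)) :
    (k : ℕ) → DiagramSpace R →ₗ[R] ((Fin k → ℕ) →₀ R)
  | 0 => Z₀
  | k + 1 => TensorProduct.lift ((consMap R k).compl₁₂ Z (iteratedCount Δ Z Z₀ k)) ∘ₗ Δ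

variable {Δ : DiagramSpace R →ₗ[R] DiagramSpace R ⊗[R] DiagramSpace R}
  {Z : DiagramSpace R →ₗ[R] (ℕ →₀ R)} {Z₀ : DiagramSpace R →ₗ[R] ((Fin 0 → ℕ) →₀ R)}

/-- On chord diagrams the iterated count is the sum of the colourings of the intersection graph:
the chords of one colour are drawn without crossings to one side of the circle. -/
theorem iteratedCount_chord (hΔ : IsCoproduct R Δ)
    (hZ : ∀ D, Z (diagramClass R D) =
      if D.deg = 0 then 0 else Finsupp.single D.deg (D.signedCount False : R))
    (hZ₀ : ∀ D, Z₀ (diagramClass R D) = if D.deg = 0 then Finsupp.single 0 1 else 0)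
    (k : ℕ) : ∀ D : TrivalentDiagram, D.IsChordDiagram →
      iteratedCount Δ Z Z₀ k (diagramClass R D) = D.intersectionGraph.coloringSum R k := by
  classical
  induction k with
  | zero =>
    intro D hD
    rw [WeightedGraph.coloringSum_zero]
    exact (hZ₀ D).trans (if_congr hD.deg_eq_zero_iff rfl rfl)
  | succ k ih =>
    intro D hD
    let : Fintype (Set D.intersectionGraph.V) := instFintypeSetComponent D
    rw [WeightedGraph.coloringSum_succ]
    change TensorProduct.lift ((consMap R k).compl₁₂ Z (iteratedCount Δ Z Z₀ k))
      (Δ (diagramClass R D)) = _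
    rw [hΔ, map_sum]
    refine Finset.sum_congr rfl fun s _ => ?_
    rw [TensorProduct.lift.tmul, LinearMap.compl₁₂_apply, ih _ (hD.sub sᶜ), hZ,
      (hD.intersectionGraph_sub sᶜ).coloringSum_eq R k, (hD.sub s).signedCount_false]
    have h1 : (D.sub s).deg = 0 ↔ ¬ s.Nonempty := by
      rw [(hD.sub s).deg_eq_zero_iff, Set.not_nonempty_iff_eq_empty, ← Set.isEmpty_coe_sort]
      exact (Equiv.ofBijective _ (hD.subComponent_bijective s)).isEmpty_congr
    have h2 : (D.sub s).intersectionGraph.graph = ⊥ ↔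
        (D.intersectionGraph.induce s).graph = ⊥ :=
      (hD.intersectionGraph_sub s).graph_eq_bot_iff
    by_cases hs : s.Nonempty
    · by_cases hb : (D.intersectionGraph.induce s).graph = ⊥
      · rw [if_neg fun h => h1.1 h hs, if_pos (h2.2 hb), if_pos ⟨hs, hb⟩, Int.cast_one, consMap_single,
          one_smul, hD.deg_sub]
        rfl
      · rw [if_neg fun h => h1.1 h hs, if_neg fun h => hb (h2.1 h), if_neg fun h => hb h.2,
          Int.cast_zero, Finsupp.single_zero, map_zero, LinearMap.zero_apply]
    · rw [if_pos (h1.2 hs), if_neg fun h => hs h.1, map_zero, LinearMap.zero_apply]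

theorem iteratedCount_succ_circle (hΔ : IsCoproduct R Δ)
    (hZ : Z (diagramClass R circle) = 0) (k : ℕ) :
    iteratedCount Δ Z Z₀ (k + 1) (diagramClass R circle) = 0 := by
  change TensorProduct.lift _ (Δ (diagramClass R circle)) = _
  rw [hΔ.map_circle, TensorProduct.lift.tmul, LinearMap.compl₁₂_apply, hZ, map_zero,
    LinearMap.zero_apply]

/-- The reduced count vanishes on the unit, so only one summand of the coproduct of a primitive
element contributes. -/
theorem iteratedCount_succ_primitive (hZ : Z (diagramClass R circle) = 0) {a : DiagramSpace R}
    (ha : IsPrimitiveFor R Δ a) (k : ℕ) :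
    iteratedCount Δ Z Z₀ (k + 1) a =
      consMap R k (Z a) (iteratedCount Δ Z Z₀ k (diagramClass R circle)) := by
  change TensorProduct.lift _ (Δ a) = _
  rw [ha, map_add, TensorProduct.lift.tmul, TensorProduct.lift.tmul, LinearMap.compl₁₂_apply,
    LinearMap.compl₁₂_apply, hZ, map_zero, LinearMap.zero_apply, add_zero]

/-- The universal chromatic weight system is given by the expansion of graphs in complete
graphs. -/
theorem exists_isUniversalChromatic [CharZero R] (hΔ : IsCoproduct R Δ)
    (hZ : ∀ D, Z (diagramClass R D) =
      if D.deg = 0 then 0 else Finsupp.single D.deg (D.signedCount False : R))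
    (hZ₀ : ∀ D, Z₀ (diagramClass R D) = if D.deg = 0 then Finsupp.single 0 1 else 0) :
    ∃ Γ : DiagramSpace R →ₗ[R] ChromaticSpace R, IsUniversalChromatic R Γ ∧
      ∀ D, Γ (diagramClass R D) = ∑ k ∈ Finset.range (D.deg + 1), ((k.factorial : R)⁻¹) •
        WeightedGraph.completeClass R k (iteratedCount Δ Z Z₀ k (diagramClass R D)) := by
  obtain ⟨Γ, hΓ⟩ := exists_linearMap_diagramClass R (fun D =>
      ∑ k ∈ Finset.range (D.deg + 1), ((k.factorial : R)⁻¹) •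
        WeightedGraph.completeClass R k (iteratedCount Δ Z Z₀ k (diagramClass R D)))
    (fun D D' h => by simp only [h.deg_eq, diagramClass_eq_of_equivalent R h])
    (fun S p v k h => by
      simp only [IsStem.deg_resolve, diagramClass_stu R (isSTU_resolve h), map_sub, smul_sub,
        Finset.sum_sub_distrib])
  refine ⟨Γ, fun D hD => ?_, hΓ⟩
  rw [hΓ, WeightedGraph.graphClass_eq_sum R D.intersectionGraph D.deg hD.deg_eq.ge]
  exact Finset.sum_congr rfl fun k _ => by rw [iteratedCount_chord hΔ hZ hZ₀ k D hD]

theorem IsUniversalChromatic.eq {Γ Γ' : DiagramSpace R →ₗ[R] ChromaticSpace R}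
    (h : IsUniversalChromatic R Γ) (h' : IsUniversalChromatic R Γ') : Γ = Γ' :=
  diagramSpace_hom_ext_chord R fun D hD => by rw [h D hD, h' D hD]

theorem IsEmbeddingWeightSystem.eq {E E' : DiagramSpace R →ₗ[R] R}
    (h : IsEmbeddingWeightSystem R E) (h' : IsEmbeddingWeightSystem R E') : E = E' :=
  diagramSpace_hom_ext R fun D => by rw [h D, h' D]

theorem IsCoproduct.eq {Δ Δ' : DiagramSpace R →ₗ[R] DiagramSpace R ⊗[R] DiagramSpace R}
    (h : IsCoproduct R Δ) (h' : IsCoproduct R Δ') : Δ = Δ' :=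
  diagramSpace_hom_ext R fun D => by rw [h D, h' D]

/-- The part of a diagram inside the circle and the part outside are embedded independently. -/
theorem IsEmbeddingWeightSystem.eq_lift {E ζ : DiagramSpace R →ₗ[R] R} (hΔ : IsCoproduct R Δ)
    (hE : IsEmbeddingWeightSystem R E)
    (hζ : ∀ D, ζ (diagramClass R D) = (D.signedCount False : R)) :
    E = TensorProduct.lift ((LinearMap.mul R R).compl₁₂ ζ ζ) ∘ₗ Δ := by
  refine diagramSpace_hom_ext_chord R fun D hD => ?_
  rw [hE, ← signedCount_true, hD.signedCount_true_eq_sum, LinearMap.comp_apply, hΔ, map_sum,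
    Int.cast_sum]
  refine Finset.sum_congr rfl fun s _ => ?_
  rw [TensorProduct.lift.tmul, LinearMap.compl₁₂_apply, LinearMap.mul_apply', hζ, hζ, Int.cast_mul]

theorem complete_one_isomorphic (d : ℕ+) (u : Fin 0 → ℕ) :
    (WeightedGraph.complete (Fin.cons (α := fun _ => ℕ) (d : ℕ) u)).Isomorphic
      (WeightedGraph.singleVertex d) := by
  refine ⟨⟨Equiv.ofUnique (Fin 1) Unit, fun {x y} => ?_⟩, fun x => ?_⟩
  · have : x = y := Subsingleton.elim (α := Fin 1) x y
    subst this
    exact iff_of_false (fun h => h.ne rfl) (fun h => h.ne rfl)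
  · have : x = (0 : Fin 1) := Subsingleton.elim (α := Fin 1) x 0
    subst this
    exact (PNat.coe_toPNat' d).symm

end Expansion

theorem mainTheorem5 (R : Type*) [Field R] [CharZero R] :
    (∃! Δ, IsCoproduct R Δ) ∧
    (∃! Γ, IsUniversalChromatic R Γ) ∧
    (∃! E, IsEmbeddingWeightSystem R E) ∧
    ∀ (Δ : DiagramSpace R →ₗ[R] DiagramSpace R ⊗[R] DiagramSpace R)
      (Γ : DiagramSpace R →ₗ[R] ChromaticSpace R) (E : DiagramSpace R →ₗ[R] R),
      IsCoproduct R Δ → IsUniversalChromatic R Γ → IsEmbeddingWeightSystem R E →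
      (∀ a ∈ DiagramSpace.homogeneous R 0, IsPrimitiveFor R Δ a → a = 0) ∧
      ∀ (d : ℕ+), ∀ a ∈ DiagramSpace.homogeneous R d, IsPrimitiveFor R Δ a →
        Γ a = ((1 / 2 : R) * E a) • graphClass R (WeightedGraph.singleVertex d) := by
  obtain ⟨Δ₀, hΔ₀⟩ := exists_isCoproduct R
  obtain ⟨Z, hZ⟩ := exists_reducedCount R
  obtain ⟨Z₀, hZ₀⟩ := exists_degreeZeroPart R
  obtain ⟨ζ, hζ⟩ := exists_signedCount R False
  obtain ⟨E₀, hE₀'⟩ := exists_signedCount R True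
  obtain ⟨Γ₀, hΓ₀, hΓ₀'⟩ := exists_isUniversalChromatic hΔ₀ hZ hZ₀
  have hE₀ : IsEmbeddingWeightSystem R E₀ := fun D => by rw [hE₀', signedCount_true]
  have hζ1 : ζ (diagramClass R circle) = 1 := by rw [hζ, signedCount_circle, Int.cast_one]
  refine ⟨⟨Δ₀, hΔ₀, fun Δ h => h.eq hΔ₀⟩, ⟨Γ₀, hΓ₀, fun Γ h => h.eq hΓ₀⟩,
    ⟨E₀, hE₀, fun E h => h.eq hE₀⟩, fun Δ Γ E hΔ hΓ hE => ?_⟩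
  obtain rfl := hΔ.eq hΔ₀
  obtain rfl := hΓ.eq hΓ₀
  have hEa : ∀ a, E a = TensorProduct.lift ((LinearMap.mul R R).compl₁₂ ζ ζ) (Δ a) :=
    fun a => congrArg (fun φ : DiagramSpace R →ₗ[R] R => φ a) (hE.eq_lift hΔ hζ)
  have hprim : ∀ a, IsPrimitiveFor R Δ a → E a = 2 * ζ a := by
    intro a ha
    rw [hEa, ha, map_add, TensorProduct.lift.tmul, TensorProduct.lift.tmul,
      LinearMap.compl₁₂_apply, LinearMap.compl₁₂_apply, LinearMap.mul_apply',
      LinearMap.mul_apply', hζ1]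
    ring
  refine ⟨fun a ha hp => ?_, fun d a ha hp => ?_⟩
  · obtain ⟨c, rfl⟩ := Submodule.mem_span_singleton.1 (DiagramSpace.homogeneous_zero_le R ha)
    have h1 := hprim _ hp
    rw [hEa, map_smul, map_smul, map_smul, hΔ.map_circle, TensorProduct.lift.tmul,
      LinearMap.compl₁₂_apply, LinearMap.mul_apply', hζ1] at h1
    simp only [smul_eq_mul, mul_one] at h1
    -- `2 * c = c` from the two ways to compute the count of embeddings
    have h2 : c = 0 := by linear_combination -h1
    rw [h2, zero_smul]
  · have hd : (d : ℕ) ≠ 0 := d.ne_zero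
    have hZ1 : Z (diagramClass R circle) = 0 := by rw [hZ, if_pos deg_circle]
    have hZa : Z a = Finsupp.single (d : ℕ) (ζ a) :=
      DiagramSpace.eqOn_homogeneous R (ψ := Finsupp.lsingle (d : ℕ) ∘ₗ ζ) (fun D hD => by
        rw [hZ, hD, if_neg hd, LinearMap.comp_apply, hζ, Finsupp.lsingle_apply]) ha
    have hZ₀a : Z₀ a = 0 :=
      DiagramSpace.eqOn_homogeneous R (ψ := 0) (fun D hD => by
        rw [hZ₀, hD, if_neg hd, LinearMap.zero_apply]) ha
    have hΓa : Γ a = ∑ k ∈ Finset.range (d + 1), ((k.factorial : R)⁻¹) •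
        WeightedGraph.completeClass R k (iteratedCount Δ Z Z₀ k a) := by
      have h1 := DiagramSpace.eqOn_homogeneous R (φ := Γ)
        (ψ := ∑ k ∈ Finset.range (d + 1), ((k.factorial : R)⁻¹) •
          (WeightedGraph.completeClass R k ∘ₗ iteratedCount Δ Z Z₀ k)) (fun D hD => by
        rw [hΓ₀', hD]
        simp only [LinearMap.sum_apply, LinearMap.smul_apply, LinearMap.comp_apply]) ha
      rw [h1]
      simp only [LinearMap.sum_apply, LinearMap.smul_apply, LinearMap.comp_apply]
    -- only the colourings with a single colour contribute
    rw [hΓa, Finset.sum_eq_single 1, hprim a hp]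
    · rw [iteratedCount_succ_primitive hZ1 hp, hZa]
      have h0 : iteratedCount Δ Z Z₀ 0 (diagramClass R circle) = Finsupp.single 0 1 :=
        (hZ₀ circle).trans (if_pos deg_circle)
      rw [h0, consMap_single, Finsupp.lmapDomain_apply, Finsupp.mapDomain_single, map_smul,
        WeightedGraph.completeClass, Finsupp.linearCombination_single, one_smul,
        WeightedGraph.graphClass_eq_of_isomorphic R (complete_one_isomorphic d 0),
        Nat.factorial_one, Nat.cast_one, inv_one, one_smul]
      congr 1
      field_simp
    · rintro (_ | _ | k) _ hk
      · have : iteratedCount Δ Z Z₀ 0 a = 0 := hZ₀a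
        rw [this, map_zero, smul_zero]
      · exact (hk rfl).elim
      · rw [iteratedCount_succ_primitive hZ1 hp, iteratedCount_succ_circle hΔ hZ1, map_zero,
          map_zero, smul_zero]
    · intro h
      exact (h (Finset.mem_range.2 (by omega))).elim
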